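/- **Setting.** Let $n>1$ and let $(M^{4n},Q,\omega)$ be a quaternionic skew-Hermitian manifold: $M$ is a smooth manifold of dimension $4n$; $Q\subset \mathrm{End}(TM)$ is an almost quaternionic structure, that is, a rank 3 subbundle locally spanned by smooth triples $(I_1,I_2,I_3)$ with $I_1^2=I_2^2=I_3^2=I_1I_2I_3=-1$ (a triple of this kind spanning $Q_m$ is an admissible frame at $m$); $\omega$ is a smooth non-degenerate 2-form with $\omega(I_aX,I_aY)=\omega(X,Y)$ for all admissible frames; and there is a torsion-free linear connection $\nabla=\nabla^{Q,\omega}$ (necessarily unique) that preserves $Q$ and $\omega$. Let $R^{Q,\omega}$ be its curvature tensor. **The Swann bundle.** Let $S_0=(\Lambda^{4n}T^*M\setminus 0)/\{\pm1\}$, let $S$ be the bundle of admissible frames of $Q$, and let $\hat\pi:\hat M=S_0\times_M S\to M$ be their fibre product over $M$. The group $\mathbb H^\times$ acts on $\hat M$ from the right (through $\mathbb H^\times/\{\pm1\}\cong\mathbb R_+\times SO(3)$, making $\hat M$ a principal bundle): $q$ multiplies the volume element by $|q|$ and replaces $s=(I_1,I_2,I_3)$, seen as the linear map $\mathrm{Im}\,\mathbb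 H\to Q_m$ with $i,j,k\mapsto I_1,I_2,I_3$, by $s\circ \mathrm{Ad}_q$, where $\mathrm{Ad}_q(x)=qxq^{-1}$. Let $Z_0,Z_1,Z_2,Z_3$ be the fundamental vector fields of $1,i,j,k\in\mathbb H$. The connection $\nabla$ induces the connection form $\hat\theta=\theta_0+\theta_1 i+\theta_2 j+\theta_3 k$ on $\hat M$: $\theta_0$ is the connection form of $S_0$, and $\theta_1,\theta_2,\theta_3$ come from the connection form of $S$; for a local section of $S$ they pull back to the 1-forms $\varphi_a$ with $\nabla I_a=2(\varphi_c\otimes I_b-\varphi_b\otimes I_c)$ for cyclic permutations $(a,b,c)$ of $(1,2,3)$. Put $\hat{\mathcal V}=\ker d\hat\pi$ and $\hat{\mathcal H}=\ker\hat\theta$, so that $T\hat M=\hat{\mathcal V}\oplus\hat{\mathcal H}$. The almost hypercomplex structure $\hat H=(\hat I_1,\hat I_2,\hat I_3)$ on $\hat M$ is defined, for cyclic permutations $(a,b,c)$ of $(1,2,3)$, by $$\hat I_aZ_0=-Z_a,\quad \hat I_aZ_a=Z_0,\quad \hat I_aZ_b=Z_c,\quad \hat I_aZ_c=-Z_b,$$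 and, for $Y\in\hat{\mathcal H}_u$ at a point $u$ of $\hat M$ with frame $s=(I_1,I_2,I_3)$, by letting $(\hat I_a)_uY$ be the horizontal lift to $u$ of $I_a(\hat\pi_*Y)$. A 2-form $\beta$ on $\hat M$ is called $\hat H$-Hermitian if $\beta(\hat I_aX,\hat I_aY)=\beta(X,Y)$ for $a=1,2,3$ and all $X,Y$, and vertical if $\beta|_{\hat{\mathcal H}\times\hat{\mathcal H}}=0$ and $\beta|_{\hat{\mathcal H}\times\hat{\mathcal V}}=0$. **Theorem.** Suppose that $R^{Q,\omega}$ is not identically zero. Then there is no smooth vertical $\hat H$-Hermitian 2-form $\beta$ on $\hat M$ with $d\beta=0$ whose restriction $\beta|_{\hat{\mathcal V}\times\hat{\mathcal V}}$ is non-degenerate (at every point). In particular, there is no smooth vertical 2-form $\beta$ on $\hat M$ for which $\hat\pi^*\omega+\beta$ is an $\hat H$-Hermitian symplectic form. -/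

import Mathlib

open Quaternion
open scoped Manifold ContDiff Bundle Topology

set_option linter.unusedSectionVars false

section QuaternionicTriples

/-- Three elements `J 0, J 1, J 2` of a ring satisfying the quaternionic identity
`J₁² = J₂² = J₃² = J₁ J₂ J₃ = -1`. -/
structure IsQuaternionic {R : Type*} [Ring R] (J : Fin 3 → R) : Prop where
  sq : ∀ a, J a * J a = -1
  triple : J 0 * J 1 * J 2 = -1

/-- The linear map `ℍ → R` with `1 ↦ 1`, `i ↦ J 0`, `j ↦ J 1`, `k ↦ J 2`. -/
noncomputable def quatMap {R : Type*} [Ring R] [Algebra ℝ R] (J : Fin 3 → R) (q : ℍ[ℝ]) : R :=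
  q.re • (1 : R) + q.imI • J 0 + q.imJ • J 1 + q.imK • J 2

/-- The right action of a non-zero quaternion `q` on quaternionic triples, through the rotation
`Ad q`: the triple `J`, seen as the map `i, j, k ↦ J 0, J 1, J 2` on imaginary quaternions, goes to
`J ∘ Ad q`, that is `J a ↦ J(q) J a J(q)⁻¹`. -/
noncomputable def quatRot {R : Type*} [Ring R] [Algebra ℝ R] (J : Fin 3 → R) (q : ℍ[ℝ])
    (a : Fin 3) : R :=
  (normSq q)⁻¹ • (quatMap J q * J a * quatMap J (star q))

/-- The imaginary units `i, j, k`. -/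
def quatUnit : Fin 3 → ℍ[ℝ] := ![⟨0, 1, 0, 0⟩, ⟨0, 0, 1, 0⟩, ⟨0, 0, 0, 1⟩]

theorem quatUnit_re (a : Fin 3) : (quatUnit a).re = 0 := by fin_cases a <;> rfl

theorem quatUnit_imI (a : Fin 3) : (quatUnit a).imI = if a = 0 then 1 else 0 := by
  fin_cases a <;> simp <;> rfl

theorem quatUnit_imJ (a : Fin 3) : (quatUnit a).imJ = if a = 1 then 1 else 0 := by
  fin_cases a <;> simp <;> rfl

theorem quatUnit_imK (a : Fin 3) : (quatUnit a).imK = if a = 2 then 1 else 0 := by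
  fin_cases a <;> simp <;> rfl

variable {R : Type*} [Ring R] [Algebra ℝ R] {J I : Fin 3 → R}

theorem IsQuaternionic.mul_zero_one {R : Type*} [Ring R] {J : Fin 3 → R} (h : IsQuaternionic J) :
    J 0 * J 1 = J 2 := by
  have h1 : J 0 * J 1 * J 2 * J 2 = - J 2 := by rw [h.triple]; simp
  rw [mul_assoc, h.sq] at h1
  simpa using h1

theorem IsQuaternionic.mul_one_zero {R : Type*} [Ring R] {J : Fin 3 → R} (h : IsQuaternionic J) :
    J 1 * J 0 = - J 2 := by
  have h1 : J 0 * J 1 * (J 0 * J 1) = -1 := by rw [h.mul_zero_one]; exact h.sq 2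
  have h2 : J 0 * (J 0 * J 1 * (J 0 * J 1)) * J 1 = J 1 * J 0 := by
    have : J 0 * (J 0 * J 1 * (J 0 * J 1)) * J 1 = (J 0 * J 0) * (J 1 * J 0) * (J 1 * J 1) := by
      noncomm_ring
    rw [this, h.sq, h.sq]; simp
  rw [← h2, h1]
  simp [h.mul_zero_one]

theorem IsQuaternionic.mul_one_two {R : Type*} [Ring R] {J : Fin 3 → R} (h : IsQuaternionic J) :
    J 1 * J 2 = J 0 := by
  rw [← neg_neg (J 2), ← h.mul_one_zero, mul_neg, ← mul_assoc, h.sq]; simp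

theorem IsQuaternionic.mul_two_one {R : Type*} [Ring R] {J : Fin 3 → R} (h : IsQuaternionic J) :
    J 2 * J 1 = - J 0 := by
  rw [← h.mul_zero_one, mul_assoc, h.sq]; simp

theorem IsQuaternionic.mul_two_zero {R : Type*} [Ring R] {J : Fin 3 → R} (h : IsQuaternionic J) :
    J 2 * J 0 = J 1 := by
  rw [← neg_neg (J 2), ← h.mul_one_zero, neg_mul, mul_assoc, h.sq]; simp

theorem IsQuaternionic.mul_zero_two {R : Type*} [Ring R] {J : Fin 3 → R} (h : IsQuaternionic J) :
    J 0 * J 2 = - J 1 := by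
  rw [← h.mul_zero_one, ← mul_assoc, h.sq]; simp

/-- A quaternionic triple gives a homomorphic image of the quaternions. -/
def IsQuaternionic.basis (h : IsQuaternionic J) : QuaternionAlgebra.Basis R (-1 : ℝ) 0 (-1) where
  i := J 0
  j := J 1
  k := J 2
  i_mul_i := by simp [h.sq]
  j_mul_j := by simp [h.sq]
  i_mul_j := h.mul_zero_one
  j_mul_i := by simp [h.mul_one_zero]

theorem IsQuaternionic.quatMap_eq (h : IsQuaternionic J) (q : ℍ[ℝ]) :
    quatMap J q = h.basis.lift q := by
  simp [quatMap, QuaternionAlgebra.Basis.lift, IsQuaternionic.basis, Algebra.algebraMap_eq_smul_one]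

theorem IsQuaternionic.quatMap_mul (h : IsQuaternionic J) (p q : ℍ[ℝ]) :
    quatMap J (p * q) = quatMap J p * quatMap J q := by
  simp only [h.quatMap_eq]; exact h.basis.lift_mul p q

theorem quatMap_one : quatMap J 1 = 1 := by simp [quatMap]

theorem quatMap_smul (r : ℝ) (q : ℍ[ℝ]) : quatMap J (r • q) = r • quatMap J q := by
  simp [quatMap, mul_smul, smul_add]

theorem quatMap_add (p q : ℍ[ℝ]) : quatMap J (p + q) = quatMap J p + quatMap J q := by
  simp only [quatMap, re_add, imI_add, imJ_add, imK_add]; module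

theorem quatMap_sub (p q : ℍ[ℝ]) : quatMap J (p - q) = quatMap J p - quatMap J q := by
  simp only [quatMap, re_sub, imI_sub, imJ_sub, imK_sub]; module

theorem quatMap_unit (a : Fin 3) : quatMap J (quatUnit a) = J a := by
  fin_cases a <;> simp [quatMap, quatUnit_re, quatUnit_imI, quatUnit_imJ, quatUnit_imK]

theorem IsQuaternionic.quatRot_eq (h : IsQuaternionic J) (q : ℍ[ℝ]) (a : Fin 3) :
    quatRot J q a = quatMap J ((normSq q)⁻¹ • (q * quatUnit a * star q)) := by
  rw [quatMap_smul, h.quatMap_mul, h.quatMap_mul, quatMap_unit, quatRot]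

theorem IsQuaternionic.quatMap_quatRot (h : IsQuaternionic J) {q : ℍ[ℝ]} (hq : q ≠ 0) (p : ℍ[ℝ]) :
    quatMap (quatRot J q) p = quatMap J ((normSq q)⁻¹ • (q * p * star q)) := by
  have hn : normSq q ≠ 0 := by simpa using hq
  have h1 : p = p.re • (1 : ℍ[ℝ]) + p.imI • quatUnit 0 + p.imJ • quatUnit 1
      + p.imK • quatUnit 2 := by
    ext <;> simp [quatUnit_re, quatUnit_imI, quatUnit_imJ, quatUnit_imK]
  have h2 : (normSq q)⁻¹ • (q * (1 : ℍ[ℝ]) * star q) = 1 := by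
    rw [mul_one, self_mul_star, ← coe_smul]
    simp [hn]
  conv_rhs => rw [h1]
  simp only [mul_add, add_mul, smul_add, mul_smul_comm, smul_mul_assoc, quatMap_add]
  rw [quatMap, h.quatRot_eq, h.quatRot_eq, h.quatRot_eq]
  simp only [smul_comm ((normSq q)⁻¹), quatMap_smul p.re, quatMap_smul p.imI,
    quatMap_smul p.imJ, quatMap_smul p.imK, h2, quatMap_one]

theorem IsQuaternionic.quatRot (h : IsQuaternionic J) {q : ℍ[ℝ]} (hq : q ≠ 0) :
    IsQuaternionic (quatRot J q) := by
  have hn : normSq q ≠ 0 := by simpa using hq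
  have key : ∀ x y : ℍ[ℝ], ((normSq q)⁻¹ • (q * x * star q)) * ((normSq q)⁻¹ • (q * y * star q))
      = (normSq q)⁻¹ • (q * (x * y) * star q) := by
    intro x y
    have h3 : star q * q = (normSq q : ℝ) • (1 : ℍ[ℝ]) := by
      rw [star_mul_self]; ext <;> simp
    have h4 : q * x * star q * (q * y * star q) = q * x * (star q * q) * y * star q := by
      noncomm_ring
    rw [smul_mul_smul_comm, h4, h3]
    simp only [mul_smul_comm, smul_mul_assoc, smul_smul, mul_one, mul_assoc]
    congr 1
    field_simp
  have h5 : ∀ x y : ℍ[ℝ], x * y = -1 → (normSq q)⁻¹ • (q * (x * y) * star q) = -1 := by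
    intro x y hxy
    rw [hxy, mul_neg, mul_one, neg_mul, self_mul_star]
    ext <;> simp [hn]
  refine ⟨fun a => ?_, ?_⟩
  · rw [h.quatRot_eq, ← h.quatMap_mul, key, h5 _ _ (by fin_cases a <;> ext <;> simp [quatUnit_re, quatUnit_imI, quatUnit_imJ, quatUnit_imK])]
    simp [quatMap]
  · rw [h.quatRot_eq, h.quatRot_eq, h.quatRot_eq, ← h.quatMap_mul, ← h.quatMap_mul, key, key, h5 _ _
      (by ext <;> simp [quatUnit_re, quatUnit_imI, quatUnit_imJ, quatUnit_imK])]
    simp [quatMap]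

theorem IsQuaternionic.quatRot_quatRot (h : IsQuaternionic J) {q : ℍ[ℝ]} (hq : q ≠ 0)
    (p : ℍ[ℝ]) : _root_.quatRot (_root_.quatRot J q) p = _root_.quatRot J (q * p) := by
  ext a
  rw [(h.quatRot hq).quatRot_eq, h.quatMap_quatRot hq, h.quatRot_eq]
  congr 1
  simp only [map_mul, mul_smul_comm, smul_mul_assoc, smul_smul, mul_inv, star_mul, mul_assoc]

theorem quatRot_one : quatRot J 1 = J := by
  ext a; simp [quatRot, quatMap_one]

theorem IsQuaternionic.quatRot_mem_span (h : IsQuaternionic J) (q : ℍ[ℝ]) (a : Fin 3) :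
    _root_.quatRot J q a ∈ Submodule.span ℝ (Set.range J) := by
  rw [h.quatRot_eq, quatMap]
  have : ((normSq q)⁻¹ • (q * quatUnit a * star q)).re = 0 := by
    fin_cases a <;> simp [quatUnit_re, quatUnit_imI, quatUnit_imJ, quatUnit_imK] <;> right <;> ring
  rw [this, zero_smul, zero_add]
  have hm : ∀ b, J b ∈ Submodule.span ℝ (Set.range J) := fun b => Submodule.subset_span ⟨b, rfl⟩
  exact add_mem (add_mem (Submodule.smul_mem _ _ (hm _)) (Submodule.smul_mem _ _ (hm _)))
    (Submodule.smul_mem _ _ (hm _))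

theorem IsQuaternionic.span_quatRot (h : IsQuaternionic J) {q : ℍ[ℝ]} (hq : q ≠ 0) :
    Submodule.span ℝ (Set.range (_root_.quatRot J q)) = Submodule.span ℝ (Set.range J) := by
  apply le_antisymm
  · rw [Submodule.span_le]
    rintro _ ⟨a, rfl⟩
    exact h.quatRot_mem_span q a
  · rw [Submodule.span_le]
    rintro _ ⟨a, rfl⟩
    have h1 := (h.quatRot hq).quatRot_mem_span q⁻¹ a
    rwa [h.quatRot_quatRot hq, mul_inv_cancel₀ hq, quatRot_one] at h1

/-- For `I = quatRot J q`, this is a real multiple of the image of `q` under `quatMap J`. -/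
def rotor (J I : Fin 3 → R) : R := 1 - (I 0 * J 0 + I 1 * J 1 + I 2 * J 2)

theorem rotor_mul {R : Type*} [Ring R] {J I : Fin 3 → R} (h : IsQuaternionic J)
    (h' : IsQuaternionic I) (a : Fin 3) : rotor J I * J a = I a * rotor J I := by
  have e1 := h.mul_zero_one; have e2 := h.mul_one_zero; have e3 := h.mul_one_two
  have e4 := h.mul_two_one; have e5 := h.mul_two_zero; have e6 := h.mul_zero_two
  have f1 := h'.mul_zero_one; have f2 := h'.mul_one_zero; have f3 := h'.mul_one_two
  have f4 := h'.mul_two_one; have f5 := h'.mul_two_zero; have f6 := h'.mul_zero_two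
  have s0 := h.sq 0; have s1 := h.sq 1; have s2 := h.sq 2
  have t0 := h'.sq 0; have t1 := h'.sq 1; have t2 := h'.sq 2
  simp only [rotor, sub_mul, mul_sub, add_mul, mul_add, one_mul, mul_one, mul_assoc]
  simp only [← mul_assoc (I _) (I _) (J _)]
  fin_cases a <;> simp [*] <;> abel

theorem rotor_quatRot (h : IsQuaternionic J) {q : ℍ[ℝ]} (hq : q ≠ 0) :
    rotor J (quatRot J q) = quatMap J ((4 * q.re / normSq q) • q) := by
  have hn : normSq q ≠ 0 := by simpa using hq
  have h1 : ∀ a, J a = quatMap J (quatUnit a) := fun a => (quatMap_unit a).symm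
  rw [rotor, h.quatRot_eq, h.quatRot_eq, h.quatRot_eq, h1 0, h1 1, h1 2]
  simp only [← h.quatMap_mul, ← quatMap_add]
  rw [← quatMap_one (J := J), ← quatMap_sub]
  congr 1
  rw [normSq_def'] at *
  ext <;> simp [quatUnit_re, quatUnit_imI, quatUnit_imJ, quatUnit_imK] <;> field_simp <;> ring


/-- The coordinates `y` for which `I = quatRot J (1 + y₁ i + y₂ j + y₃ k)`, computed by means of a
trace functional. -/
noncomputable def rotCoord (τ : R →ₗ[ℝ] ℝ) (J I : Fin 3 → R) (a : Fin 3) : ℝ :=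
  -τ (rotor J I * J a) / τ (rotor J I)

/-- The quaternion `1 + y₁ i + y₂ j + y₃ k`. -/
def onePlus (y : Fin 3 → ℝ) : ℍ[ℝ] := ⟨1, y 0, y 1, y 2⟩

theorem onePlus_re (y : Fin 3 → ℝ) : (onePlus y).re = 1 := rfl

theorem onePlus_imI (y : Fin 3 → ℝ) : (onePlus y).imI = y 0 := rfl

theorem onePlus_imJ (y : Fin 3 → ℝ) : (onePlus y).imJ = y 1 := rfl

theorem onePlus_imK (y : Fin 3 → ℝ) : (onePlus y).imK = y 2 := rfl

theorem onePlus_ne_zero (y : Fin 3 → ℝ) : onePlus y ≠ 0 := by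
  intro h
  have : (onePlus y).re = 0 := by rw [h]; rfl
  exact one_ne_zero this

section Trace

variable {τ : R →ₗ[ℝ] ℝ}

theorem IsQuaternionic.trace_unit (h : IsQuaternionic J) (hτ : ∀ x y, τ (x * y) = τ (y * x))
    (a : Fin 3) : τ (J a) = 0 := by
  have h0 : τ (J 0) = 0 := by
    have := hτ (J 1) (J 2); rw [h.mul_one_two, h.mul_two_one, map_neg] at this; linarith
  have h1 : τ (J 1) = 0 := by
    have := hτ (J 2) (J 0); rw [h.mul_two_zero, h.mul_zero_two, map_neg] at this; linarith
  have h2 : τ (J 2) = 0 := by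
    have := hτ (J 0) (J 1); rw [h.mul_zero_one, h.mul_one_zero, map_neg] at this; linarith
  fin_cases a
  exacts [h0, h1, h2]

theorem IsQuaternionic.trace_quatMap (h : IsQuaternionic J) (hτ : ∀ x y, τ (x * y) = τ (y * x))
    (q : ℍ[ℝ]) : τ (quatMap J q) = q.re * τ 1 := by
  simp [quatMap, h.trace_unit hτ]

theorem IsQuaternionic.trace_quatMap_mul (h : IsQuaternionic J)
    (hτ : ∀ x y, τ (x * y) = τ (y * x)) (q : ℍ[ℝ]) (a : Fin 3) :
    -τ (quatMap J q * J a) = ![q.imI, q.imJ, q.imK] a * τ 1 := by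
  rw [← quatMap_unit (J := J) a, ← h.quatMap_mul, h.trace_quatMap hτ]
  fin_cases a <;> simp [quatUnit_re, quatUnit_imI, quatUnit_imJ, quatUnit_imK]

theorem exists_quatMap_of_mem_span {x : R} (hx : x ∈ Submodule.span ℝ (Set.range J)) :
    ∃ q : ℍ[ℝ], x = quatMap J q := by
  induction hx using Submodule.span_induction with
  | mem x hx => obtain ⟨a, rfl⟩ := hx; exact ⟨quatUnit a, (quatMap_unit a).symm⟩
  | zero => exact ⟨0, by simp [quatMap]⟩
  | add x y _ _ hx hy =>
    obtain ⟨p, rfl⟩ := hx; obtain ⟨q, rfl⟩ := hy; exact ⟨p + q, (quatMap_add p q).symm⟩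
  | smul r x _ hx => obtain ⟨p, rfl⟩ := hx; exact ⟨r • p, (quatMap_smul r p).symm⟩

theorem exists_rotor_eq (h : IsQuaternionic J)
    (hI : ∀ a, I a ∈ Submodule.span ℝ (Set.range J)) : ∃ c : ℍ[ℝ], rotor J I = quatMap J c := by
  choose p hp using fun a => exists_quatMap_of_mem_span (hI a)
  refine ⟨1 - (p 0 * quatUnit 0 + p 1 * quatUnit 1 + p 2 * quatUnit 2), ?_⟩
  simp only [quatMap_sub, quatMap_add, h.quatMap_mul, quatMap_one, quatMap_unit, ← hp]
  rfl

theorem quatRot_rotCoord (h : IsQuaternionic J) (h' : IsQuaternionic I)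
    (hI : ∀ a, I a ∈ Submodule.span ℝ (Set.range J)) (hτ : ∀ x y, τ (x * y) = τ (y * x))
    (h0 : τ (rotor J I) ≠ 0) : quatRot J (onePlus (rotCoord τ J I)) = I := by
  obtain ⟨c, hc⟩ := exists_rotor_eq h hI
  have h1 := h.trace_quatMap hτ c
  rw [← hc] at h1
  have hre : c.re ≠ 0 := fun h => h0 (by rw [h1, h, zero_mul])
  have hτ1 : τ 1 ≠ 0 := fun h => h0 (by rw [h1, h, mul_zero])
  have hy : ∀ a, rotCoord τ J I a = ![c.imI, c.imJ, c.imK] a / c.re := by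
    intro a
    rw [rotCoord, hc, h.trace_quatMap_mul hτ, h.trace_quatMap hτ]
    field_simp
  set q := onePlus (rotCoord τ J I) with hq
  have hcq : c = c.re • q := by
    have e0 := hy 0; have e1 := hy 1; have e2 := hy 2
    simp at e0 e1 e2
    ext <;> simp [hq, onePlus_re, onePlus_imI, onePlus_imJ, onePlus_imK, e0, e1, e2] <;> field_simp
  have hq0 : q ≠ 0 := onePlus_ne_zero _
  have hn : normSq q ≠ 0 := by simpa using hq0
  ext a
  have h2 : quatMap J q * J a = I a * quatMap J q := by
    have h3 := rotor_mul h h' a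
    rw [hc, hcq, quatMap_smul, smul_mul_assoc, mul_smul_comm] at h3
    exact smul_right_injective R hre h3
  rw [quatRot, h2, mul_assoc, ← h.quatMap_mul, self_mul_star]
  have h4 : ((normSq q : ℝ) : ℍ[ℝ]) = normSq q • (1 : ℍ[ℝ]) := by ext <;> simp
  rw [h4, quatMap_smul, quatMap_one, mul_smul_comm, mul_one, smul_smul, inv_mul_cancel₀ hn,
    one_smul]

theorem normSq_onePlus (y : Fin 3 → ℝ) :
    normSq (onePlus y) = 1 + y 0 ^ 2 + y 1 ^ 2 + y 2 ^ 2 := by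
  rw [normSq_def']; simp [onePlus_re, onePlus_imI, onePlus_imJ, onePlus_imK]

theorem trace_rotor_onePlus (h : IsQuaternionic J) (hτ : ∀ x y, τ (x * y) = τ (y * x))
    (h1 : 0 < τ 1) (y : Fin 3 → ℝ) : 0 < τ (rotor J (quatRot J (onePlus y))) := by
  rw [rotor_quatRot h (onePlus_ne_zero y), h.trace_quatMap hτ, normSq_onePlus]
  have : (0 : ℝ) < 1 + y 0 ^ 2 + y 1 ^ 2 + y 2 ^ 2 := by positivity
  simp only [onePlus_re, re_smul, smul_eq_mul]
  positivity

theorem rotCoord_quatRot (h : IsQuaternionic J) (hτ : ∀ x y, τ (x * y) = τ (y * x))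
    (h1 : 0 < τ 1) (y : Fin 3 → ℝ) : rotCoord τ J (quatRot J (onePlus y)) = y := by
  ext a
  rw [rotCoord, rotor_quatRot h (onePlus_ne_zero y), h.trace_quatMap_mul hτ, h.trace_quatMap hτ,
    normSq_onePlus]
  have : (0 : ℝ) < 1 + y 0 ^ 2 + y 1 ^ 2 + y 2 ^ 2 := by positivity
  fin_cases a <;> simp [onePlus_re, onePlus_imI, onePlus_imJ, onePlus_imK] <;> field_simp

/-- One of the four triples obtained from `J` by `1, Ad i, Ad j, Ad k` is close to `I`. -/
theorem exists_trace_rotor_pos (h : IsQuaternionic J) (h1 : 0 < τ 1) (I : Fin 3 → R) :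
    ∃ q : ℍ[ℝ], q ≠ 0 ∧ 0 < τ (rotor (quatRot J q) I) := by
  by_contra! hcon
  have hne : ∀ c, quatUnit c ≠ 0 := by
    intro c hc
    have hs := quatMap_unit (J := J) c
    rw [hc] at hs
    have h2 := h.sq c
    rw [← hs] at h2
    have : (1 : R) = 0 := by simpa [quatMap] using h2.symm
    rw [this, map_zero] at h1
    exact lt_irrefl _ h1
  have key : ∀ c a, quatRot J (quatUnit c) a = if a = c then J a else -J a := by
    intro c a
    rw [h.quatRot_eq, quatMap]
    fin_cases c <;> fin_cases a <;>
      simp [normSq_def', quatUnit_re, quatUnit_imI, quatUnit_imJ, quatUnit_imK]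
  have e0 := hcon (quatUnit 0) (hne 0)
  have e1 := hcon (quatUnit 1) (hne 1)
  have e2 := hcon (quatUnit 2) (hne 2)
  have e3 := hcon 1 one_ne_zero
  rw [quatRot_one] at e3
  simp only [rotor, key, map_sub, map_add] at e0 e1 e2 e3
  simp at e0 e1 e2 e3
  linarith

end Trace

end QuaternionicTriples

/-! ## Manifolds, two-forms -/

/-- Endomorphisms of the tangent space at `m`. -/
abbrev EndT (E : Type*) [NormedAddCommGroup E] [NormedSpace ℝ E] {M : Type*} [TopologicalSpace M]
    [ChartedSpace E M] (m : M) : Type _ :=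
  TangentSpace 𝓘(ℝ, E) m →L[ℝ] TangentSpace 𝓘(ℝ, E) m

/-- A (not necessarily continuous) exterior two-form on the manifold `M` modelled on `E`. -/
abbrev TwoForm (E : Type*) [NormedAddCommGroup E] [NormedSpace ℝ E] (M : Type*)
    [TopologicalSpace M] [ChartedSpace E M] : Type _ :=
  ∀ m : M, TangentSpace 𝓘(ℝ, E) m [⋀^Fin 2]→L[ℝ] ℝ

namespace TwoForm

variable {E : Type*} [NormedAddCommGroup E] [NormedSpace ℝ E] {M : Type*} [TopologicalSpace M]
  [ChartedSpace E M]

/-- The two-form on (the target of) the chart `e` that represents `β`. -/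
noncomputable def inChart (β : TwoForm E M) (e : OpenPartialHomeomorph M E) (y : E) :
    E [⋀^Fin 2]→L[ℝ] ℝ :=
  (β (e.symm y)).compContinuousLinearMap (mfderiv 𝓘(ℝ, E) 𝓘(ℝ, E) e.symm y)

/-- Smoothness of a two-form, in the charts of the atlas. -/
def IsSmooth (β : TwoForm E M) : Prop :=
  ∀ e ∈ atlas E M, ContDiffOn ℝ ∞ (inChart β e) e.target

/-- `dβ = 0`, in the charts of the atlas. -/
def IsClosed (β : TwoForm E M) : Prop :=
  ∀ e ∈ atlas E M, ∀ y ∈ e.target, extDeriv (inChart β e) y = 0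

def IsNondegenerate (β : TwoForm E M) : Prop :=
  ∀ (m : M) (X : TangentSpace 𝓘(ℝ, E) m), (∀ Y, β m ![X, Y] = 0) → X = 0

structure IsSymplectic (β : TwoForm E M) : Prop where
  smooth : IsSmooth β
  closed : IsClosed β
  nondegenerate : IsNondegenerate β

/-- The pull-back of a two-form along a map. -/
noncomputable def pullback {F : Type*} [NormedAddCommGroup F] [NormedSpace ℝ F] {N : Type*}
    [TopologicalSpace N] [ChartedSpace F N] (f : N → M) (β : TwoForm E M) : TwoForm F N :=
  fun x => (β (f x)).compContinuousLinearMap (mfderiv 𝓘(ℝ, F) 𝓘(ℝ, E) f x)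

end TwoForm

/-! ## Quaternionic skew-Hermitian manifolds -/

section QuaternionicSkewHermitian

variable {E : Type*} [NormedAddCommGroup E] [NormedSpace ℝ E] {M : Type*} [TopologicalSpace M]
  [ChartedSpace E M] [IsManifold 𝓘(ℝ, E) ∞ M]

/-- The field of endomorphisms `A` is smooth on the set `U`. -/
def SmoothEndOn (A : ∀ m : M, EndT E m) (U : Set M) : Prop :=
  ContMDiffOn 𝓘(ℝ, E) (𝓘(ℝ, E).prod 𝓘(ℝ, E →L[ℝ] E)) ∞
    (fun m => Bundle.TotalSpace.mk' (E →L[ℝ] E) (E := fun m : M => EndT E m) m (A m)) U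

variable (E M) in
/-- An almost quaternionic structure: a subbundle of `End(TM)` that is locally, near each point,
generated by a smooth almost hypercomplex structure. -/
structure AlmostQuaternionicStructure where
  fiber : ∀ m : M, Submodule ℝ (EndT E m)
  exists_frame : ∀ m : M, ∃ U : Set M, IsOpen U ∧ m ∈ U ∧ ∃ J : Fin 3 → ∀ m : M, EndT E m,
    (∀ a, SmoothEndOn (J a) U) ∧
    ∀ p ∈ U, IsQuaternionic (fun a => J a p) ∧
      Submodule.span ℝ (Set.range fun a => J a p) = fiber p

/-- The admissible frames (bases) of the almost quaternionic structure at the point `m`. -/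
@[ext]
structure AdmissibleFrame (Q : AlmostQuaternionicStructure E M) (m : M) where
  J : Fin 3 → EndT E m
  quaternionic : IsQuaternionic J
  span_eq : Submodule.span ℝ (Set.range J) = Q.fiber m

/-- `om` is a smooth scalar two-form with respect to `Q`: non-degenerate and `Q`-Hermitian. -/
structure IsScalarTwoForm (Q : AlmostQuaternionicStructure E M) (om : TwoForm E M) : Prop where
  smooth : om.IsSmooth
  nondegenerate : om.IsNondegenerate
  hermitian : ∀ (m : M) (s : AdmissibleFrame Q m) (a : Fin 3) (X Y : TangentSpace 𝓘(ℝ, E) m),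
    om m ![s.J a X, s.J a Y] = om m ![X, Y]

variable (E M) in
/-- Linear connections on `M`; `cov Y m X` is `∇_X Y` at `m`. -/
abbrev Connection : Type _ := CovariantDerivative 𝓘(ℝ, E) E (TangentSpace 𝓘(ℝ, E) : M → Type _)

/-- `cov` is a smooth torsion-free connection that preserves `Q` and `om`, that is, a torsion-free
`SO*(2n)Sp(1)`-connection. -/
structure IsAdaptedTorsionFree [FiniteDimensional ℝ E] (Q : AlmostQuaternionicStructure E M) (om : TwoForm E M)
    (cov : Connection E M) : Prop where
  smooth : CovariantDerivative.ContMDiffCovariantDerivative cov ∞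
  torsion_free : cov.torsion = 0
  /-- `∇_X A ∈ Q` for local sections `A` of `Q`, where `(∇_X A) Y = ∇_X (A Y) - A (∇_X Y)`. -/
  preserves_Q : ∀ (U : Set M) (A : ∀ m : M, EndT E m), IsOpen U → SmoothEndOn A U →
    (∀ m ∈ U, A m ∈ Q.fiber m) → ∀ m ∈ U, ∀ X : TangentSpace 𝓘(ℝ, E) m, ∃ B ∈ Q.fiber m,
      ∀ Y : ∀ m : M, TangentSpace 𝓘(ℝ, E) m, MDiffAt (T% Y) m →
        B (Y m) = cov (fun m' => A m' (Y m')) m X - A m (cov Y m X)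
  /-- `∇ om = 0`. -/
  preserves_om : ∀ (m : M) (X : TangentSpace 𝓘(ℝ, E) m) (Y Z : ∀ m : M, TangentSpace 𝓘(ℝ, E) m),
    MDiffAt (T% Y) m → MDiffAt (T% Z) m →
      mvfderiv 𝓘(ℝ, E) (fun m' => om m' ![Y m', Z m']) m X =
        om m ![cov Y m X, Z m] + om m ![Y m, cov Z m X]

/-- `R(X, Y)Z` for the curvature `R` of the connection. -/
noncomputable def curvature (cov : Connection E M) (X Y Z : ∀ m : M, TangentSpace 𝓘(ℝ, E) m)
    (m : M) : TangentSpace 𝓘(ℝ, E) m :=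
  cov (fun m' => cov Z m' (Y m')) m (X m) - cov (fun m' => cov Z m' (X m')) m (Y m)
    - cov Z m (VectorField.mlieBracket 𝓘(ℝ, E) X Y m)

/-- The curvature tensor is not identically zero. -/
def CurvatureNeZero (cov : Connection E M) : Prop :=
  ∃ X Y Z : ∀ m : M, TangentSpace 𝓘(ℝ, E) m, CMDiff ∞ (T% X) ∧ CMDiff ∞ (T% Y) ∧
    CMDiff ∞ (T% Z) ∧ ∃ m : M, curvature cov X Y Z m ≠ 0

end QuaternionicSkewHermitian

section Transport

variable {R R' : Type*} [Ring R] [Algebra ℝ R] [Ring R'] [Algebra ℝ R']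

theorem map_quatRot (φ : R →ₐ[ℝ] R') (J : Fin 3 → R) (q : ℍ[ℝ]) (a : Fin 3) :
    φ (quatRot J q a) = quatRot (fun b => φ (J b)) q a := by
  simp [quatRot, quatMap]

theorem map_rotor (φ : R →ₐ[ℝ] R') (J I : Fin 3 → R) :
    φ (rotor J I) = rotor (fun b => φ (J b)) (fun b => φ (I b)) := by
  simp [rotor]

theorem rotCoord_map (φ : R →ₐ[ℝ] R') (τ : R →ₗ[ℝ] ℝ) (τ' : R' →ₗ[ℝ] ℝ)
    (h : ∀ x, τ' (φ x) = τ x) (J I : Fin 3 → R) (a : Fin 3) :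
    rotCoord τ' (fun b => φ (J b)) (fun b => φ (I b)) a = rotCoord τ J I a := by
  rw [rotCoord, rotCoord, ← map_rotor, ← map_mul, h, h]

variable (V : Type*) [AddCommGroup V] [Module ℝ V] [TopologicalSpace V] [IsTopologicalAddGroup V]
  [ContinuousSMul ℝ V]

/-- The trace of a continuous linear endomorphism. -/
noncomputable def clmTrace : (V →L[ℝ] V) →ₗ[ℝ] ℝ :=
  LinearMap.trace ℝ V ∘ₗ ContinuousLinearMap.coeLM ℝ

variable {V}

theorem clmTrace_mul_comm (A B : V →L[ℝ] V) : clmTrace V (A * B) = clmTrace V (B * A) :=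
  LinearMap.trace_mul_comm ℝ (A : V →ₗ[ℝ] V) (B : V →ₗ[ℝ] V)

variable {W : Type*} [AddCommGroup W] [Module ℝ W] [TopologicalSpace W] [IsTopologicalAddGroup W]
  [ContinuousSMul ℝ W]

/-- Conjugation of endomorphisms by an isomorphism. -/
def clmConj (e : V ≃L[ℝ] W) : (V →L[ℝ] V) →ₐ[ℝ] (W →L[ℝ] W) where
  toFun A := e ∘L A ∘L (e.symm : W →L[ℝ] V)
  map_one' := by ext; simp
  map_mul' A B := by ext; simp
  map_zero' := by ext; simp
  map_add' A B := by ext; simp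
  commutes' r := by ext; simp [Algebra.algebraMap_eq_smul_one]

theorem clmTrace_clmConj (e : V ≃L[ℝ] W) (A : V →L[ℝ] V) :
    clmTrace W (clmConj e A) = clmTrace V A :=
  LinearMap.trace_conj' (A : V →ₗ[ℝ] V) e.toLinearEquiv

theorem clmTrace_one [FiniteDimensional ℝ V] : clmTrace V 1 = Module.finrank ℝ V :=
  LinearMap.trace_one ℝ V

end Transport

section TangentCoordinates

variable {E : Type*} [NormedAddCommGroup E] [NormedSpace ℝ E] {M : Type*} [TopologicalSpace M]
  [ChartedSpace E M] [IsManifold 𝓘(ℝ, E) ∞ M]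

/-- The identification of the tangent space at `m` with the model space given by the preferred
chart at `x` (by the preferred chart at `m` if `m` is not in the domain of the former). -/
noncomputable def coordIso (x m : M) : TangentSpace 𝓘(ℝ, E) m ≃L[ℝ] E :=
  open Classical in
  if h : m ∈ (trivializationAt E (TangentSpace 𝓘(ℝ, E)) x).baseSet then
    (trivializationAt E (TangentSpace 𝓘(ℝ, E)) x).continuousLinearEquivAt ℝ m h
  else (trivializationAt E (TangentSpace 𝓘(ℝ, E)) m).continuousLinearEquivAt ℝ m
    (FiberBundle.mem_baseSet_trivializationAt' m)

theorem SmoothEndOn.coord {A : ∀ m : M, EndT E m} {U : Set M} (hU : IsOpen U)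
    (hA : SmoothEndOn A U) {x : M} (hx : U ⊆ (chartAt E x).source) :
    ContMDiffOn 𝓘(ℝ, E) 𝓘(ℝ, E →L[ℝ] E) ∞ (fun m => clmConj (coordIso x m) (A m)) U := by
  have h1 : U ⊆ (trivializationAt (E →L[ℝ] E) (fun m : M => EndT E m) x).baseSet := by
    rw [hom_trivializationAt_baseSet]
    intro m hm
    exact ⟨hx hm, hx hm⟩
  have h2 := ((trivializationAt (E →L[ℝ] E) (fun m : M => EndT E m) x).contMDiffOn_section_iff
    hU h1).1 hA
  refine h2.congr fun m hm => ?_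
  have hm' : m ∈ (trivializationAt E (TangentSpace 𝓘(ℝ, E)) x).baseSet := hx hm
  rw [hom_trivializationAt_apply]
  rw [ContinuousLinearMap.inCoordinates_eq hm' hm', coordIso, dif_pos hm']
  rfl

/-- The change of coordinates on the tangent space at `m`. -/
noncomputable def coordTrans (x' x m : M) : E ≃L[ℝ] E :=
  (coordIso x' m).symm.trans (coordIso x m)

theorem coordIso_coordChange {x x' m : M} (h : m ∈ (chartAt E x).source)
    (h' : m ∈ (chartAt E x').source) :
    (coordTrans (E := E) x' x m : E →L[ℝ] E) =
      ((trivializationAt E (TangentSpace 𝓘(ℝ, E)) x').coordChangeL ℝ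
        (trivializationAt E (TangentSpace 𝓘(ℝ, E)) x) m : E →L[ℝ] E) := by
  have k : m ∈ (trivializationAt E (TangentSpace 𝓘(ℝ, E)) x).baseSet := h
  have k' : m ∈ (trivializationAt E (TangentSpace 𝓘(ℝ, E)) x').baseSet := h'
  rw [coordTrans, coordIso, dif_pos k', coordIso, dif_pos k]
  ext v
  rw [ContinuousLinearEquiv.coe_coe, ContinuousLinearEquiv.coe_coe,
    Bundle.Trivialization.coordChangeL_apply _ _ ⟨k', k⟩]
  simp

theorem contMDiffOn_coordIso (x x' : M) :
    ContMDiffOn 𝓘(ℝ, E) 𝓘(ℝ, E →L[ℝ] E) ∞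
      (fun m => (coordTrans (E := E) x' x m : E →L[ℝ] E))
      ((chartAt E x).source ∩ (chartAt E x').source) := by
  have := contMDiffOn_coordChangeL (IB := 𝓘(ℝ, E)) (n := ∞)
    (trivializationAt E (TangentSpace 𝓘(ℝ, E)) x') (trivializationAt E (TangentSpace 𝓘(ℝ, E)) x)
  refine (this.mono ?_).congr fun m hm => coordIso_coordChange hm.1 hm.2
  intro m hm
  exact ⟨hm.2, hm.1⟩

theorem contDiff_clm_det (E : Type*) [NormedAddCommGroup E] [NormedSpace ℝ E]
    [FiniteDimensional ℝ E] :
    ContDiff ℝ ∞ (fun A : E →L[ℝ] E => LinearMap.det (A : E →ₗ[ℝ] E)) := by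
  have : (fun A : E →L[ℝ] E => LinearMap.det (A : E →ₗ[ℝ] E)) = fun A =>
      (Matrix.of fun i j => (Module.finBasis ℝ E).coord i (A (Module.finBasis ℝ E j))).det := by
    ext A
    rw [← LinearMap.det_toMatrix (Module.finBasis ℝ E)]
    congr 1
    ext i j
    simp [LinearMap.toMatrix_apply]
  rw [this]
  simp only [Matrix.det_apply]
  refine ContDiff.sum fun σ _ => ContDiff.const_smul _ ?_
  refine contDiff_prod fun i _ => ?_
  have h1 : IsBoundedLinearMap ℝ fun A : E →L[ℝ] E =>
      (Module.finBasis ℝ E).coord (σ i) (A (Module.finBasis ℝ E i)) :=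
    (((Module.finBasis ℝ E).coord (σ i)).toContinuousLinearMap ∘L
      ContinuousLinearMap.apply ℝ E (Module.finBasis ℝ E i)).isBoundedLinearMap
  exact h1.contDiff

end TangentCoordinates

/-! ## The Swann bundle -/

section Swann

variable {E : Type*} [NormedAddCommGroup E] [NormedSpace ℝ E] {M : Type*} [TopologicalSpace M]
  [ChartedSpace E M]

variable (E) in
/-- The non-zero volume forms at `m` up to sign; the class of `ν` is represented by the
function `|ν|`. -/
@[ext]
structure Density (m : M) where
  toFun : (Fin (Module.finrank ℝ E) → TangentSpace 𝓘(ℝ, E) m) → ℝ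
  exists_form : ∃ ν : TangentSpace 𝓘(ℝ, E) m [⋀^Fin (Module.finrank ℝ E)]→ₗ[ℝ] ℝ, ν ≠ 0 ∧
    ∀ v, toFun v = |ν v|

/-- Multiplication of a density by a positive number. -/
def Density.scale {m : M} (t : ℝ) (ht : 0 < t) (ρ : Density E m) : Density E m where
  toFun v := t * ρ.toFun v
  exists_form := by
    obtain ⟨ν, h0, h⟩ := ρ.exists_form
    refine ⟨t • ν, smul_ne_zero ht.ne' h0, fun v => ?_⟩
    rw [h, AlternatingMap.smul_apply, smul_eq_mul, abs_mul, abs_of_pos ht]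

variable [IsManifold 𝓘(ℝ, E) ∞ M] [FiniteDimensional ℝ E]

/-- The logarithm of the density `ρ` at `m`, expressed by a positive number in the chart at `x`. -/
noncomputable def Density.logCoord (x : M) {m : M} (ρ : Density E m) : ℝ :=
  Real.log (ρ.toFun fun i => (coordIso x m).symm (Module.finBasis ℝ E i))

/-- The density at `m` with a given coordinate. -/
noncomputable def Density.ofLog (x m : M) (r : ℝ) : Density E m where
  toFun v := Real.exp r * |(Module.finBasis ℝ E).det fun i => coordIso x m (v i)|
  exists_form := by
    refine ⟨Real.exp r • (Module.finBasis ℝ E).det.compLinearMap (coordIso x m).toLinearMap,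
      fun h => ?_, fun v => ?_⟩
    · have h1 := congrArg (fun f => f fun i => (coordIso x m).symm (Module.finBasis ℝ E i)) h
      simp [Module.Basis.det_self] at h1
    · rw [AlternatingMap.smul_apply, smul_eq_mul, abs_mul, abs_of_pos (Real.exp_pos r)]
      rfl

theorem Density.logCoord_ofLog (x x' m : M) (r : ℝ) :
    (Density.ofLog (E := E) x m r).logCoord x' =
      r + Real.log (LinearMap.det ((coordTrans (E := E) x' x m : E →L[ℝ] E) : E →ₗ[ℝ] E)) := by
  have h1 : (Module.finBasis ℝ E).det
      (fun i => coordIso x m ((coordIso x' m).symm (Module.finBasis ℝ E i))) =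
      LinearMap.det ((coordTrans (E := E) x' x m : E →L[ℝ] E) : E →ₗ[ℝ] E) := by
    rw [← LinearMap.det_toMatrix (Module.finBasis ℝ E), Module.Basis.det_apply]
    congr 1
    ext i j
    rw [LinearMap.toMatrix_apply]
    rfl
  have h2 : LinearMap.det ((coordTrans (E := E) x' x m : E →L[ℝ] E) : E →ₗ[ℝ] E) ≠ 0 :=
    (LinearEquiv.isUnit_det' (coordTrans (E := E) x' x m).toLinearEquiv).ne_zero
  rw [Density.logCoord, Density.ofLog]
  dsimp only
  rw [h1, Real.log_mul (Real.exp_ne_zero _) (by simpa using h2), Real.log_exp, Real.log_abs]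

theorem Density.logCoord_ofLog_self (x m : M) (r : ℝ) :
    (Density.ofLog (E := E) x m r).logCoord x = r := by
  have h : (coordTrans (E := E) x x m) = ContinuousLinearEquiv.refl ℝ E := by
    ext v; simp [coordTrans]
  rw [Density.logCoord_ofLog, h]
  simp

theorem Density.ofLog_logCoord (x : M) {m : M} (ρ : Density E m) :
    Density.ofLog x m (ρ.logCoord x) = ρ := by
  obtain ⟨ν, h0, h⟩ := ρ.exists_form
  set b := (Module.finBasis ℝ E).map (coordIso x m).symm.toLinearEquiv with hb
  have h1 : ν = ν b • b.det := AlternatingMap.eq_smul_basis_det b ν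
  have h2 : ν b ≠ 0 := fun h => h0 (by rw [h1, h, zero_smul])
  have h3 : ρ.logCoord x = Real.log |ν b| := by
    rw [Density.logCoord, h]; rfl
  ext v
  have h4 : ν v = ν b * (Module.finBasis ℝ E).det fun i => coordIso x m (v i) := by
    conv_lhs => rw [h1, AlternatingMap.smul_apply, smul_eq_mul]
    rw [hb, Module.Basis.det_map]
    rfl
  rw [h3, Density.ofLog, h, h4]
  dsimp only
  rw [Real.exp_log (abs_pos.2 h2), abs_mul]

/-- The Swann bundle: the fibre product of the bundle of densities with the bundle of
admissible frames. -/
@[ext]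
structure SwannBundle (Q : AlmostQuaternionicStructure E M) where
  base : M
  vol : Density E base
  frame : AdmissibleFrame Q base

variable {Q : AlmostQuaternionicStructure E M}

/-- The right action of a non-zero quaternion on an admissible frame. -/
noncomputable def AdmissibleFrame.rot {m : M} (s : AdmissibleFrame Q m) (q : ℍ[ℝ]) (hq : q ≠ 0) :
    AdmissibleFrame Q m where
  J := quatRot s.J q
  quaternionic := s.quaternionic.quatRot hq
  span_eq := (s.quaternionic.span_quatRot hq).trans s.span_eq

/-- The right action of a non-zero quaternion on the Swann bundle. -/
noncomputable def SwannBundle.act (u : SwannBundle Q) (q : ℍ[ℝ]) (hq : q ≠ 0) :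
    SwannBundle Q where
  base := u.base
  vol := u.vol.scale ‖q‖ (norm_pos_iff.2 hq)
  frame := u.frame.rot q hq

variable (Q) in
/-- A smooth local admissible frame (smooth on `dom` only), over the domain of a chart. -/
structure LocalFrame where
  center : M
  dom : Set M
  dom_open : IsOpen dom
  dom_subset : dom ⊆ (chartAt E center).source
  frame : ∀ m : M, AdmissibleFrame Q m
  smooth : ∀ a, SmoothEndOn (fun m => (frame m).J a) dom

/-- Trace functional on endomorphisms of tangent spaces. -/
noncomputable abbrev trT (m : M) : EndT E m →ₗ[ℝ] ℝ := clmTrace (TangentSpace 𝓘(ℝ, E) m)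

theorem trT_one_pos [Nontrivial E] (m : M) : 0 < trT m (1 : EndT E m) := by
  have h : trT m (1 : EndT E m) = clmTrace E 1 := by
    rw [← clmTrace_clmConj (coordIso m m), map_one]
  rw [h, clmTrace_one]
  exact_mod_cast Module.finrank_pos

/-- The coordinates on the Swann bundle given by the local frame `σ`: a chart on `M`, the logarithm
of the density, and the rotation that takes the frame `σ` to the given frame. -/
noncomputable def LocalFrame.chart [Nontrivial E] (σ : LocalFrame Q) :
    PartialEquiv (SwannBundle Q) (E × ℝ × (Fin 3 → ℝ)) where
  toFun u := (chartAt E σ.center u.base, u.vol.logCoord σ.center,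
    rotCoord (trT u.base) (σ.frame u.base).J u.frame.J)
  invFun p :=
    { base := (chartAt E σ.center).symm p.1
      vol := Density.ofLog σ.center _ p.2.1
      frame := (σ.frame _).rot (onePlus p.2.2) (onePlus_ne_zero _) }
  source := {u | u.base ∈ σ.dom ∧ 0 < trT u.base (rotor (σ.frame u.base).J u.frame.J)}
  target := {p | p.1 ∈ (chartAt E σ.center).target ∧ (chartAt E σ.center).symm p.1 ∈ σ.dom}
  map_source' := by
    rintro u ⟨hu, -⟩
    have := σ.dom_subset hu
    exact ⟨(chartAt E σ.center).map_source this, by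
      simpa only [(chartAt E σ.center).left_inv this] using hu⟩
  map_target' := by
    rintro p ⟨hp, hd⟩
    exact ⟨hd, trace_rotor_onePlus (σ.frame _).quaternionic clmTrace_mul_comm (trT_one_pos _) _⟩
  left_inv' := by
    rintro u ⟨hu, hpos⟩
    have key : ∀ m, m = u.base → (⟨m, Density.ofLog σ.center _ (u.vol.logCoord σ.center),
        (σ.frame m).rot (onePlus (rotCoord (trT u.base) (σ.frame u.base).J u.frame.J))
          (onePlus_ne_zero _)⟩ : SwannBundle Q) = u := by
      rintro m rfl
      have h1 := Density.ofLog_logCoord σ.center u.vol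
      have h2 : (σ.frame u.base).rot
          (onePlus (rotCoord (trT u.base) (σ.frame u.base).J u.frame.J))
          (onePlus_ne_zero _) = u.frame := by
        ext1
        refine quatRot_rotCoord (σ.frame u.base).quaternionic u.frame.quaternionic (fun a => ?_)
          clmTrace_mul_comm hpos.ne'
        rw [(σ.frame u.base).span_eq, ← u.frame.span_eq]
        exact Submodule.subset_span ⟨a, rfl⟩
      rw [h1, h2]
    exact key _ ((chartAt E σ.center).left_inv (σ.dom_subset hu))
  right_inv' := by
    rintro ⟨x, r, y⟩ ⟨hp, hd⟩
    simp only [Prod.mk.injEq]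
    exact ⟨(chartAt E σ.center).right_inv hp, Density.logCoord_ofLog_self _ _ _,
      rotCoord_quatRot (σ.frame _).quaternionic clmTrace_mul_comm (trT_one_pos _) _⟩

end Swann

section SwannManifold

theorem quatRot_onePlus {R : Type*} [Ring R] [Algebra ℝ R] (J : Fin 3 → R) (y : Fin 3 → ℝ)
    (a : Fin 3) :
    quatRot J (onePlus y) a = (1 + y 0 ^ 2 + y 1 ^ 2 + y 2 ^ 2)⁻¹ •
      ((1 + y 0 • J 0 + y 1 • J 1 + y 2 • J 2) * J a * (1 - y 0 • J 0 - y 1 • J 1 - y 2 • J 2)) := by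
  rw [quatRot, normSq_onePlus, quatMap, quatMap]
  simp only [re_star, imI_star, imJ_star, imK_star, onePlus_re, onePlus_imI, onePlus_imJ,
    onePlus_imK, one_smul, neg_smul, sub_eq_add_neg]

theorem ContDiffOn.quatRot_onePlus {F A : Type*} [NormedAddCommGroup F] [NormedSpace ℝ F]
    [NormedRing A] [NormedAlgebra ℝ A] {D : Set F} {J : F → Fin 3 → A} {y : F → Fin 3 → ℝ}
    (hJ : ∀ a, ContDiffOn ℝ ∞ (fun p => J p a) D) (hy : ∀ a, ContDiffOn ℝ ∞ (fun p => y p a) D)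
    (a : Fin 3) : ContDiffOn ℝ ∞ (fun p => quatRot (J p) (onePlus (y p)) a) D := by
  simp only [_root_.quatRot_onePlus]
  have h : ∀ b, ContDiffOn ℝ ∞ (fun p => y p b • J p b) D := fun b => (hy b).smul (hJ b)
  have h1 : ContDiffOn ℝ ∞ (fun _ : F => (1 : A)) D := contDiffOn_const
  have h2 : ContDiffOn ℝ ∞ (fun p => 1 + y p 0 ^ 2 + y p 1 ^ 2 + y p 2 ^ 2) D :=
    (((contDiffOn_const.add ((hy 0).pow 2)).add ((hy 1).pow 2)).add ((hy 2).pow 2))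
  have h3 : ContDiffOn ℝ ∞ (fun p => (1 + y p 0 ^ 2 + y p 1 ^ 2 + y p 2 ^ 2)⁻¹) D :=
    h2.inv fun p _ => by positivity
  refine ContDiffOn.smul h3 ?_
  exact ((((h1.add (h 0)).add (h 1)).add (h 2)).mul (hJ a)).mul
    (((h1.sub (h 0)).sub (h 1)).sub (h 2))

theorem ContDiffOn.rotor {F A : Type*} [NormedAddCommGroup F] [NormedSpace ℝ F]
    [NormedRing A] [NormedAlgebra ℝ A] {D : Set F} {J I : F → Fin 3 → A}
    (hJ : ∀ a, ContDiffOn ℝ ∞ (fun p => J p a) D) (hI : ∀ a, ContDiffOn ℝ ∞ (fun p => I p a) D) :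
    ContDiffOn ℝ ∞ (fun p => rotor (J p) (I p)) D := by
  unfold _root_.rotor
  have h1 : ContDiffOn ℝ ∞ (fun _ : F => (1 : A)) D := contDiffOn_const
  have h : ∀ a, ContDiffOn ℝ ∞ (fun p => I p a * J p a) D := fun a => (hI a).mul (hJ a)
  exact h1.sub (((h 0).add (h 1)).add (h 2))

variable {E : Type*} [NormedAddCommGroup E] [NormedSpace ℝ E] {M : Type*} [TopologicalSpace M]
  [ChartedSpace E M] [IsManifold 𝓘(ℝ, E) ∞ M] [FiniteDimensional ℝ E] [Nontrivial E]
  {Q : AlmostQuaternionicStructure E M}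

theorem contDiff_clmTrace (E : Type*) [NormedAddCommGroup E] [NormedSpace ℝ E]
    [FiniteDimensional ℝ E] : ContDiff ℝ ∞ (clmTrace E) :=
  (LinearMap.toContinuousLinearMap (clmTrace E)).contDiff

/-- Points with the given first coordinate over the domains of both local frames. -/
def LocalFrame.overlap (σ σ' : LocalFrame Q) : Set (E × ℝ × (Fin 3 → ℝ)) :=
  {p | p.1 ∈ (chartAt E σ.center).target ∧ (chartAt E σ.center).symm p.1 ∈ σ.dom ∩ σ'.dom}

theorem LocalFrame.isOpen_overlap (σ σ' : LocalFrame Q) : IsOpen (σ.overlap σ') := by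
  have := (chartAt E σ.center).isOpen_inter_preimage_symm (σ.dom_open.inter σ'.dom_open)
  exact this.preimage continuous_fst

/-- The frame `σ'` in the coordinates of `σ`. -/
noncomputable def LocalFrame.inCoord (σ σ' : LocalFrame Q) (p : E × ℝ × (Fin 3 → ℝ)) (a : Fin 3) :
    E →L[ℝ] E :=
  clmConj (coordIso σ.center ((chartAt E σ.center).symm p.1))
    ((σ'.frame ((chartAt E σ.center).symm p.1)).J a)

theorem LocalFrame.contDiffOn_comp (σ σ' : LocalFrame Q) {G : Type*} [NormedAddCommGroup G]
    [NormedSpace ℝ G] {f : M → G} (hf : ContMDiffOn 𝓘(ℝ, E) 𝓘(ℝ, G) ∞ f (σ.dom ∩ σ'.dom)) :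
    ContDiffOn ℝ ∞ (fun p : E × ℝ × (Fin 3 → ℝ) => f ((chartAt E σ.center).symm p.1))
      (σ.overlap σ') := by
  have h1 : ContMDiffOn 𝓘(ℝ, E) 𝓘(ℝ, E) ∞ (chartAt E σ.center).symm
      (chartAt E σ.center).target := contMDiffOn_chart_symm
  have h2 := hf.comp (h1.mono (Set.inter_subset_left
    (t := (chartAt E σ.center).symm ⁻¹' (σ.dom ∩ σ'.dom)))) (fun x hx => hx.2)
  exact h2.contDiffOn.comp contDiff_fst.contDiffOn (fun p hp => hp)

theorem LocalFrame.contDiffOn_inCoord (σ σ' : LocalFrame Q) (a : Fin 3) :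
    ContDiffOn ℝ ∞ (fun p => σ.inCoord σ' p a) (σ.overlap σ') := by
  have h1 : SmoothEndOn (fun m => (σ'.frame m).J a) (σ.dom ∩ σ'.dom) :=
    (σ'.smooth a).mono Set.inter_subset_right
  exact σ.contDiffOn_comp σ' (h1.coord (σ.dom_open.inter σ'.dom_open)
    (Set.inter_subset_left.trans σ.dom_subset))

theorem LocalFrame.contDiffOn_inCoord_self (σ σ' : LocalFrame Q) (a : Fin 3) :
    ContDiffOn ℝ ∞ (fun p => σ.inCoord σ p a) (σ.overlap σ') :=
  (σ.contDiffOn_inCoord σ a).mono fun _ hp => ⟨hp.1, hp.2.1, hp.2.1⟩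

theorem LocalFrame.transition_source (σ σ' : LocalFrame Q) :
    (σ.chart.symm.trans σ'.chart).source = σ.overlap σ' ∩
      {p | 0 < clmTrace E (rotor (σ.inCoord σ' p)
        (quatRot (σ.inCoord σ p) (onePlus p.2.2)))} := by
  ext p
  rw [PartialEquiv.trans_source]
  have h : clmTrace E (rotor (σ.inCoord σ' p) (quatRot (σ.inCoord σ p) (onePlus p.2.2))) =
      trT ((chartAt E σ.center).symm p.1)
        (rotor (σ'.frame ((chartAt E σ.center).symm p.1)).J
          (quatRot (σ.frame ((chartAt E σ.center).symm p.1)).J (onePlus p.2.2))) := by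
    rw [← clmTrace_clmConj (coordIso σ.center ((chartAt E σ.center).symm p.1)), map_rotor]
    congr 2
    ext1 a
    rw [map_quatRot]
    rfl
  simp only [Set.mem_inter_iff, Set.mem_ofPred_eq, h]
  exact ⟨fun ⟨⟨h1, h2⟩, h3, h4⟩ => ⟨⟨h1, h2, h3⟩, h4⟩, fun ⟨⟨h1, h2, h3⟩, h4⟩ => ⟨⟨h1, h2⟩, h3, h4⟩⟩

theorem LocalFrame.transition_rotor (σ σ' : LocalFrame Q) :
    ContDiffOn ℝ ∞ (fun p => rotor (σ.inCoord σ' p) (quatRot (σ.inCoord σ p) (onePlus p.2.2)))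
      (σ.overlap σ') :=
  ContDiffOn.rotor (σ.contDiffOn_inCoord σ')
    (ContDiffOn.quatRot_onePlus (σ.contDiffOn_inCoord_self σ') fun a =>
      (contDiff_pi.1 (contDiff_snd.comp contDiff_snd) a).contDiffOn)

theorem LocalFrame.isOpen_transition_source (σ σ' : LocalFrame Q) :
    IsOpen (σ.chart.symm.trans σ'.chart).source := by
  rw [LocalFrame.transition_source]
  have := ((contDiff_clmTrace E).comp_contDiffOn (σ.transition_rotor σ')).continuousOn
  exact this.isOpen_inter_preimage (σ.isOpen_overlap σ') isOpen_Ioi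

theorem LocalFrame.contDiffOn_transition (σ σ' : LocalFrame Q) :
    ContDiffOn ℝ ∞ (σ.chart.symm.trans σ'.chart) (σ.chart.symm.trans σ'.chart).source := by
  rw [LocalFrame.transition_source]
  have hrot : ∀ p : E × ℝ × (Fin 3 → ℝ), ∀ a,
      (σ.chart.symm.trans σ'.chart p).2.2 a = rotCoord (clmTrace E) (σ.inCoord σ' p)
        (quatRot (σ.inCoord σ p) (onePlus p.2.2)) a := by
    intro p a
    have h := rotCoord_map (clmConj (coordIso σ.center ((chartAt E σ.center).symm p.1)))
      (trT ((chartAt E σ.center).symm p.1)) (clmTrace E) (fun x => clmTrace_clmConj _ x)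
      (σ'.frame ((chartAt E σ.center).symm p.1)).J
      (quatRot (σ.frame ((chartAt E σ.center).symm p.1)).J (onePlus p.2.2)) a
    simp only [map_quatRot] at h
    exact h.symm
  have hlog : ∀ p : E × ℝ × (Fin 3 → ℝ), (σ.chart.symm.trans σ'.chart p).2.1 = p.2.1 + Real.log
      (LinearMap.det ((coordTrans (E := E) σ'.center σ.center
        ((chartAt E σ.center).symm p.1) : E →L[ℝ] E) : E →ₗ[ℝ] E)) := fun p =>
    Density.logCoord_ofLog _ _ _ _
  refine ContDiffOn.mono (s := σ.overlap σ' ∩ {p | 0 < clmTrace E (rotor (σ.inCoord σ' p)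
        (quatRot (σ.inCoord σ p) (onePlus p.2.2)))}) ?_ subset_rfl
  refine ContDiffOn.prodMk (f := fun p => (σ.chart.symm.trans σ'.chart p).1)
    (g := fun p => (σ.chart.symm.trans σ'.chart p).2) ?_
    (ContDiffOn.prodMk (f := fun p => (σ.chart.symm.trans σ'.chart p).2.1)
    (g := fun p => (σ.chart.symm.trans σ'.chart p).2.2) ?_ ?_)
  · have h1 : ContMDiffOn 𝓘(ℝ, E) 𝓘(ℝ, E) ∞ (chartAt E σ'.center) (σ.dom ∩ σ'.dom) :=
      contMDiffOn_chart.mono (Set.inter_subset_right.trans σ'.dom_subset)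
    exact (σ.contDiffOn_comp σ' h1).mono Set.inter_subset_left
  · simp only [hlog]
    have h1 := σ.contDiffOn_comp σ' ((contMDiffOn_coordIso σ.center σ'.center).mono
      (Set.inter_subset_inter σ.dom_subset σ'.dom_subset))
    have h2 := (contDiff_clm_det E).comp_contDiffOn h1
    have h3 : ContDiffOn ℝ ∞ (fun p : E × ℝ × (Fin 3 → ℝ) => p.2.1) (σ.overlap σ') :=
      (contDiff_fst.comp contDiff_snd).contDiffOn
    refine (h3.add (h2.log fun p _ => ?_)).mono Set.inter_subset_left
    exact (LinearEquiv.isUnit_det' (coordTrans (E := E) σ'.center σ.center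
      ((chartAt E σ.center).symm p.1)).toLinearEquiv).ne_zero
  · refine contDiffOn_pi.2 fun a => ?_
    simp only [hrot, rotCoord]
    have h1 := (contDiff_clmTrace E).comp_contDiffOn (σ.transition_rotor σ')
    have h2 := (contDiff_clmTrace E).comp_contDiffOn
      ((σ.transition_rotor σ').mul (σ.contDiffOn_inCoord σ' a))
    exact ContDiffOn.div (h2.neg.mono Set.inter_subset_left) (h1.mono Set.inter_subset_left)
      fun p hp => ne_of_gt hp.2

theorem AlmostQuaternionicStructure.nonempty_frame (Q : AlmostQuaternionicStructure E M) (m : M) :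
    Nonempty (AdmissibleFrame Q m) := by
  obtain ⟨U, -, hm, J, -, hJ⟩ := Q.exists_frame m
  exact ⟨⟨fun a => J a m, (hJ m hm).1, (hJ m hm).2⟩⟩

theorem SmoothEndOn.linearCombination {U : Set M} {A : Fin 3 → ∀ m : M, EndT E m}
    (hA : ∀ a, SmoothEndOn (A a) U) (c : Fin 3 → ℝ) :
    SmoothEndOn (fun m => c 0 • A 0 m + c 1 • A 1 m + c 2 • A 2 m) U := by
  have h : ∀ a, SmoothEndOn (fun m => c a • A a m) U := fun a =>
    ContMDiffOn.const_smul_section (hA a)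
  exact ContMDiffOn.add_section (ContMDiffOn.add_section (h 0) (h 1)) (h 2)

theorem exists_localFrame (u : SwannBundle Q) : ∃ σ : LocalFrame Q, u ∈ σ.chart.source := by
  classical
  obtain ⟨U, hU, hm, J, hJ, hQ⟩ := Q.exists_frame u.base
  obtain ⟨q, hq, hpos⟩ := exists_trace_rotor_pos (hQ _ hm).1 (trT_one_pos u.base) u.frame.J
  set V := U ∩ (chartAt E u.base).source with hV
  have hVo : IsOpen V := hU.inter (chartAt E u.base).open_source
  have hmV : u.base ∈ V := ⟨hm, mem_chart_source E u.base⟩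
  let s : ∀ m : M, AdmissibleFrame Q m := fun m =>
    if h : m ∈ V then (⟨fun a => J a m, (hQ m h.1).1, (hQ m h.1).2⟩ : AdmissibleFrame Q m).rot q hq
    else (Q.nonempty_frame m).some
  have hs : ∀ m ∈ V, (s m).J = quatRot (fun a => J a m) q := by
    intro m h
    simp only [s, dif_pos h]
    rfl
  refine ⟨⟨u.base, V, hVo, Set.inter_subset_right, s, fun a => ?_⟩, hmV, ?_⟩
  · set w : ℍ[ℝ] := (normSq q)⁻¹ • (q * quatUnit a * star q) with hw
    have hre : w.re = 0 := by
      rw [hw]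
      fin_cases a <;> simp [quatUnit_re, quatUnit_imI, quatUnit_imJ, quatUnit_imK] <;> right <;>
        ring
    refine (SmoothEndOn.linearCombination (fun b => (hJ b).mono Set.inter_subset_left)
      ![w.imI, w.imJ, w.imK]).congr fun m hm => ?_
    have h : (s m).J a = w.imI • J 0 m + w.imJ • J 1 m + w.imK • J 2 m := by
      rw [hs m hm, (hQ m hm.1).1.quatRot_eq, quatMap, ← hw, hre, zero_smul, zero_add]
    exact congrArg (Bundle.TotalSpace.mk' (E →L[ℝ] E) (E := fun m : M => EndT E m) m) h
  · change 0 < trT u.base (rotor (s u.base).J u.frame.J)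
    rw [hs _ hmV]
    exact hpos

variable (Q) in
/-- The charts of the Swann bundle. -/
noncomputable def swannCore : ChartedSpaceCore (E × ℝ × (Fin 3 → ℝ)) (SwannBundle Q) where
  atlas := Set.range LocalFrame.chart
  chartAt u := (exists_localFrame u).choose.chart
  mem_chart_source u := (exists_localFrame u).choose_spec
  chart_mem_atlas u := ⟨_, rfl⟩
  open_source := by
    rintro _ _ ⟨σ, rfl⟩ ⟨σ', rfl⟩
    exact σ.isOpen_transition_source σ'
  continuousOn_toFun := by
    rintro _ _ ⟨σ, rfl⟩ ⟨σ', rfl⟩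
    exact (σ.contDiffOn_transition σ').continuousOn

noncomputable instance : TopologicalSpace (SwannBundle Q) := (swannCore Q).toTopologicalSpace

noncomputable instance : ChartedSpace (E × ℝ × (Fin 3 → ℝ)) (SwannBundle Q) :=
  (swannCore Q).toChartedSpace

theorem exists_localFrame_of_mem_atlas
    {e : OpenPartialHomeomorph (SwannBundle Q) (E × ℝ × (Fin 3 → ℝ))}
    (he : e ∈ atlas (E × ℝ × (Fin 3 → ℝ)) (SwannBundle Q)) :
    ∃ σ : LocalFrame Q, e.toPartialEquiv = σ.chart := by
  have h1 : e ∈ ⋃ (f : PartialEquiv (SwannBundle Q) (E × ℝ × (Fin 3 → ℝ)))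
    (hf : f ∈ (swannCore Q).atlas), {(swannCore Q).openPartialHomeomorph f hf} := he
  simp only [Set.mem_iUnion, Set.mem_singleton_iff] at h1
  obtain ⟨_, ⟨σ, rfl⟩, rfl⟩ := h1
  exact ⟨σ, rfl⟩

instance : IsManifold 𝓘(ℝ, E × ℝ × (Fin 3 → ℝ)) ∞ (SwannBundle Q) := by
  refine isManifold_of_contDiffOn _ _ _ fun e e' he he' => ?_
  obtain ⟨σ, hσ⟩ := exists_localFrame_of_mem_atlas he
  obtain ⟨σ', hσ'⟩ := exists_localFrame_of_mem_atlas he'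
  have h := σ.contDiffOn_transition σ'
  rw [← hσ, ← hσ'] at h
  exact h.mono Set.inter_subset_left

end SwannManifold

/-! ## The connection form and the almost hypercomplex structure of the Swann bundle -/

section SwannGeometry

variable {E : Type*} [NormedAddCommGroup E] [NormedSpace ℝ E] {M : Type*} [TopologicalSpace M]
  [ChartedSpace E M] [IsManifold 𝓘(ℝ, E) ∞ M] [FiniteDimensional ℝ E] [Nontrivial E]
  {Q : AlmostQuaternionicStructure E M}

variable (E) in
/-- The model space of the Swann bundle. -/
abbrev SwannModel : Type _ := E × ℝ × (Fin 3 → ℝ)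

/-- Tangent spaces of the Swann bundle. -/
abbrev SwannTangent (u : SwannBundle Q) : Type _ := TangentSpace 𝓘(ℝ, SwannModel E) u

/-- The differential of the bundle projection. -/
noncomputable def dproj (u : SwannBundle Q) :
    SwannTangent u →L[ℝ] TangentSpace 𝓘(ℝ, E) u.base :=
  mfderiv 𝓘(ℝ, SwannModel E) 𝓘(ℝ, E) SwannBundle.base u

theorem quatExp_ne_zero (e : ℍ[ℝ]) : NormedSpace.exp e ≠ 0 := by
  let _ : NormedAlgebra ℚ ℍ[ℝ] := NormedAlgebra.restrictScalars ℚ ℝ ℍ[ℝ]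
  exact (NormedSpace.isUnit_exp e).ne_zero

/-- The fundamental vector field of `e ∈ ℍ`, the velocity of `t ↦ u · exp (t e)`. -/
noncomputable def fundamental (e : ℍ[ℝ]) (u : SwannBundle Q) : SwannTangent u :=
  mfderiv 𝓘(ℝ, ℝ) 𝓘(ℝ, SwannModel E)
    (fun t : ℝ => u.act (NormedSpace.exp (t • e)) (quatExp_ne_zero _)) 0 (1 : ℝ)

theorem extend_add {m : M} (y y' : TangentSpace 𝓘(ℝ, E) m) {m' : M}
    (hm : m' ∈ (trivializationAt E (TangentSpace 𝓘(ℝ, E)) m).baseSet) :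
    FiberBundle.extend E (y + y') m' = FiberBundle.extend E y m' + FiberBundle.extend E y' m' := by
  have h := FiberBundle.mem_baseSet_trivializationAt' (F := E) (E := TangentSpace 𝓘(ℝ, E)) m
  have e := (trivializationAt E (TangentSpace 𝓘(ℝ, E)) m).linear ℝ h
  have h1 := e.map_add y y'
  unfold FiberBundle.extend
  rw [h1]
  have k := (trivializationAt E (TangentSpace 𝓘(ℝ, E)) m).coe_symmₗ (R := ℝ) hm
  rw [← k]
  exact map_add ((trivializationAt E (TangentSpace 𝓘(ℝ, E)) m).symmₗ ℝ m') _ _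

theorem extend_smul {m : M} (c : ℝ) (y : TangentSpace 𝓘(ℝ, E) m) {m' : M}
    (hm : m' ∈ (trivializationAt E (TangentSpace 𝓘(ℝ, E)) m).baseSet) :
    FiberBundle.extend E (c • y) m' = c • FiberBundle.extend E y m' := by
  have h := FiberBundle.mem_baseSet_trivializationAt' (F := E) (E := TangentSpace 𝓘(ℝ, E)) m
  have e := (trivializationAt E (TangentSpace 𝓘(ℝ, E)) m).linear ℝ h
  have h1 := e.map_smul c y
  unfold FiberBundle.extend
  rw [h1]
  have k := (trivializationAt E (TangentSpace 𝓘(ℝ, E)) m).coe_symmₗ (R := ℝ) hm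
  rw [← k]
  exact map_smul ((trivializationAt E (TangentSpace 𝓘(ℝ, E)) m).symmₗ ℝ m') _ _

/-- The connection coefficients at `m` in the preferred chart at `m`: the endomorphism
`Γ(X) : y ↦ ∇_X Y`, where `Y` is the vector field near `m` with constant coefficients and with
value `y` at `m`. -/
noncomputable def connCoeff (cov : Connection E M) (m : M) :
    TangentSpace 𝓘(ℝ, E) m →ₗ[ℝ] Module.End ℝ (TangentSpace 𝓘(ℝ, E) m) :=
  LinearMap.mk₂ ℝ (fun X y => cov (FiberBundle.extend E y) m X)
    (fun X X' y => map_add _ X X')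
    (fun c X y => map_smul _ c X)
    (fun X y y' => by
      have h := cov.isCovariantDerivativeOnUniv.congr_of_eventuallyEq
        (σ := FiberBundle.extend E (y + y')) (σ' := FiberBundle.extend E y + FiberBundle.extend E y')
        (x := m) (FiberBundle.mdifferentiableAt_extend ..)
        (mdifferentiableAt_add_section (FiberBundle.mdifferentiableAt_extend ..)
          (FiberBundle.mdifferentiableAt_extend ..)) Filter.univ_mem
        (Filter.eventually_of_mem ((trivializationAt E _ m).open_baseSet.mem_nhds
          (FiberBundle.mem_baseSet_trivializationAt' m)) fun _ hm => extend_add y y' hm)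
      rw [h, cov.isCovariantDerivativeOnUniv.add (FiberBundle.mdifferentiableAt_extend ..)
          (FiberBundle.mdifferentiableAt_extend ..)]
      rfl)
    (fun c X y => by
      have h := cov.isCovariantDerivativeOnUniv.congr_of_eventuallyEq
        (σ := FiberBundle.extend E (c • y)) (σ' := c • FiberBundle.extend E y)
        (x := m) (FiberBundle.mdifferentiableAt_extend ..)
        (mdifferentiableAt_const.smul_section (FiberBundle.mdifferentiableAt_extend ..))
        Filter.univ_mem
        (Filter.eventually_of_mem ((trivializationAt E _ m).open_baseSet.mem_nhds
          (FiberBundle.mem_baseSet_trivializationAt' m)) fun _ hm => extend_smul c y hm)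
      rw [h, cov.isCovariantDerivativeOnUniv.smul_const c
        (FiberBundle.mdifferentiableAt_extend ..)]
      rfl)

/-- The covariant derivative `∇ I_a` at `u` of the tautological endomorphism field `I_a` along the
projection of the Swann bundle, which is the `a`-th member of the frame at each point. -/
noncomputable def nablaFrame (cov : Connection E M) (u : SwannBundle Q) (a : Fin 3) :
    SwannTangent u →ₗ[ℝ] Module.End ℝ (TangentSpace 𝓘(ℝ, E) u.base) where
  toFun ξ :=
    (clmConj (coordIso u.base u.base).symm
      (mvfderiv 𝓘(ℝ, SwannModel E)
        (fun u' : SwannBundle Q => clmConj (coordIso u.base u'.base) (u'.frame.J a)) u ξ) :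
        TangentSpace 𝓘(ℝ, E) u.base →L[ℝ] TangentSpace 𝓘(ℝ, E) u.base).toLinearMap
    + (connCoeff cov u.base (dproj u ξ) * (u.frame.J a).toLinearMap
      - (u.frame.J a).toLinearMap * connCoeff cov u.base (dproj u ξ))
  map_add' ξ η := by
    simp only [map_add, add_mul, mul_add, ContinuousLinearMap.toLinearMap_add]
    abel
  map_smul' c ξ := by
    simp only [map_smul, ContinuousLinearMap.toLinearMap_smul, smul_mul_assoc, mul_smul_comm, smul_add, smul_sub, RingHom.id_apply]

/-- The component `θ_0` of the connection form: the connection form of the bundle of densities,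
`∇ v = θ_0 ⊗ v` for the tautological density `v`. -/
noncomputable def thetaZero (cov : Connection E M) (u : SwannBundle Q) :
    SwannTangent u →ₗ[ℝ] ℝ :=
  (mvfderiv 𝓘(ℝ, SwannModel E) (fun u' : SwannBundle Q => u'.vol.logCoord u.base) u).toLinearMap
    - LinearMap.trace ℝ (TangentSpace 𝓘(ℝ, E) u.base) ∘ₗ connCoeff cov u.base ∘ₗ
      (dproj u).toLinearMap

/-- The components `θ_1, θ_2, θ_3` of the connection form on the bundle of admissible frames,
determined by `∇ I_b = 2 (θ_a ⊗ I_c - θ_c ⊗ I_a)` for cyclic `(a, b, c)`. -/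
noncomputable def theta (cov : Connection E M) (u : SwannBundle Q) (a : Fin 3) :
    SwannTangent u →ₗ[ℝ] ℝ :=
  (-(2 * (Module.finrank ℝ E : ℝ))⁻¹) • (LinearMap.trace ℝ (TangentSpace 𝓘(ℝ, E) u.base) ∘ₗ
    LinearMap.mulRight ℝ (u.frame.J (a + 2)).toLinearMap ∘ₗ nablaFrame cov u (a + 1))

/-- The horizontal space `Ĥ`, the kernel of the connection form. -/
noncomputable def horizontal (cov : Connection E M) (u : SwannBundle Q) :
    Submodule ℝ (SwannTangent u) :=
  LinearMap.ker (thetaZero cov u) ⊓ ⨅ a, LinearMap.ker (theta cov u a)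

/-- The vertical space `V̂`. -/
noncomputable def vertical (u : SwannBundle Q) : Submodule ℝ (SwannTangent u) :=
  LinearMap.ker (dproj u).toLinearMap

/-- The horizontal lift to `u` of a tangent vector. -/
noncomputable def horizontalLift (cov : Connection E M) (u : SwannBundle Q)
    (v : TangentSpace 𝓘(ℝ, E) u.base) : SwannTangent u :=
  Classical.epsilon fun η => η ∈ horizontal cov u ∧ dproj u η = v

/-- The almost hypercomplex structure `Î_1, Î_2, Î_3` of the Swann bundle. On horizontal vectors it
is the lift of the frame `u`; on the fundamental vector fields `Z_0, Z_1, Z_2, Z_3` of `1, i, j, k`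
it is `Î_a Z_0 = -Z_a`, `Î_a Z_a = Z_0`, `Î_a Z_b = Z_c`, `Î_a Z_c = -Z_b`. -/
noncomputable def swannI (cov : Connection E M) (a : Fin 3) (u : SwannBundle Q)
    (ξ : SwannTangent u) : SwannTangent u :=
  horizontalLift cov u (u.frame.J a (dproj u ξ))
    - thetaZero cov u ξ • fundamental (quatUnit a) u
    + theta cov u a ξ • fundamental 1 u
    + theta cov u (a + 1) ξ • fundamental (quatUnit (a + 2)) u
    - theta cov u (a + 2) ξ • fundamental (quatUnit (a + 1)) u

/-- Invariance of a two-form under `Î_1, Î_2, Î_3`. -/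
def IsHHermitian (cov : Connection E M) (β : TwoForm (SwannModel E) (SwannBundle Q)) : Prop :=
  ∀ (u : SwannBundle Q) (a : Fin 3) (ξ η : SwannTangent u),
    β u ![swannI cov a u ξ, swannI cov a u η] = β u ![ξ, η]

/-- `β` vanishes on `Ĥ × Ĥ` and on `Ĥ × V̂`. -/
def IsVerticalForm (cov : Connection E M) (β : TwoForm (SwannModel E) (SwannBundle Q)) : Prop :=
  ∀ (u : SwannBundle Q), ∀ ξ ∈ horizontal cov u,
    (∀ η ∈ horizontal cov u, β u ![ξ, η] = 0) ∧ ∀ η ∈ vertical u, β u ![ξ, η] = 0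

/-- `β` is non-degenerate on `V̂ × V̂`. -/
def IsNondegenerateOnVertical (β : TwoForm (SwannModel E) (SwannBundle Q)) : Prop :=
  ∀ (u : SwannBundle Q), ∀ ξ ∈ vertical u, (∀ η ∈ vertical u, β u ![ξ, η] = 0) → ξ = 0

end SwannGeometry

/-! A vertical form β that is non-degenerate on the vertical spaces has the horizontal distribution
Ĥ as its kernel. The kernel of a closed form is involutive (`altBilin_lieBracket`), so dβ = 0 forces
Ĥ to be integrable. Since Ĥ is the horizontal distribution of ∇ on a bundle of frames of Q,
integrability means that every curvature endomorphism R(v, w) commutes with I₁, I₂, I₃.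

This is carried out in the bundle chart of a local frame. The horizontal lifts of the coordinate
fields (`liftField`) have vertical brackets; these brackets lie in the kernel of β, hence vanish.
The tautological frame is parallel along the lifts (`PreservesQuaternionic.fderiv_tautFrame`), and
equality of its mixed derivatives along two commuting lifts says that R(v, w) commutes with it
(`PreservesQuaternionic.formCurvature_commute`).

The rest is linear algebra (`curvature_eq_zero`). If R satisfies the first Bianchi identity and
commutes with a hypercomplex pair I, J, then R(IX, IY) = R(X, Y) (`curvature_compl_invariant`). A
partial projection P of R is then symmetric in its three arguments, while skewness of R for ω makes
ω(P(X, Y, Z), JW) skew in Z and W. A tensor symmetric in three slots and skew in one of them and a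
fourth is zero; hence P = 0, and then R = 0, against the assumption.

The second claim reduces to the same statement. Since ∇ is torsion-free and ω is parallel, ω is
closed (`extDeriv_eq_zero_of_parallel`), so π̂*ω + β closed gives β closed; and vertical vectors lie
in the kernel of π̂*ω, so non-degeneracy of the sum passes to β on the vertical spaces.

Passing from the manifold to coordinates is the work of `coordIso_curvature` (the curvature),
`LocalFrame.preservesQuaternionic` (the local frame) and `LocalFrame.liftField_mem_horizontal` (the
connection form of the Swann bundle). -/

/-! ### Algebraic curvature tensors commuting with a hypercomplex structure -/

section CurvatureAlgebra

variable {V : Type*} [AddCommGroup V] [Module ℝ V]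

/-- Bianchi and I-linearity kill the (0,2) part of R with respect to I, the scalar i acting on
values as I. Since J anticommutes with I, the same identity holds with i replaced by -i, so the
(2,0) part dies as well and only the I-invariant part is left. -/
theorem curvature_compl_invariant {R : V →ₗ[ℝ] V →ₗ[ℝ] Module.End ℝ V} {I J : Module.End ℝ V}
    (hbianchi : ∀ X Y Z, R X Y Z + R Y Z X + R Z X Y = 0)
    (hI : ∀ X Y Z, R X Y (I Z) = I (R X Y Z)) (hJ : ∀ X Y Z, R X Y (J Z) = J (R X Y Z))
    (hI2 : ∀ X, I (I X) = -X) (hJ2 : ∀ X, J (J X) = -X) (hIJ : ∀ X, I (J X) = -J (I X))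
    (X Y : V) : R (I X) (I Y) = R X Y := by
  have key : ∀ Z, (R X Y Z - R (I X) (I Y) Z) + I (R (I X) Y Z + R X (I Y) Z) = 0 := by
    intro Z
    have b1 := hbianchi X Y Z
    have b2 := hbianchi (I X) (I Y) Z
    have b3 := hbianchi (I X) Y (I Z)
    have b4 := hbianchi X (I Y) (I Z)
    have c1 := congrArg I (hbianchi (I X) Y Z)
    have c2 := congrArg I (hbianchi X (I Y) Z)
    have c3 := congrArg I (hbianchi X Y (I Z))
    have c4 := congrArg I (hbianchi (I X) (I Y) (I Z))
    simp only [hI, map_add, map_zero, hI2] at *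
    -- The eight Bianchi identities expand the one for X + iIX, Y + iIY, Z - iIZ, with i acting as I
    -- on values. R is I-linear in its last slot, so the two terms with X + iIX or Y + iIY there
    -- vanish, and the term with Z - iIZ there is doubled.
    have h2 : (2 : ℝ) • ((R X Y Z - R (I X) (I Y) Z) + (I (R (I X) Y Z) + I (R X (I Y) Z))) = 0 := by
      linear_combination (norm := module) b1 - b2 + b3 + b4 + c1 + c2 - c3 + c4
    exact (smul_eq_zero.1 h2).resolve_left two_ne_zero
  ext Z
  have k1 := key Z
  have k2 := key (J Z)
  simp only [hJ] at k2
  -- Moving J out of `key (J Z)` flips the sign of the term with I; adding the two versions isolates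
  -- the difference wanted.
  have k3 : J ((R X Y Z - R (I X) (I Y) Z) - I (R (I X) Y Z + R X (I Y) Z)) = 0 := by
    rw [← k2]
    simp only [map_add, map_sub, hIJ]
    abel
  have k4 := congrArg J k3
  rw [hJ2, map_zero] at k4
  have k5 : (2 : ℝ) • (R X Y Z - R (I X) (I Y) Z) = 0 := by
    linear_combination (norm := module) k1 - k4
  have k6 := (smul_eq_zero.1 k5).resolve_left two_ne_zero
  exact (sub_eq_zero.1 k6).symm

/-- An algebraic curvature tensor of a hypercomplex structure that is skew with respect to a
Hermitian non-degenerate two-form vanishes. -/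
theorem curvature_eq_zero {R : V →ₗ[ℝ] V →ₗ[ℝ] Module.End ℝ V} {I J : Module.End ℝ V}
    (hskew : ∀ X Y Z, R X Y Z = - R Y X Z)
    (hbianchi : ∀ X Y Z, R X Y Z + R Y Z X + R Z X Y = 0)
    (hI : ∀ X Y Z, R X Y (I Z) = I (R X Y Z)) (hJ : ∀ X Y Z, R X Y (J Z) = J (R X Y Z))
    (hI2 : ∀ X, I (I X) = -X) (hJ2 : ∀ X, J (J X) = -X) (hIJ : ∀ X, I (J X) = -J (I X))
    {om : V →ₗ[ℝ] V →ₗ[ℝ] ℝ} (hom : ∀ X Y, om X Y = -om Y X)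
    (hnd : ∀ X, (∀ Y, om X Y = 0) → X = 0)
    (homI : ∀ X Y, om (I X) (I Y) = om X Y) (homJ : ∀ X Y, om (J X) (J Y) = om X Y)
    (hR : ∀ X Y Z W, om (R X Y Z) W + om Z (R X Y W) = 0) (X Y : V) : R X Y = 0 := by
  have hJI : ∀ X, J (I X) = -I (J X) := fun X => by rw [hIJ, neg_neg]
  have iI := curvature_compl_invariant hbianchi hI hJ hI2 hJ2 hIJ
  have iJ := curvature_compl_invariant hbianchi hJ hI hJ2 hI2 hJI
  have sI : ∀ X Y, R (I X) Y = -R X (I Y) := fun X Y => by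
    rw [← iI X (I Y), hI2, map_neg, neg_neg]
  have sJ : ∀ X Y, R (J X) Y = -R X (J Y) := fun X Y => by
    rw [← iJ X (J Y), hJ2, map_neg, neg_neg]
  have hsk : ∀ X Y, R X Y = -R Y X := fun X Y => LinearMap.ext (hskew X Y)
  have aI : ∀ X Y, om (I X) Y = -om X (I Y) := fun X Y => by
    rw [← homI X (I Y), hI2, map_neg, neg_neg]
  have aJ : ∀ X Y, om (J X) Y = -om X (J Y) := fun X Y => by
    rw [← homJ X (J Y), hJ2, map_neg, neg_neg]
  -- P is R with X - iIX and JY inserted, where i acts as I on values. The J makes it symmetric in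
  -- X, Y, because R is J-invariant and skew; the projection of X makes it symmetric in X, Z by
  -- Bianchi.
  set P : V → V → V → V := fun X Y Z => R X (J Y) Z - I (R (I X) (J Y) Z) with hP
  have s1 : ∀ X Y Z, P X Y Z = P Y X Z := by
    intro X Y Z
    have e1 : R X (J Y) = R Y (J X) := by rw [hsk, sJ, neg_neg]
    have e2 : R (I X) (J Y) = R (I Y) (J X) := by
      rw [sI, hsk (I Y), sJ, neg_neg, hIJ, map_neg, neg_neg]
    simp only [hP, e1, e2]
  have s2 : ∀ X Y Z, P X Y Z = P Z Y X := by
    intro X Y Z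
    have b2 := congrArg I (hbianchi (I X) (J Y) Z)
    have b3 := congrArg I (hbianchi X (J Y) (I Z))
    rw [hskew (J Y) Z] at b2
    rw [hskew (J Y) (I Z), sI Z X] at b3
    simp only [hI, hJ, map_add, map_neg, map_zero, hI2, LinearMap.neg_apply] at b2 b3
    simp only [hP]
    linear_combination (norm := module) -b2 - b3
  -- ω(·, J·) is a symmetric form, and the values of R, which commute with J, are skew for it; the
  -- term with I is skew too, since I anticommutes with J.
  have s3 : ∀ X Y Z W, om (P X Y Z) (J W) = -om (P X Y W) (J Z) := by
    intro X Y Z W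
    have e1 := hR X (J Y) Z (J W)
    have e2 := hR (I X) (J Y) Z (I (J W))
    have e3 := aJ Z (R X (J Y) W)
    have e4 := aI Z (J (R (I X) (J Y) W))
    have e5 := aJ (I Z) (R (I X) (J Y) W)
    have e6 := aI (R (I X) (J Y) Z) (J W)
    have e7 := aI (R (I X) (J Y) W) (J Z)
    simp only [hI, hJ] at e1 e2
    rw [hom (J Z)] at e3
    rw [hom (J (I Z)), hJI, map_neg] at e5
    simp only [hP, map_sub, LinearMap.sub_apply]
    linarith
  -- Alternating the symmetry in X, Z with the skewness in Z, W three times returns to the starting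
  -- expression with the opposite sign.
  have s4 : ∀ X Y Z W, om (P X Y Z) (J W) = 0 := by
    intro X Y Z W
    have h1 : ∀ X Y Z W, om (P X Y Z) (J W) = om (P Y X Z) (J W) := fun X Y Z W => by rw [s1]
    have h2 : ∀ X Y Z W, om (P X Y Z) (J W) = om (P Z Y X) (J W) := fun X Y Z W => by rw [s2]
    have a1 := s3 X Y Z W
    have a2 := h2 X Y W Z
    have a3 := s3 W Y X Z
    have a4 := h2 W Y Z X
    have a5 := s3 Z Y W X
    have a6 := h2 Z Y X W
    linarith
  have s5 : ∀ X Y Z, P X Y Z = 0 := fun X Y Z => hnd _ fun W => by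
    have := s4 X Y Z (-J W)
    rwa [map_neg, hJ2, neg_neg] at this
  -- P = 0 reads R(X, JY) = I R(IX, JY); evaluated at JZ, the right side changes sign relative to
  -- the left, so both sides vanish.
  have s6 : ∀ X Y Z, R X (J Y) Z = 0 := by
    intro X Y Z
    have h1 := s5 X Y Z
    have h2 := s5 X Y (J Z)
    simp only [hP, hJ, hIJ] at h1 h2
    have h3 : J (R X (J Y) Z + I (R (I X) (J Y) Z)) = 0 := by
      rw [← h2, map_add]; abel
    have h4 := congrArg J h3
    rw [hJ2, map_zero] at h4
    have h5 : (2 : ℝ) • R X (J Y) Z = 0 := by linear_combination (norm := module) h1 - h4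
    exact (smul_eq_zero.1 h5).resolve_left two_ne_zero
  ext Z
  have := s6 X (-J Y) Z
  rwa [map_neg, hJ2, neg_neg] at this

end CurvatureAlgebra

/-! ### Derivations of the quaternions are inner -/

section Derivation

variable {R : Type*} [Ring R] [Algebra ℝ R] {J D : Fin 3 → R}

/-- A derivation of the algebra spanned by a quaternionic triple is inner. -/
theorem IsQuaternionic.derivation_inner (h : IsQuaternionic J)
    (hsq : ∀ a, D a * J a + J a * D a = 0) (h01 : D 0 * J 1 + J 0 * D 1 = D 2)
    (h12 : D 1 * J 2 + J 1 * D 2 = D 0) (h20 : D 2 * J 0 + J 2 * D 0 = D 1)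
    (h10 : D 1 * J 0 + J 1 * D 0 = -D 2) (h21 : D 2 * J 1 + J 2 * D 1 = -D 0)
    (h02 : D 0 * J 2 + J 0 * D 2 = -D 1)
    (b : Fin 3) :
    (-(1 / 4 : ℝ)) • (D 0 * J 0 + D 1 * J 1 + D 2 * J 2) * J b -
      J b * ((-(1 / 4 : ℝ)) • (D 0 * J 0 + D 1 * J 1 + D 2 * J 2)) = D b := by
  -- The constant: for D a = [A, J a] with A an imaginary quaternion, the sum of the [A, J a] J a is
  -- -4A.
  have key : ∀ b, (D 0 * J 0 + D 1 * J 1 + D 2 * J 2) * J b -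
      J b * (D 0 * J 0 + D 1 * J 1 + D 2 * J 2) = -(4 : ℝ) • D b := by
    -- One computation for the first member of a cyclic triple: the Leibniz rules carry J a to the
    -- right past each D, after which everything is reduced by the multiplication table.
    have cyc : ∀ a b c : Fin 3, J a * J a = -1 → J b * J b = -1 → J c * J c = -1 →
        J b * J a = -J c → J c * J a = J b → D a * J a + J a * D a = 0 →
        D a * J b + J a * D b = D c → D a * J c + J a * D c = -D b →
        (D a * J a + D b * J b + D c * J c) * J a - J a * (D a * J a + D b * J b + D c * J c) =
          -(4 : ℝ) • D a := by
      intro a b c qa qb qc hba hca ea eb ec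
      have ea' : J a * D a = -(D a * J a) := by rw [← add_eq_zero_iff_neg_eq'.1 ea, neg_neg]
      have eb' : J a * D b = D c - D a * J b := by rw [← eb]; abel
      have ec' : J a * D c = -D b - D a * J c := by rw [← ec]; abel
      simp only [add_mul, mul_add, ← mul_assoc, ea', eb', ec', sub_mul, neg_mul]
      simp only [mul_assoc, qa, qb, qc, hba, hca]
      simp only [mul_neg, mul_one]
      module
    intro b
    fin_cases b
    · exact cyc 0 1 2 (h.sq 0) (h.sq 1) (h.sq 2) h.mul_one_zero h.mul_two_zero (hsq 0) h01 h02
    · have := cyc 1 2 0 (h.sq 1) (h.sq 2) (h.sq 0) h.mul_two_one h.mul_zero_one (hsq 1) h12 h10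
      rw [add_comm _ (D 0 * J 0), ← add_assoc] at this
      exact this
    · have := cyc 2 0 1 (h.sq 2) (h.sq 0) (h.sq 1) h.mul_zero_two h.mul_one_two (hsq 2) h20 h21
      rw [add_assoc, add_comm (D 2 * J 2)] at this
      exact this
  rw [smul_mul_assoc, mul_smul_comm, ← smul_sub, key, smul_smul]
  norm_num

end Derivation

/-! ### Derivatives along commuting vector fields -/

section Calculus

variable {F G : Type*} [NormedAddCommGroup F] [NormedSpace ℝ F] [NormedAddCommGroup G]
  [NormedSpace ℝ G]

theorem fderiv_clm_apply_apply {H : Type*} [NormedAddCommGroup H] [NormedSpace ℝ H]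
    {f : F → G →L[ℝ] H} {g : F → G} {p : F} (hf : DifferentiableAt ℝ f p)
    (hg : DifferentiableAt ℝ g p) (a : F) :
    fderiv ℝ (fun y => f y (g y)) p a = f p (fderiv ℝ g p a) + fderiv ℝ f p a (g p) := by
  rw [fderiv_clm_apply hf hg]; rfl

theorem fderiv_clm_apply_const {H : Type*} [NormedAddCommGroup H] [NormedSpace ℝ H]
    {f : F → G →L[ℝ] H} {p : F} (hf : DifferentiableAt ℝ f p) (g : G) (a : F) :
    fderiv ℝ (fun y => f y g) p a = fderiv ℝ f p a g := by
  rw [fderiv_clm_apply_apply hf (differentiableAt_const g), fderiv_const_apply]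
  simp

/-- Derivatives of a function along two vector fields that commute at a point. -/
theorem fderiv_fderiv_comm {f : F → G} {V W : F → F} {p : F} (hf : ContDiffAt ℝ 2 f p)
    (hV : DifferentiableAt ℝ V p) (hW : DifferentiableAt ℝ W p)
    (hVW : VectorField.lieBracket ℝ V W p = 0) :
    fderiv ℝ (fun y => fderiv ℝ f y (W y)) p (V p) =
      fderiv ℝ (fun y => fderiv ℝ f y (V y)) p (W p) := by
  have hd : DifferentiableAt ℝ (fderiv ℝ f) p :=
    (hf.fderiv_right (m := 1) (by norm_num)).differentiableAt one_ne_zero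
  have hs : IsSymmSndFDerivAt ℝ f p := hf.isSymmSndFDerivAt (by simp)
  rw [VectorField.lieBracket, sub_eq_zero] at hVW
  rw [fderiv_clm_apply hd hW, fderiv_clm_apply hd hV]
  simp only [add_apply, ContinuousLinearMap.comp_apply,
    ContinuousLinearMap.flip_apply, hVW, hs.eq (V p) (W p)]

end Calculus

/-! ### Two-forms on a vector space and the kernel of a closed form -/

section Alternating

variable {E : Type*} [NormedAddCommGroup E] [NormedSpace ℝ E] [FiniteDimensional ℝ E]

theorem update_pair_zero {α : Type*} (a b x : α) : Function.update ![a, b] 0 x = ![x, b] := by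
  ext i; fin_cases i <;> simp

theorem update_pair_one {α : Type*} (a b x : α) : Function.update ![a, b] 1 x = ![a, x] := by
  ext i; fin_cases i <;> simp

/-- An alternating two-form as a bilinear map. -/
noncomputable def altBilin (β : E [⋀^Fin 2]→L[ℝ] ℝ) : E →L[ℝ] E →L[ℝ] ℝ :=
  LinearMap.toContinuousLinearMap ((LinearMap.toContinuousLinearMap (𝕜 := ℝ) (E := E)
    (F' := ℝ)).toLinearMap ∘ₗ LinearMap.mk₂ ℝ (fun a b => β ![a, b])
    (fun a a' b => by
      have := β.map_update_add ![a, b] 0 a a'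
      simpa only [update_pair_zero] using this)
    (fun c a b => by
      have := β.map_update_smul ![a, b] 0 c a
      simpa only [update_pair_zero] using this)
    (fun a b b' => by
      have := β.map_update_add ![a, b] 1 b b'
      simpa only [update_pair_one] using this)
    (fun c a b => by
      have := β.map_update_smul ![a, b] 1 c b
      simpa only [update_pair_one] using this))

theorem altBilin_apply (β : E [⋀^Fin 2]→L[ℝ] ℝ) (a b : E) : altBilin β a b = β ![a, b] := rfl

theorem altBilin_swap (β : E [⋀^Fin 2]→L[ℝ] ℝ) (a b : E) : altBilin β a b = -altBilin β b a := by
  have h : β (![b, a] ∘ Equiv.swap 0 1) = -β ![b, a] :=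
    β.toAlternatingMap.map_swap ![b, a] (i := 0) (j := 1) (by simp)
  rw [altBilin_apply, altBilin_apply, ← h]
  congr 1
  ext i; fin_cases i <;> simp

theorem contDiff_altBilin : ContDiff ℝ ∞ (altBilin (E := E)) := by
  rw [contDiff_clm_apply_iff]; intro a
  rw [contDiff_clm_apply_iff]; intro b
  exact (ContinuousAlternatingMap.apply ℝ E ℝ ![a, b]).contDiff

theorem fderiv_altBilin {β : E → E [⋀^Fin 2]→L[ℝ] ℝ} {z : E} (hβ : DifferentiableAt ℝ β z)
    (v a b : E) : fderiv ℝ (fun y => altBilin (β y)) z v a b =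
      fderiv ℝ (fun y => β y ![a, b]) z v := by
  have h1 : DifferentiableAt ℝ (fun y => altBilin (β y)) z :=
    (contDiff_altBilin.differentiable (by simp)).differentiableAt.comp z hβ
  have h2 := (h1.hasFDerivAt.clm_apply (hasFDerivAt_const a z)).clm_apply (hasFDerivAt_const b z)
  have h3 : (fun y => β y ![a, b]) = fun y => altBilin (β y) a b := rfl
  rw [h3, h2.fderiv]
  simp only [ContinuousLinearMap.comp_zero, zero_add, ContinuousLinearMap.flip_apply]

/-- Differentiating the form as a bilinear map keeps the derivative apart from the arguments, so
that product rules apply when vector fields are inserted. -/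
theorem extDeriv_two_apply {β : E → E [⋀^Fin 2]→L[ℝ] ℝ} {z : E} (hβ : DifferentiableAt ℝ β z)
    (a b c : E) : extDeriv β z ![a, b, c] = fderiv ℝ (fun y => altBilin (β y)) z a b c -
      fderiv ℝ (fun y => altBilin (β y)) z b a c + fderiv ℝ (fun y => altBilin (β y)) z c a b := by
  have e := fderiv_altBilin hβ
  have e0 : Fin.removeNth 0 ![a, b, c] = ![b, c] := by ext i; fin_cases i <;> rfl
  have e1 : Fin.removeNth 1 ![a, b, c] = ![a, c] := by ext i; fin_cases i <;> rfl
  have e2 : Fin.removeNth 2 ![a, b, c] = ![a, b] := by ext i; fin_cases i <;> rfl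
  rw [extDeriv_apply hβ]
  refine (Fin.sum_univ_three _).trans ?_
  rw [e0, e1, e2, e, e, e]
  simp
  ring

/-- A closed two-form with kernel containing two vector fields also annihilates their bracket. -/
theorem altBilin_lieBracket {B : E → E [⋀^Fin 2]→L[ℝ] ℝ} {V W : E → E} {p : E}
    (hB : DifferentiableAt ℝ B p) (hV : DifferentiableAt ℝ V p) (hW : DifferentiableAt ℝ W p)
    (hBV : ∀ᶠ y in 𝓝 p, ∀ ξ, B y ![V y, ξ] = 0) (hBW : ∀ᶠ y in 𝓝 p, ∀ ξ, B y ![W y, ξ] = 0)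
    (hd : extDeriv B p = 0) (ξ : E) : B p ![VectorField.lieBracket ℝ V W p, ξ] = 0 := by
  have h1 : DifferentiableAt ℝ (fun y => altBilin (B y)) p :=
    (contDiff_altBilin.differentiable (by simp)).differentiableAt.comp p hB
  -- Differentiating B(V, ξ) = 0 trades a derivative of B for a derivative of V. Inserted in dB(V,
  -- W, ξ) = 0, this produces exactly the two terms of the bracket and a term B(D_ξ V, W).
  have key : ∀ {V : E → E}, DifferentiableAt ℝ V p → (∀ᶠ y in 𝓝 p, ∀ ξ, B y ![V y, ξ] = 0) →
      ∀ a ξ, fderiv ℝ (fun y => altBilin (B y)) p a (V p) ξ =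
        -altBilin (B p) (fderiv ℝ V p a) ξ := by
    intro V hV hBV a ξ
    have h2 := (h1.hasFDerivAt.clm_apply hV.hasFDerivAt).clm_apply (hasFDerivAt_const ξ p)
    have h3 : (fun y => altBilin (B y) (V y) ξ) =ᶠ[𝓝 p] fun _ => 0 := hBV.mono fun y hy => hy ξ
    have h4 := congrArg (fun L : E →L[ℝ] ℝ => L a) (h2.fderiv.symm.trans h3.fderiv_eq)
    simp [ContinuousLinearMap.flip_apply] at h4
    linarith
  have h := extDeriv_two_apply hB (V p) (W p) ξ
  have k := key hV hBV ξ (W p)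
  -- The extra term B(D_ξ V, W) vanishes because W also lies in the kernel.
  have k0 := hBW.self_of_nhds (fderiv ℝ V p ξ)
  rw [← altBilin_apply, altBilin_swap, neg_eq_zero] at k0
  rw [k0, neg_zero] at k
  rw [hd, key hW hBW, key hV hBV, k] at h
  rw [← altBilin_apply, VectorField.lieBracket, map_sub, sub_apply]
  simp at h
  linarith

end Alternating

/-! ### Curvature of a connection form: Bianchi, skewness, closedness of parallel forms -/

section Curvature

variable {E : Type*} [NormedAddCommGroup E] [NormedSpace ℝ E]
  {W : Set E} {Γ : E → E →L[ℝ] E →L[ℝ] E} {z : E}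

/-- The curvature of the connection with connection form `Γ` on the trivial bundle. -/
noncomputable def formCurvature (Γ : E → E →L[ℝ] E →L[ℝ] E) (z v w : E) : E →L[ℝ] E :=
  fderiv ℝ Γ z v w - fderiv ℝ Γ z w v + (Γ z v * Γ z w - Γ z w * Γ z v)

theorem formCurvature_swap (Γ : E → E →L[ℝ] E →L[ℝ] E) (z v w : E) :
    formCurvature Γ z v w = -formCurvature Γ z w v := by
  unfold formCurvature; abel

/-- Vanishing torsion is the symmetry of Γ in its two arguments. Its derivatives inherit this
symmetry, and in the cyclic sum the derivative terms and the quadratic terms cancel separately. -/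
theorem formCurvature_bianchi (hW : IsOpen W) (hΓ : ContDiffOn ℝ ∞ Γ W)
    (hsymm : ∀ z ∈ W, ∀ v w, Γ z v w = Γ z w v) (hz : z ∈ W) (u v w : E) :
    formCurvature Γ z u v w + formCurvature Γ z v w u + formCurvature Γ z w u v = 0 := by
  have hd : DifferentiableAt ℝ Γ z := (hΓ.contDiffAt (hW.mem_nhds hz)).differentiableAt (by simp)
  have key : ∀ a b c, fderiv ℝ Γ z a b c = fderiv ℝ Γ z a c b := by
    intro a b c
    have h1 : ∀ b c, fderiv ℝ (fun y => Γ y b c) z a = fderiv ℝ Γ z a b c := by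
      intro b c
      rw [fderiv_clm_apply_const (hd.clm_apply (differentiableAt_const b)),
        fderiv_clm_apply_const hd]
    rw [← h1, ← h1]
    congr 1
    apply Filter.EventuallyEq.fderiv_eq
    filter_upwards [hW.mem_nhds hz] with y hy using hsymm y hy b c
  simp only [formCurvature, add_apply, sub_apply,
    mul_apply_eq_comp]
  rw [key u v w, key v w u, key w u v, hsymm z hz v w, hsymm z hz u w, hsymm z hz u v]
  abel

variable [FiniteDimensional ℝ E]

/-- The equation ∇ω = 0 is differentiated once more. Second derivatives of ω commute, the terms with
one Γ in each slot are symmetric in v and w, and the skew remainder is the curvature acting on ω. -/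
theorem formCurvature_skew (hW : IsOpen W) (hΓ : ContDiffOn ℝ ∞ Γ W)
    {om : E → E [⋀^Fin 2]→L[ℝ] ℝ} (hom : ContDiffOn ℝ ∞ om W)
    (hpar : ∀ z ∈ W, ∀ v a b, fderiv ℝ (fun y => om y ![a, b]) z v =
      om z ![Γ z v a, b] + om z ![a, Γ z v b]) (hz : z ∈ W) (v w a b : E) :
    om z ![formCurvature Γ z v w a, b] + om z ![a, formCurvature Γ z v w b] = 0 := by
  have hW' := hW.mem_nhds hz
  have hd : DifferentiableAt ℝ Γ z := (hΓ.contDiffAt hW').differentiableAt (by simp)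
  have hb : ContDiffOn ℝ ∞ (fun y => altBilin (om y)) W := contDiff_altBilin.comp_contDiffOn hom
  have hbd : DifferentiableAt ℝ (fun y => altBilin (om y)) z :=
    (hb.contDiffAt hW').differentiableAt (by simp)
  have hc : ∀ y ∈ W, ∀ v a b, fderiv ℝ (fun y => altBilin (om y)) y v a b =
      altBilin (om y) (Γ y v a) b + altBilin (om y) a (Γ y v b) := by
    intro y hy v a b
    rw [fderiv_altBilin ((hom.contDiffAt (hW.mem_nhds hy)).differentiableAt (by simp)),
      hpar y hy]
    rfl
  have hdd : ∀ v w, fderiv ℝ (fun y => altBilin (om y) (Γ y v a) b + altBilin (om y) a (Γ y v b))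
      z w = altBilin (om z) (Γ z w (Γ z v a)) b + altBilin (om z) (Γ z v a) (Γ z w b) +
        altBilin (om z) (fderiv ℝ Γ z w v a) b + (altBilin (om z) (Γ z w a) (Γ z v b) +
        altBilin (om z) a (Γ z w (Γ z v b)) + altBilin (om z) a (fderiv ℝ Γ z w v b)) := by
    intro v w
    have g0 : DifferentiableAt ℝ (fun y => Γ y v) z := hd.clm_apply (differentiableAt_const v)
    have g1 : ∀ a, DifferentiableAt ℝ (fun y => Γ y v a) z := fun a =>
      g0.clm_apply (differentiableAt_const a)
    have g2 : ∀ a, fderiv ℝ (fun y => Γ y v a) z w = fderiv ℝ Γ z w v a := fun a => by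
      rw [fderiv_clm_apply_const g0, fderiv_clm_apply_const hd]
    have g3 : DifferentiableAt ℝ (fun y => altBilin (om y) (Γ y v a)) z := hbd.clm_apply (g1 a)
    have g4 : DifferentiableAt ℝ (fun y => altBilin (om y) a) z :=
      hbd.clm_apply (differentiableAt_const a)
    rw [fderiv_fun_add (g3.clm_apply (differentiableAt_const b)) (g4.clm_apply (g1 b)),
      add_apply, fderiv_clm_apply_const g3, fderiv_clm_apply_apply hbd (g1 a),
      fderiv_clm_apply_apply g4 (g1 b), fderiv_clm_apply_const hbd, g2, g2, add_apply,
      hc z hz, hc z hz]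
    ring
  have hf : ContDiffAt ℝ 2 (fun y => altBilin (om y) a b) z :=
    (((hb.contDiffAt hW').clm_apply contDiffAt_const).clm_apply contDiffAt_const).of_le
      (WithTop.coe_le_coe.2 le_top)
  have hcomm := fderiv_fderiv_comm (V := fun _ => v) (W := fun _ => w) hf
    (differentiableAt_const _) (differentiableAt_const _) (by simp [VectorField.lieBracket])
  have hev : ∀ v, (fun y => fderiv ℝ (fun y => altBilin (om y) a b) y v) =ᶠ[𝓝 z]
      fun y => altBilin (om y) (Γ y v a) b + altBilin (om y) a (Γ y v b) := by
    intro v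
    filter_upwards [hW'] with y hy using hpar y hy v a b
  rw [(hev w).fderiv_eq, (hev v).fderiv_eq, hdd, hdd] at hcomm
  simp only [← altBilin_apply]
  simp only [formCurvature, add_apply, sub_apply,
    mul_apply_eq_comp, map_add, map_sub]
  linarith

/-- For a symmetric Γ, dω is the alternation of ∇ω. In the second claim this separates dβ from the
closedness of the sum. -/
theorem extDeriv_eq_zero_of_parallel {om : E → E [⋀^Fin 2]→L[ℝ] ℝ}
    (hom : DifferentiableAt ℝ om z)
    (hsymm : ∀ v w, Γ z v w = Γ z w v)
    (hpar : ∀ v a b, fderiv ℝ (fun y => om y ![a, b]) z v =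
      om z ![Γ z v a, b] + om z ![a, Γ z v b]) : extDeriv om z = 0 := by
  ext v
  have hv : v = ![v 0, v 1, v 2] := by ext i; fin_cases i <;> rfl
  rw [hv, extDeriv_two_apply hom, fderiv_altBilin hom, fderiv_altBilin hom, fderiv_altBilin hom,
    hpar, hpar, hpar]
  simp only [← altBilin_apply]
  rw [hsymm (v 1) (v 0), hsymm (v 2) (v 0), hsymm (v 2) (v 1),
    altBilin_swap _ (v 1) (Γ z (v 0) (v 2)), altBilin_swap _ (v 0) (Γ z (v 1) (v 2))]
  change _ = (0 : ℝ)
  ring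
end Curvature

/-! ### Product rules and imaginary quaternions -/

section ProductRules

variable {F G A : Type*} [NormedAddCommGroup F] [NormedSpace ℝ F] [NormedAddCommGroup G]
  [NormedSpace ℝ G] [NormedRing A] [NormedAlgebra ℝ A]

theorem fderiv_fun_mul_apply {f g : F → A} {p : F} (hf : DifferentiableAt ℝ f p)
    (hg : DifferentiableAt ℝ g p) (a : F) :
    fderiv ℝ (fun y => f y * g y) p a = f p * fderiv ℝ g p a + fderiv ℝ f p a * g p := by
  rw [show (fun y => f y * g y) = f * g from rfl, (hf.hasFDerivAt.mul' hg.hasFDerivAt).fderiv]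
  rfl

theorem fderiv_fun_smul_apply {c : F → ℝ} {g : F → G} {p : F} (hc : DifferentiableAt ℝ c p)
    (hg : DifferentiableAt ℝ g p) (a : F) :
    fderiv ℝ (fun y => c y • g y) p a = c p • fderiv ℝ g p a + fderiv ℝ c p a • g p := by
  rw [fderiv_fun_smul hc hg]
  rfl

end ProductRules

/-- The imaginary quaternion with given components. -/
def imQuat (ψ : Fin 3 → ℝ) : ℍ[ℝ] := ⟨0, ψ 0, ψ 1, ψ 2⟩

theorem imQuat_re (ψ : Fin 3 → ℝ) : (imQuat ψ).re = 0 := rfl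

theorem imQuat_imI (ψ : Fin 3 → ℝ) : (imQuat ψ).imI = ψ 0 := rfl

theorem imQuat_imJ (ψ : Fin 3 → ℝ) : (imQuat ψ).imJ = ψ 1 := rfl

theorem imQuat_imK (ψ : Fin 3 → ℝ) : (imQuat ψ).imK = ψ 2 := rfl

theorem quatMap_imQuat {R : Type*} [Ring R] [Algebra ℝ R] (J : Fin 3 → R) (ψ : Fin 3 → ℝ) :
    quatMap J (imQuat ψ) = ψ 0 • J 0 + ψ 1 • J 1 + ψ 2 • J 2 := by
  simp [quatMap, imQuat]

theorem quatMap_neg {R : Type*} [Ring R] [Algebra ℝ R] (J : Fin 3 → R) (q : ℍ[ℝ]) :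
    quatMap J (-q) = -quatMap J q := by
  rw [← neg_one_smul ℝ q, quatMap_smul, neg_one_smul]

/-! ### Horizontal lifts and the tautological frame in coordinates -/

section HorizontalFields

variable {E : Type*} [NormedAddCommGroup E] [NormedSpace ℝ E]

/-- The covariant derivative of the endomorphism field `J a` in the trivial bundle. -/
noncomputable def covEnd (Γ : E → E →L[ℝ] E →L[ℝ] E) (J : E → Fin 3 → E →L[ℝ] E) (z v : E)
    (a : Fin 3) : E →L[ℝ] E :=
  fderiv ℝ (fun y => J y a) z v + (Γ z v * J z a - J z a * Γ z v)

/-- A connection on a trivial tangent bundle, with a field of quaternionic triples whose span is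
parallel. -/
structure PreservesQuaternionic (W : Set E) (Γ : E → E →L[ℝ] E →L[ℝ] E)
    (J : E → Fin 3 → E →L[ℝ] E) : Prop where
  isOpen : IsOpen W
  contDiffOn_form : ContDiffOn ℝ ∞ Γ W
  contDiffOn_frame : ∀ a, ContDiffOn ℝ ∞ (fun z => J z a) W
  quaternionic : ∀ z ∈ W, IsQuaternionic (J z)
  covEnd_mem : ∀ z ∈ W, ∀ v a, covEnd Γ J z v a ∈ Submodule.span ℝ (Set.range (J z))

/-- The endomorphism whose commutators with the quaternionic frame are its covariant derivatives. -/
noncomputable def frameForm (Γ : E → E →L[ℝ] E →L[ℝ] E) (J : E → Fin 3 → E →L[ℝ] E) (z v : E) :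
    E →L[ℝ] E :=
  (-(1 / 4 : ℝ)) • (covEnd Γ J z v 0 * J z 0 + covEnd Γ J z v 1 * J z 1 + covEnd Γ J z v 2 * J z 2)

/-- The coordinates of `frameForm` in the quaternionic frame. -/
noncomputable def frameCoord (Γ : E → E →L[ℝ] E →L[ℝ] E) (J : E → Fin 3 → E →L[ℝ] E) (z v : E)
    (a : Fin 3) : ℝ :=
  -clmTrace E (frameForm Γ J z v * J z a) / clmTrace E 1

/-- The fibre component of horizontal lifts, in the coordinates of the bundle of frames. -/
def liftCoord (ψ y : Fin 3 → ℝ) (a : Fin 3) : ℝ :=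
  -(ψ a + (ψ (a + 1) * y (a + 2) - ψ (a + 2) * y (a + 1))) - (ψ 0 * y 0 + ψ 1 * y 1 + ψ 2 * y 2) * y a

/-- The horizontal lift of the constant vector field `v` in coordinates. -/
noncomputable def liftField (Γ : E → E →L[ℝ] E →L[ℝ] E) (J : E → Fin 3 → E →L[ℝ] E) (v : E)
    (p : E × ℝ × (Fin 3 → ℝ)) : E × ℝ × (Fin 3 → ℝ) :=
  (v, clmTrace E (Γ p.1 v), liftCoord (frameCoord Γ J p.1 v) p.2.2)

/-- The tautological quaternionic frame in coordinates. -/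
noncomputable def tautFrame (J : E → Fin 3 → E →L[ℝ] E) (p : E × ℝ × (Fin 3 → ℝ)) (a : Fin 3) :
    E →L[ℝ] E :=
  quatRot (J p.1) (onePlus p.2.2) a

variable {W : Set E} {Γ : E → E →L[ℝ] E →L[ℝ] E} {J : E → Fin 3 → E →L[ℝ] E} {z : E}

set_option synthInstance.maxHeartbeats 200000 in
theorem formCurvature_add_left (Γ : E → E →L[ℝ] E →L[ℝ] E) (z v v' w : E) :
    formCurvature Γ z (v + v') w = formCurvature Γ z v w + formCurvature Γ z v' w := by
  simp only [formCurvature, map_add, add_apply, add_mul, mul_add]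
  abel

set_option synthInstance.maxHeartbeats 200000 in
theorem formCurvature_smul_left (Γ : E → E →L[ℝ] E →L[ℝ] E) (z : E) (c : ℝ) (v w : E) :
    formCurvature Γ z (c • v) w = c • formCurvature Γ z v w := by
  simp only [formCurvature, map_smul, smul_apply, smul_mul_assoc, mul_smul_comm, smul_add, smul_sub]

theorem formCurvature_add_right (Γ : E → E →L[ℝ] E →L[ℝ] E) (z v w w' : E) :
    formCurvature Γ z v (w + w') = formCurvature Γ z v w + formCurvature Γ z v w' := by
  rw [formCurvature_swap, formCurvature_add_left, neg_add, ← formCurvature_swap,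
    ← formCurvature_swap]

theorem formCurvature_smul_right (Γ : E → E →L[ℝ] E →L[ℝ] E) (z : E) (c : ℝ) (v w : E) :
    formCurvature Γ z v (c • w) = c • formCurvature Γ z v w := by
  rw [formCurvature_swap, formCurvature_smul_left, ← smul_neg, ← formCurvature_swap]

namespace PreservesQuaternionic

theorem differentiableAt_frame (h : PreservesQuaternionic W Γ J) (hz : z ∈ W) (a : Fin 3) :
    DifferentiableAt ℝ (fun y => J y a) z :=
  ((h.contDiffOn_frame a).contDiffAt (h.isOpen.mem_nhds hz)).differentiableAt (by simp)

theorem differentiableAt_form (h : PreservesQuaternionic W Γ J) (hz : z ∈ W) :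
    DifferentiableAt ℝ Γ z :=
  (h.contDiffOn_form.contDiffAt (h.isOpen.mem_nhds hz)).differentiableAt (by simp)

/-- The right side is the covariant derivative of the product, so this is the Leibniz rule. It makes
J ↦ ∇J a derivation on the quaternionic algebra, to which `IsQuaternionic.derivation_inner` applies.
-/
theorem covEnd_mul_add (h : PreservesQuaternionic W Γ J) (hz : z ∈ W) (v : E) (a b : Fin 3) :
    covEnd Γ J z v a * J z b + J z a * covEnd Γ J z v b =
      fderiv ℝ (fun y => J y a * J y b) z v +
        (Γ z v * (J z a * J z b) - (J z a * J z b) * Γ z v) := by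
  rw [fderiv_fun_mul_apply (h.differentiableAt_frame hz a) (h.differentiableAt_frame hz b), covEnd,
    covEnd]
  noncomm_ring

theorem covEnd_of_mul (h : PreservesQuaternionic W Γ J) (hz : z ∈ W) (v : E) {a b c : Fin 3}
    {s : ℝ} (hs : ∀ z ∈ W, J z a * J z b = s • J z c) :
    covEnd Γ J z v a * J z b + J z a * covEnd Γ J z v b = s • covEnd Γ J z v c := by
  have h1 : (fun y => J y a * J y b) =ᶠ[𝓝 z] fun y => s • J y c := by
    filter_upwards [h.isOpen.mem_nhds hz] with y hy using hs y hy
  rw [h.covEnd_mul_add hz, h1.fderiv_eq, hs z hz, fderiv_fun_const_smul (h.differentiableAt_frame hz c),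
    covEnd, smul_apply, mul_smul_comm, smul_mul_assoc, smul_add, smul_sub]

theorem frameForm_commutator (h : PreservesQuaternionic W Γ J) (hz : z ∈ W) (v : E) (b : Fin 3) :
    frameForm Γ J z v * J z b - J z b * frameForm Γ J z v = covEnd Γ J z v b := by
  have hq := h.quaternionic
  refine (hq z hz).derivation_inner (fun a => ?_) ?_ ?_ ?_ ?_ ?_ ?_ b
  · have h1 : (fun y => J y a * J y a) =ᶠ[𝓝 z] fun _ => -1 := by
      filter_upwards [h.isOpen.mem_nhds hz] with y hy using (hq y hy).sq a
    rw [h.covEnd_mul_add hz, h1.fderiv_eq, (hq z hz).sq]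
    simp
  · simpa using h.covEnd_of_mul hz v (s := 1) fun z hz => by rw [one_smul, (hq z hz).mul_zero_one]
  · simpa using h.covEnd_of_mul hz v (s := 1) fun z hz => by rw [one_smul, (hq z hz).mul_one_two]
  · simpa using h.covEnd_of_mul hz v (s := 1) fun z hz => by rw [one_smul, (hq z hz).mul_two_zero]
  · simpa using h.covEnd_of_mul hz v (s := -1) fun z hz => by
      rw [neg_one_smul, (hq z hz).mul_one_zero]
  · simpa using h.covEnd_of_mul hz v (s := -1) fun z hz => by
      rw [neg_one_smul, (hq z hz).mul_two_one]
  · simpa using h.covEnd_of_mul hz v (s := -1) fun z hz => by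
      rw [neg_one_smul, (hq z hz).mul_zero_two]

theorem differentiableAt_form_fst (h : PreservesQuaternionic W Γ J) {p : E × ℝ × (Fin 3 → ℝ)}
    (hp : p.1 ∈ W) (w : E) :
    DifferentiableAt ℝ (fun p : E × ℝ × (Fin 3 → ℝ) => Γ p.1 w) p :=
  ((h.differentiableAt_form hp).clm_apply (differentiableAt_const w)).comp p differentiableAt_fst

theorem fderiv_form_fst (h : PreservesQuaternionic W Γ J) {p : E × ℝ × (Fin 3 → ℝ)}
    (hp : p.1 ∈ W) (w : E) (X : E × ℝ × (Fin 3 → ℝ)) :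
    fderiv ℝ (fun p : E × ℝ × (Fin 3 → ℝ) => Γ p.1 w) p X = fderiv ℝ Γ p.1 X.1 w := by
  have h1 := (h.differentiableAt_form hp).clm_apply (differentiableAt_const w)
  have h2 := (h1.hasFDerivAt.comp p hasFDerivAt_fst).fderiv
  rw [← fderiv_clm_apply_const (h.differentiableAt_form hp)]
  exact congrArg (fun L => L X) h2

variable [FiniteDimensional ℝ E] [Nontrivial E]

/-- The covariant derivatives of the frame are commutators with an imaginary quaternion. -/
theorem covEnd_eq (h : PreservesQuaternionic W Γ J) (hz : z ∈ W) (v : E) (b : Fin 3) :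
    covEnd Γ J z v b =
      quatMap (J z) (imQuat (frameCoord Γ J z v)) * J z b -
        J z b * quatMap (J z) (imQuat (frameCoord Γ J z v)) := by
  have hq := h.quaternionic z hz
  obtain ⟨c, hc⟩ : ∃ c, frameForm Γ J z v = quatMap (J z) c := by
    choose d hd using fun a => exists_quatMap_of_mem_span (h.covEnd_mem z hz v a)
    refine ⟨(-(1 / 4 : ℝ)) • (d 0 * quatUnit 0 + d 1 * quatUnit 1 + d 2 * quatUnit 2), ?_⟩
    simp only [quatMap_smul, quatMap_add, hq.quatMap_mul, quatMap_unit, ← hd]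
    rfl
  have ht : clmTrace E (1 : E →L[ℝ] E) ≠ 0 := by
    rw [clmTrace_one]; exact_mod_cast Module.finrank_pos.ne'
  have hy : ∀ a, frameCoord Γ J z v a = ![c.imI, c.imJ, c.imK] a := by
    intro a
    rw [frameCoord, hc, hq.trace_quatMap_mul clmTrace_mul_comm]
    field_simp
  -- The real part of c is central and drops out of the commutator, so the imaginary coordinates
  -- suffice.
  rw [← h.frameForm_commutator hz, hc, quatMap_imQuat, hy, hy, hy]
  simp [quatMap, add_mul, mul_add, sub_eq_add_neg]
  abel

end PreservesQuaternionic

/-- With ∇J = [ψ, J], the frame J rotated by q is parallel when q' = -ψq + cq for a real c, because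
a real factor of q does not affect the rotation. The chart uses q = 1 + y, whose real part is
constant; this fixes c = -⟨ψ, y⟩, and the imaginary part of q' is then `liftCoord`. -/
theorem liftCoord_quaternion (ψ y : Fin 3 → ℝ) :
    imQuat (liftCoord ψ y) = -(imQuat ψ * onePlus y) +
        (-(ψ 0 * y 0 + ψ 1 * y 1 + ψ 2 * y 2)) • onePlus y := by
  ext <;> simp [imQuat_re, imQuat_imI, imQuat_imJ, imQuat_imK, liftCoord, onePlus_re, onePlus_imI,
    onePlus_imJ, onePlus_imK] <;> ring

/-- The rotation as an intertwining relation: in this form it can be differentiated without touching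
the inverse of q. -/
theorem quatRot_mul_quatMap {R : Type*} [Ring R] [Algebra ℝ R] {J : Fin 3 → R}
    (h : IsQuaternionic J) {q : ℍ[ℝ]} (hq : q ≠ 0) (a : Fin 3) :
    quatRot J q a * quatMap J q = quatMap J q * J a := by
  have hn : normSq q ≠ 0 := by simpa using hq
  have h1 : quatMap J (star q) * quatMap J q = normSq q • 1 := by
    rw [← h.quatMap_mul, star_mul_self]
    simp [quatMap]
  rw [quatRot, smul_mul_assoc, mul_assoc, h1, mul_smul_comm, mul_one, smul_smul,
    inv_mul_cancel₀ hn, one_smul]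

namespace PreservesQuaternionic

theorem contDiffAt_tautFrame (h : PreservesQuaternionic W Γ J) {p : E × ℝ × (Fin 3 → ℝ)}
    (hp : p.1 ∈ W) (a : Fin 3) : ContDiffAt ℝ ∞ (fun p => tautFrame J p a) p := by
  have h1 := ContDiffOn.quatRot_onePlus (D := {p : E × ℝ × (Fin 3 → ℝ) | p.1 ∈ W})
    (J := fun p => J p.1) (y := fun p => p.2.2)
    (fun a => (h.contDiffOn_frame a).comp contDiff_fst.contDiffOn fun p hp => hp)
    (fun a => (contDiff_pi.1 (contDiff_snd.comp contDiff_snd) a).contDiffOn) a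
  exact h1.contDiffAt ((h.isOpen.preimage continuous_fst).mem_nhds hp)

variable [FiniteDimensional ℝ E] [Nontrivial E]

/-- The tautological frame is parallel along horizontal lifts. -/
theorem fderiv_tautFrame (h : PreservesQuaternionic W Γ J) {p : E × ℝ × (Fin 3 → ℝ)}
    (hp : p.1 ∈ W) (v : E) (a : Fin 3) :
    fderiv ℝ (fun p => tautFrame J p a) p (liftField Γ J v p) =
      tautFrame J p a * Γ p.1 v - Γ p.1 v * tautFrame J p a := by
  set Jh : E × ℝ × (Fin 3 → ℝ) → E →L[ℝ] E := fun p => quatMap (J p.1) (onePlus p.2.2) with hJh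
  set ψ := frameCoord Γ J p.1 v with hψ
  set P := quatMap (J p.1) (imQuat ψ) with hP
  set l := liftCoord ψ p.2.2 with hl
  have hJd : ∀ b, DifferentiableAt ℝ (fun p : E × ℝ × (Fin 3 → ℝ) => J p.1 b) p := fun b =>
    (h.differentiableAt_frame hp b).comp p differentiableAt_fst
  have hdv : ∀ b, fderiv ℝ (fun p : E × ℝ × (Fin 3 → ℝ) => J p.1 b) p (liftField Γ J v p) =
      P * J p.1 b - J p.1 b * P - (Γ p.1 v * J p.1 b - J p.1 b * Γ p.1 v) := by
    intro b
    have h1 := ((h.differentiableAt_frame hp b).hasFDerivAt.comp p hasFDerivAt_fst).fderiv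
    rw [← h.covEnd_eq hp, covEnd, add_sub_cancel_right]
    exact congrArg (fun L => L (liftField Γ J v p)) h1
  set pr : Fin 3 → E × ℝ × (Fin 3 → ℝ) →L[ℝ] ℝ := fun b =>
    ((ContinuousLinearMap.proj b : (Fin 3 → ℝ) →L[ℝ] ℝ) ∘L
      ContinuousLinearMap.snd ℝ ℝ (Fin 3 → ℝ)) ∘L ContinuousLinearMap.snd ℝ E (ℝ × (Fin 3 → ℝ))
    with hpr
  have hy : ∀ b, DifferentiableAt ℝ (fun p : E × ℝ × (Fin 3 → ℝ) => p.2.2 b) p := fun b =>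
    (pr b).differentiableAt
  have hyv : ∀ b, fderiv ℝ (fun p : E × ℝ × (Fin 3 → ℝ) => p.2.2 b) p (liftField Γ J v p) = l b :=
    fun b => congrArg (fun L => L (liftField Γ J v p)) (pr b).fderiv
  have hterm : ∀ b, DifferentiableAt ℝ (fun p : E × ℝ × (Fin 3 → ℝ) => p.2.2 b • J p.1 b) p :=
    fun b => (hy b).smul (hJd b)
  have hJh' : Jh = fun p => 1 + p.2.2 0 • J p.1 0 + p.2.2 1 • J p.1 1 + p.2.2 2 • J p.1 2 := by
    ext1 p; simp only [hJh, quatMap, onePlus_re, onePlus_imI, onePlus_imJ, onePlus_imK, one_smul]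
  have hone : DifferentiableAt ℝ (fun _ : E × ℝ × (Fin 3 → ℝ) => (1 : E →L[ℝ] E)) p :=
    differentiableAt_const _
  have hJhd : DifferentiableAt ℝ Jh p := by
    rw [hJh']
    exact ((hone.fun_add (hterm 0)).fun_add (hterm 1)).fun_add (hterm 2)
  have hq := h.quaternionic p.1 hp
  -- In covariant terms, ∇Jh = -Jh P + c Jh along the lift, with c the scalar of
  -- `liftCoord_quaternion`.
  have hJhv : fderiv ℝ Jh p (liftField Γ J v p) = -(Γ p.1 v * Jh p) + Jh p * Γ p.1 v - Jh p * P +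
      (-(ψ 0 * p.2.2 0 + ψ 1 * p.2.2 1 + ψ 2 * p.2.2 2)) • Jh p := by
    have h1 : quatMap (J p.1) (imQuat l) = -(P * Jh p) +
        (-(ψ 0 * p.2.2 0 + ψ 1 * p.2.2 1 + ψ 2 * p.2.2 2)) • Jh p := by
      rw [hl, liftCoord_quaternion, quatMap_add, quatMap_smul, quatMap_neg, hq.quatMap_mul]
    have h2 : fderiv ℝ Jh p (liftField Γ J v p) = quatMap (J p.1) (imQuat l) +
        (p.2.2 0 • (P * J p.1 0 - J p.1 0 * P - (Γ p.1 v * J p.1 0 - J p.1 0 * Γ p.1 v)) +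
        p.2.2 1 • (P * J p.1 1 - J p.1 1 * P - (Γ p.1 v * J p.1 1 - J p.1 1 * Γ p.1 v)) +
        p.2.2 2 • (P * J p.1 2 - J p.1 2 * P - (Γ p.1 v * J p.1 2 - J p.1 2 * Γ p.1 v))) := by
      rw [hJh', fderiv_fun_add ((hone.fun_add (hterm 0)).fun_add (hterm 1)) (hterm 2),
        fderiv_fun_add (hone.fun_add (hterm 0)) (hterm 1), fderiv_fun_add hone (hterm 0),
        add_apply, add_apply, add_apply, fderiv_fun_smul_apply (hy 0) (hJd 0),
        fderiv_fun_smul_apply (hy 1) (hJd 1), fderiv_fun_smul_apply (hy 2) (hJd 2), hdv, hdv, hdv,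
        hyv, hyv, hyv, fderiv_const_apply, zero_apply, quatMap_imQuat]
      module
    rw [h2, h1, hJh']
    simp only [mul_add, add_mul, mul_one, one_mul, smul_mul_assoc, mul_smul_comm]
    module
  have hmul : ∀ᶠ p' in 𝓝 p, tautFrame J p' a * Jh p' = Jh p' * J p'.1 a := by
    filter_upwards [(h.isOpen.preimage continuous_fst).mem_nhds hp] with p' hp'
    exact quatRot_mul_quatMap (h.quaternionic _ hp') (onePlus_ne_zero _) a
  have htd : DifferentiableAt ℝ (fun p => tautFrame J p a) p :=
    (h.contDiffAt_tautFrame hp a).differentiableAt (by simp)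
  have e := congrArg (fun L : _ →L[ℝ] (E →L[ℝ] E) => L (liftField Γ J v p))
    (Filter.EventuallyEq.fderiv_eq hmul)
  rw [fderiv_fun_mul_apply htd hJhd, fderiv_fun_mul_apply hJhd (hJd a), hdv, hJhv] at e
  have hT := hmul.self_of_nhds
  -- Differentiate I Jh = Jh J with ∇J = [P, J]: the P-terms and the c-terms cancel, leaving (∇I) Jh
  -- = 0.
  have hX : fderiv ℝ (fun p => tautFrame J p a) p (liftField Γ J v p) * Jh p =
      (tautFrame J p a * Γ p.1 v - Γ p.1 v * tautFrame J p a) * Jh p := by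
    rw [← eq_sub_iff_add_eq'] at e
    rw [e]
    have k : ∀ X, Jh p * (J p.1 a * X) = tautFrame J p a * (Jh p * X) := fun X => by
      rw [← mul_assoc, ← hT, mul_assoc]
    simp only [mul_add, add_mul, mul_sub, sub_mul, mul_neg, neg_mul, smul_mul_assoc,
      mul_smul_comm, mul_assoc, k, hT]
    simp only [← hT]
    abel
  have hinv : Jh p * quatMap (J p.1) (onePlus p.2.2)⁻¹ = 1 := by
    rw [hJh, ← hq.quatMap_mul, mul_inv_cancel₀ (onePlus_ne_zero _), quatMap_one]
  have hY := congrArg (fun X => X * quatMap (J p.1) (onePlus p.2.2)⁻¹) hX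
  simpa only [mul_assoc, hinv, mul_one] using hY

theorem differentiableAt_frameCoord (h : PreservesQuaternionic W Γ J) (hz : z ∈ W) (v : E)
    (a : Fin 3) : DifferentiableAt ℝ (fun z => frameCoord Γ J z v a) z := by
  have h1 : ∀ b, DifferentiableAt ℝ (fun z => covEnd Γ J z v b) z := fun b => by
    have h2 : DifferentiableAt ℝ (fderiv ℝ (fun y => J y b)) z :=
      (((h.contDiffOn_frame b).contDiffAt (h.isOpen.mem_nhds hz)).fderiv_right (m := 1)
        (WithTop.coe_le_coe.2 le_top)).differentiableAt one_ne_zero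
    have h3 := (h.differentiableAt_form hz).clm_apply (differentiableAt_const v)
    have h4 := h.differentiableAt_frame hz b
    exact (h2.clm_apply (differentiableAt_const v)).add ((h3.mul h4).sub (h4.mul h3))
  have h5 : ∀ b, DifferentiableAt ℝ (fun z => covEnd Γ J z v b * J z b) z := fun b =>
    (h1 b).mul (h.differentiableAt_frame hz b)
  have h6 : DifferentiableAt ℝ (fun z => frameForm Γ J z v) z :=
    (((h5 0).fun_add (h5 1)).fun_add (h5 2)).fun_const_smul _
  have h7 := ((contDiff_clmTrace E).differentiable (by simp)).differentiableAt.comp z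
    (h6.mul (h.differentiableAt_frame hz a))
  simp only [frameCoord, div_eq_mul_inv]
  exact h7.fun_neg.mul_const _

theorem differentiableAt_liftField (h : PreservesQuaternionic W Γ J) {p : E × ℝ × (Fin 3 → ℝ)}
    (hp : p.1 ∈ W) (v : E) : DifferentiableAt ℝ (liftField Γ J v) p := by
  have h1 : ∀ a, DifferentiableAt ℝ (fun p : E × ℝ × (Fin 3 → ℝ) => frameCoord Γ J p.1 v a) p :=
    fun a => (h.differentiableAt_frameCoord hp v a).comp p differentiableAt_fst
  have h2 : ∀ a, DifferentiableAt ℝ (fun p : E × ℝ × (Fin 3 → ℝ) => p.2.2 a) p := fun a =>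
    differentiableAt_pi.1 (differentiableAt_snd.comp p differentiableAt_snd) a
  have h3 := (h.differentiableAt_form hp).clm_apply (differentiableAt_const v)
  have h4 := ((contDiff_clmTrace E).differentiable (by simp)).differentiableAt.comp p
    (h3.comp p differentiableAt_fst)
  refine (differentiableAt_const v).prodMk (h4.prodMk (differentiableAt_pi.2 fun a => ?_))
  unfold liftCoord
  exact (((h1 a).add (((h1 _).mul (h2 _)).sub ((h1 _).mul (h2 _)))).neg).sub
    (((((h1 0).mul (h2 0)).add ((h1 1).mul (h2 1))).add ((h1 2).mul (h2 2))).mul (h2 a))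

/-- The base components of the lifts are constant, so the bracket is vertical. Being vertical is
what allows non-degeneracy of β on the vertical spaces to kill it. -/
theorem lieBracket_liftField_fst (h : PreservesQuaternionic W Γ J) {p : E × ℝ × (Fin 3 → ℝ)}
    (hp : p.1 ∈ W) (v w : E) :
    (VectorField.lieBracket ℝ (liftField Γ J v) (liftField Γ J w) p).1 = 0 := by
  have key : ∀ v X, (fderiv ℝ (liftField Γ J v) p X).1 = 0 := by
    intro v X
    have h1 := (hasFDerivAt_fst.comp p (h.differentiableAt_liftField hp v).hasFDerivAt).fderiv
    have h2 : (Prod.fst ∘ liftField Γ J v) = fun _ => v := rfl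
    rw [h2, fderiv_const_apply] at h1
    exact (congrArg (fun L => L X) h1).symm
  rw [VectorField.lieBracket, Prod.fst_sub, key, key, sub_zero]

/-- If the horizontal fields commute at a point, then the curvature commutes with the frame. -/
theorem formCurvature_commute (h : PreservesQuaternionic W Γ J) {p : E × ℝ × (Fin 3 → ℝ)}
    (hp : p.1 ∈ W) {v w : E}
    (hvw : VectorField.lieBracket ℝ (liftField Γ J v) (liftField Γ J w) p = 0) (a : Fin 3) :
    formCurvature Γ p.1 v w * tautFrame J p a = tautFrame J p a * formCurvature Γ p.1 v w := by
  have hcomm := fderiv_fderiv_comm ((h.contDiffAt_tautFrame hp a).of_le (WithTop.coe_le_coe.2 le_top))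
    (h.differentiableAt_liftField hp v) (h.differentiableAt_liftField hp w) hvw
  have hev : ∀ v, (fun p => fderiv ℝ (fun p => tautFrame J p a) p (liftField Γ J v p)) =ᶠ[𝓝 p]
      fun p => tautFrame J p a * Γ p.1 v - Γ p.1 v * tautFrame J p a := fun v => by
    filter_upwards [(h.isOpen.preimage continuous_fst).mem_nhds hp] with p' hp'
    exact h.fderiv_tautFrame hp' v a
  have htd : DifferentiableAt ℝ (fun p => tautFrame J p a) p :=
    (h.contDiffAt_tautFrame hp a).differentiableAt (by simp)
  have hD : ∀ v w, fderiv ℝ (fun p => tautFrame J p a * Γ p.1 w - Γ p.1 w * tautFrame J p a) p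
      (liftField Γ J v p) = tautFrame J p a * fderiv ℝ Γ p.1 v w +
        (tautFrame J p a * Γ p.1 v - Γ p.1 v * tautFrame J p a) * Γ p.1 w -
        (Γ p.1 w * (tautFrame J p a * Γ p.1 v - Γ p.1 v * tautFrame J p a) +
          fderiv ℝ Γ p.1 v w * tautFrame J p a) := by
    intro v w
    have k := h.differentiableAt_form_fst hp w
    rw [fderiv_fun_sub (htd.fun_mul k) (k.fun_mul htd), sub_apply, fderiv_fun_mul_apply htd k,
      fderiv_fun_mul_apply k htd, h.fderiv_tautFrame hp, h.fderiv_form_fst hp]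
    rfl
  -- Both mixed derivatives of the frame are now expressed by the first-order equation I' = [I, Γ];
  -- their difference is, up to sign, the commutator of the curvature with I.
  rw [(hev w).fderiv_eq, (hev v).fderiv_eq, hD, hD] at hcomm
  rw [← sub_eq_zero] at hcomm ⊢
  rw [← neg_eq_zero, ← hcomm, formCurvature]
  noncomm_ring

/-- Vanishing of the curvature in coordinates. -/
theorem formCurvature_eq_zero (h : PreservesQuaternionic W Γ J)
    (hsymm : ∀ z ∈ W, ∀ v w, Γ z v w = Γ z w v) {om : E → E [⋀^Fin 2]→L[ℝ] ℝ}
    (hom : ContDiffOn ℝ ∞ om W)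
    (hpar : ∀ z ∈ W, ∀ v a b, fderiv ℝ (fun y => om y ![a, b]) z v =
      om z ![Γ z v a, b] + om z ![a, Γ z v b])
    (hnd : ∀ z ∈ W, ∀ a, (∀ b, om z ![a, b] = 0) → a = 0)
    (hherm : ∀ z ∈ W, ∀ c a b, om z ![J z c a, J z c b] = om z ![a, b])
    {B : E × ℝ × (Fin 3 → ℝ) → (E × ℝ × (Fin 3 → ℝ)) [⋀^Fin 2]→L[ℝ] ℝ}
    (hB : ∀ p, p.1 ∈ W → DifferentiableAt ℝ B p) (hBd : ∀ p, p.1 ∈ W → extDeriv B p = 0)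
    (hBh : ∀ p, p.1 ∈ W → ∀ v ξ, B p ![liftField Γ J v p, ξ] = 0)
    (hBv : ∀ p, p.1 ∈ W → ∀ k, k.1 = 0 → (∀ k', k'.1 = 0 → B p ![k, k'] = 0) → k = 0)
    (hz : z ∈ W) (v w : E) : formCurvature Γ z v w = 0 := by
  -- At y = 0 the tautological frame is the local frame itself; the density coordinate plays no
  -- role.
  set p : E × ℝ × (Fin 3 → ℝ) := (z, 0, 0) with hp
  have hpW : p.1 ∈ W := hz
  have hev : ∀ v, ∀ᶠ y in 𝓝 p, ∀ ξ, B y ![liftField Γ J v y, ξ] = 0 := fun v => by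
    filter_upwards [(h.isOpen.preimage continuous_fst).mem_nhds hpW] with y hy using hBh y hy v
  -- The bracket is vertical and, by involutivity, in the kernel of B, which is non-degenerate on
  -- vertical vectors.
  have hbr : ∀ v w, VectorField.lieBracket ℝ (liftField Γ J v) (liftField Γ J w) p = 0 :=
    fun v w => hBv p hpW _ (h.lieBracket_liftField_fst hpW v w) fun k _ =>
      altBilin_lieBracket (hB p hpW) (h.differentiableAt_liftField hpW v)
        (h.differentiableAt_liftField hpW w) (hev v) (hev w) (hBd p hpW) k
  have htaut : ∀ a, tautFrame J p a = J z a := by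
    intro a
    have : onePlus (0 : Fin 3 → ℝ) = 1 := by ext <;> rfl
    change quatRot (J z) (onePlus 0) a = J z a
    rw [this, quatRot_one]
  have hc : ∀ a v w x, formCurvature Γ z v w (J z a x) = J z a (formCurvature Γ z v w x) := by
    intro a v w x
    have := h.formCurvature_commute hpW (hbr v w) a
    rw [htaut] at this
    exact congrArg (fun L => L x) this
  have hq := h.quaternionic z hz
  have hsq : ∀ a x, J z a (J z a x) = -x := fun a x => congrArg (fun L => L x) (hq.sq a)
  let R : E →ₗ[ℝ] E →ₗ[ℝ] Module.End ℝ E := LinearMap.mk₂ ℝ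
    (fun v w => (formCurvature Γ z v w).toLinearMap)
    (fun v v' w => congrArg _ (formCurvature_add_left Γ z v v' w))
    (fun c v w => congrArg _ (formCurvature_smul_left Γ z c v w))
    (fun v w w' => congrArg _ (formCurvature_add_right Γ z v w w'))
    (fun c v w => congrArg _ (formCurvature_smul_right Γ z c v w))
  let om' : E →ₗ[ℝ] E →ₗ[ℝ] ℝ := ContinuousLinearMap.coeLM ℝ ∘ₗ (altBilin (om z)).toLinearMap
  have h0 := curvature_eq_zero (R := R) (I := (J z 0).toLinearMap) (J := (J z 1).toLinearMap)
    (om := om')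
    (fun X Y Z => congrArg (fun L => L Z) (formCurvature_swap Γ z X Y))
    (fun X Y Z => formCurvature_bianchi h.isOpen h.contDiffOn_form hsymm hz X Y Z)
    (fun X Y Z => hc 0 X Y Z) (fun X Y Z => hc 1 X Y Z) (hsq 0) (hsq 1)
    (fun X => by
      have h1 := congrArg (fun L => L X) hq.mul_zero_one
      have h2 := congrArg (fun L => L X) hq.mul_one_zero
      exact h1.trans ((neg_neg _).symm.trans (congrArg Neg.neg h2.symm)))
    (fun X Y => altBilin_swap (om z) X Y) (hnd z hz) (hherm z hz 0) (hherm z hz 1)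
    (fun X Y Z U => formCurvature_skew h.isOpen h.contDiffOn_form hom hpar hz X Y Z U) v w
  ext x
  exact congrArg (fun L => L x) h0

end PreservesQuaternionic

end HorizontalFields

/-! ### Derivatives of functions through charts -/

section Charts

variable {F : Type*} [NormedAddCommGroup F] [NormedSpace ℝ F] {N : Type*} [TopologicalSpace N]
  [ChartedSpace F N] [IsManifold 𝓘(ℝ, F) ∞ N] {G : Type*} [NormedAddCommGroup G] [NormedSpace ℝ G]

theorem mdifferentiableAt_of_comp_symm {e : OpenPartialHomeomorph N F} (he : e ∈ atlas F N)
    {p : F} (hp : p ∈ e.target) {f : N → G} (hf : DifferentiableAt ℝ (fun y => f (e.symm y)) p) :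
    MDifferentiableAt 𝓘(ℝ, F) 𝓘(ℝ, G) f (e.symm p) := by
  have h1 : MDifferentiableAt 𝓘(ℝ, F) 𝓘(ℝ, F) e (e.symm p) :=
    mdifferentiableAt_atlas he (e.map_target hp)
  have h2 : MDifferentiableAt 𝓘(ℝ, F) 𝓘(ℝ, G) (fun y => f (e.symm y)) (e (e.symm p)) := by
    rw [e.right_inv hp]; exact hf.mdifferentiableAt
  refine (h2.comp (e.symm p) h1).congr_of_eventuallyEq ?_
  filter_upwards [e.open_source.mem_nhds (e.map_target hp)] with u hu
  rw [Function.comp_apply, e.left_inv hu]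

theorem mvfderiv_mfderiv_symm {e : OpenPartialHomeomorph N F} (he : e ∈ atlas F N)
    {p : F} (hp : p ∈ e.target) {f : N → G}
    (hf : MDifferentiableAt 𝓘(ℝ, F) 𝓘(ℝ, G) f (e.symm p)) (h : F) :
    mvfderiv 𝓘(ℝ, F) f (e.symm p) (mfderiv 𝓘(ℝ, F) 𝓘(ℝ, F) e.symm p h) =
      fderiv ℝ (fun y => f (e.symm y)) p h := by
  have h1 := mfderiv_comp_apply p hf (mdifferentiableAt_atlas_symm he hp) h
  rw [mfderiv_eq_fderiv] at h1
  exact h1.symm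

end Charts

/-! ### Vector fields in a chart of the base -/

section TangentCharts

variable {E : Type*} [NormedAddCommGroup E] [NormedSpace ℝ E] {M : Type*} [TopologicalSpace M]
  [ChartedSpace E M] [IsManifold 𝓘(ℝ, E) ∞ M] {x m : M} {z : E}

theorem coordIso_of_mem (hm : m ∈ (chartAt E x).source) :
    coordIso (E := E) x m =
      (trivializationAt E (TangentSpace 𝓘(ℝ, E)) x).continuousLinearEquivAt ℝ m hm := by
  rw [coordIso, dif_pos (show m ∈ (trivializationAt E (TangentSpace 𝓘(ℝ, E)) x).baseSet from hm)]

theorem coordIso_eq_snd (hm : m ∈ (chartAt E x).source) (v : TangentSpace 𝓘(ℝ, E) m) :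
    coordIso x m v = (trivializationAt E (TangentSpace 𝓘(ℝ, E)) x ⟨m, v⟩).2 := by
  rw [coordIso_of_mem hm]; rfl

theorem mfderiv_chartAt_apply (hm : m ∈ (chartAt E x).source) (v : TangentSpace 𝓘(ℝ, E) m) :
    mfderiv 𝓘(ℝ, E) 𝓘(ℝ, E) (chartAt E x) m v = coordIso x m v := by
  have h := TangentBundle.continuousLinearMapAt_trivializationAt (I := 𝓘(ℝ, E)) hm
  have h2 : coordIso x m v =
      (trivializationAt E (TangentSpace 𝓘(ℝ, E)) x).continuousLinearMapAt ℝ m v := by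
    rw [coordIso_of_mem hm]
    exact congrFun ((trivializationAt E (TangentSpace 𝓘(ℝ, E)) x).coe_continuousLinearEquivAt_eq hm) v
  rw [h2, h]
  rfl

theorem mfderiv_chartAt_symm_apply (hz : z ∈ (chartAt E x).target) (v : E) :
    mfderiv 𝓘(ℝ, E) 𝓘(ℝ, E) (chartAt E x).symm z v =
      (coordIso x ((chartAt E x).symm z)).symm v := by
  have h := (mdifferentiable_chart (I := 𝓘(ℝ, E)) x).comp_symm_deriv hz
  have h2 := congrArg (fun L => L v) h
  rw [ContinuousLinearEquiv.eq_symm_apply]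
  rw [← mfderiv_chartAt_apply ((chartAt E x).map_target hz)]
  exact h2

theorem mvfderiv_coordIso_symm {G : Type*} [NormedAddCommGroup G] [NormedSpace ℝ G]
    (hz : z ∈ (chartAt E x).target) {f : M → G}
    (hf : MDifferentiableAt 𝓘(ℝ, E) 𝓘(ℝ, G) f ((chartAt E x).symm z)) (v : E) :
    mvfderiv 𝓘(ℝ, E) f ((chartAt E x).symm z) ((coordIso x ((chartAt E x).symm z)).symm v) =
      fderiv ℝ (fun y => f ((chartAt E x).symm y)) z v := by
  rw [← mfderiv_chartAt_symm_apply hz, mvfderiv_mfderiv_symm (chart_mem_atlas E x) hz hf]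

theorem mdifferentiableAt_section_iff_coord (hm : m ∈ (chartAt E x).source)
    {Z : ∀ m : M, TangentSpace 𝓘(ℝ, E) m} :
    MDiffAt (T% Z) m ↔ MDifferentiableAt 𝓘(ℝ, E) 𝓘(ℝ, E) (fun m' => coordIso x m' (Z m')) m := by
  rw [(trivializationAt E (TangentSpace 𝓘(ℝ, E)) x).mdifferentiableAt_section_iff 𝓘(ℝ, E) Z hm]
  have : (fun m' => coordIso x m' (Z m')) =ᶠ[𝓝 m]
      fun m' => (trivializationAt E (TangentSpace 𝓘(ℝ, E)) x (Z m')).2 := by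
    filter_upwards [(chartAt E x).open_source.mem_nhds hm] with m' hm'
    exact coordIso_eq_snd hm' _
  exact ⟨fun h => h.congr_of_eventuallyEq this, fun h => h.congr_of_eventuallyEq this.symm⟩

theorem contMDiffOn_section_iff_coord {U : Set M} (hU : IsOpen U) (hUx : U ⊆ (chartAt E x).source)
    {Z : ∀ m : M, TangentSpace 𝓘(ℝ, E) m} :
    CMDiff[U] ∞ (T% Z) ↔ ContMDiffOn 𝓘(ℝ, E) 𝓘(ℝ, E) ∞ (fun m' => coordIso x m' (Z m')) U := by
  have h1 : U ⊆ (trivializationAt E (TangentSpace 𝓘(ℝ, E)) x).baseSet := hUx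
  refine ((trivializationAt E (TangentSpace 𝓘(ℝ, E)) x).contMDiffOn_section_iff hU h1).trans ?_
  exact contMDiffOn_congr fun m hm => (coordIso_eq_snd (hUx hm) _).symm

/-- The coordinate vector field with constant coordinates `w` in the chart at `x`. -/
noncomputable def coordField (x : M) (w : E) (m : M) : TangentSpace 𝓘(ℝ, E) m :=
  (coordIso x m).symm w

theorem coordIso_coordField (x m : M) (w : E) : coordIso x m (coordField x w m) = w :=
  (coordIso x m).apply_symm_apply w

theorem contMDiffOn_coordField (x : M) (w : E) :
    CMDiff[(chartAt E x).source] ∞ (T% (coordField x w)) := by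
  rw [contMDiffOn_section_iff_coord (chartAt E x).open_source subset_rfl]
  simp only [coordIso_coordField]
  exact contMDiffOn_const

theorem mdifferentiableAt_coordField (hm : m ∈ (chartAt E x).source) (w : E) :
    MDiffAt (T% (coordField x w)) m := by
  rw [mdifferentiableAt_section_iff_coord hm]
  simp only [coordIso_coordField]
  exact mdifferentiableAt_const

/-- A vector field in the chart at `x`. -/
noncomputable def fieldInChart (x : M) (Z : ∀ m : M, TangentSpace 𝓘(ℝ, E) m) (z : E) : E :=
  coordIso x ((chartAt E x).symm z) (Z ((chartAt E x).symm z))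

/-- Coordinate fields are pull-backs of constant fields by the chart, and pull-back commutes with
the bracket. This is what turns vanishing torsion into symmetry of `chartForm`. -/
theorem mlieBracket_coordField [CompleteSpace E] (hm : m ∈ (chartAt E x).source) (v w : E) :
    VectorField.mlieBracket 𝓘(ℝ, E) (coordField x v) (coordField x w) m = 0 := by
  have : IsManifold 𝓘(ℝ, E) (minSmoothness ℝ 2) M :=
    IsManifold.of_le (n := ∞) (by
      rw [minSmoothness_of_isRCLikeNormedField]; exact WithTop.coe_le_coe.2 le_top)
  have : IsManifold 𝓘(ℝ, E) (minSmoothness ℝ 3) M :=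
    IsManifold.of_le (n := ∞) (by
      rw [minSmoothness_of_isRCLikeNormedField]; exact WithTop.coe_le_coe.2 le_top)
  let c : E → ∀ y : E, TangentSpace 𝓘(ℝ, E) y := fun v _ => v
  have h1 : ∀ v : E, (coordField x v : ∀ m : M, TangentSpace 𝓘(ℝ, E) m) =ᶠ[𝓝 m]
      VectorField.mpullback 𝓘(ℝ, E) 𝓘(ℝ, E) (chartAt E x) (c v) := by
    intro v
    filter_upwards [(chartAt E x).open_source.mem_nhds hm] with m' hm'
    have h2 : mfderiv 𝓘(ℝ, E) 𝓘(ℝ, E) (chartAt E x) m' =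
        ((coordIso x m' : TangentSpace 𝓘(ℝ, E) m' ≃L[ℝ] E) : TangentSpace 𝓘(ℝ, E) m' →L[ℝ] E) := by
      ext v; exact mfderiv_chartAt_apply hm' v
    have h3 := congrArg (fun L : E →L[ℝ] _ => L v)
      (ContinuousLinearMap.inverse_equiv (coordIso x m'))
    refine h3.symm.trans ?_
    exact congrArg (fun L : TangentSpace 𝓘(ℝ, E) m' →L[ℝ] E => ContinuousLinearMap.inverse L v) h2.symm
  have hd : ∀ v : E, MDiffAt (T% (c v)) (chartAt E x m) := by
    intro v
    exact (contMDiffAt_vectorSpace_iff_contDiffAt (n := 1) (V := c v).2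
      contDiffAt_const).mdifferentiableAt one_ne_zero
  have h4 := VectorField.mpullback_mlieBracket (n := 2) (hd v) (hd w)
    ((contMDiffAt_of_mem_maximalAtlas (IsManifold.chart_mem_maximalAtlas x) hm)) (by simp)
  refine ((h1 v).mlieBracket_vectorField_eq (h1 w)).trans (h4.symm.trans ?_)
  have h5 : VectorField.mlieBracket 𝓘(ℝ, E) (c v) (c w) = 0 := by
    rw [← VectorField.mlieBracketWithin_univ, VectorField.mlieBracketWithin_eq_lieBracketWithin]
    ext y
    simp [VectorField.lieBracketWithin, c]
    rfl
  rw [h5]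
  exact map_zero _

end TangentCharts

/-! ### The connection form in a chart -/

section ConnectionInChart

variable {E : Type*} [NormedAddCommGroup E] [NormedSpace ℝ E] {M : Type*} [TopologicalSpace M]
  [ChartedSpace E M] [IsManifold 𝓘(ℝ, E) ∞ M] {x m : M} {z : E}

theorem mdifferentiableAt_coord (hm : m ∈ (chartAt E x).source)
    {Z : ∀ m : M, TangentSpace 𝓘(ℝ, E) m} (hZ : MDiffAt (T% Z) m) :
    MDifferentiableAt 𝓘(ℝ, E) 𝓘(ℝ, E) (fun m' => coordIso x m' (Z m')) m :=
  (mdifferentiableAt_section_iff_coord hm).1 hZ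

/-- ∇ and the derivative in the chart obey the same Leibniz rule, so their difference depends only
on the value of Z at m. -/
theorem tensorialAt_cov_sub_mvfderiv (cov : Connection E M) (hm : m ∈ (chartAt E x).source)
    (X : TangentSpace 𝓘(ℝ, E) m) :
    TensorialAt 𝓘(ℝ, E) E (fun Z : ∀ m : M, TangentSpace 𝓘(ℝ, E) m =>
      coordIso x m (cov Z m X) - mvfderiv 𝓘(ℝ, E) (fun m' => coordIso x m' (Z m')) m X) m where
  smul {f σ} hf hσ := by
    have h1 : (fun m' => coordIso x m' ((f • σ) m')) = f • fun m' => coordIso x m' (σ m') := by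
      ext1 m'
      exact map_smul (coordIso x m') _ _
    have h2 := cov.isCovariantDerivativeOnUniv.leibniz hσ hf
    have h3 := mvfderiv_smul hf (mdifferentiableAt_coord hm hσ)
    rw [h1, h2, h3]
    simp only [add_apply, smul_apply, ContinuousLinearMap.smulRight_apply, map_add, map_smul]
    module
  add {σ σ'} hσ hσ' := by
    have h1 : (fun m' => coordIso x m' ((σ + σ') m')) =
        (fun m' => coordIso x m' (σ m')) + fun m' => coordIso x m' (σ' m') := by
      ext1 m'
      exact map_add (coordIso x m') _ _
    have h2 := cov.isCovariantDerivativeOnUniv.add hσ hσ'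
    have h3 := mvfderiv_add (mdifferentiableAt_coord hm hσ) (mdifferentiableAt_coord hm hσ')
    rw [h1, h2, h3]
    simp only [add_apply, map_add]
    abel

theorem coordField_add (x : M) (w w' : E) :
    (coordField x (w + w') : ∀ m : M, TangentSpace 𝓘(ℝ, E) m) = coordField x w + coordField x w' := by
  ext1 m
  exact map_add (coordIso x m).symm w w'

theorem coordField_smul (x : M) (c : ℝ) (w : E) :
    (coordField x (c • w) : ∀ m : M, TangentSpace 𝓘(ℝ, E) m) = c • coordField x w := by
  ext1 m
  exact map_smul (coordIso x m).symm c w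

variable [FiniteDimensional ℝ E]

/-- The connection form of `cov` in the chart at `x`, as a bilinear map. -/
noncomputable def chartFormAux (cov : Connection E M) (x : M) {z : E}
    (hz : z ∈ (chartAt E x).target) : E →ₗ[ℝ] E →ₗ[ℝ] E :=
  LinearMap.mk₂ ℝ (fun v w => coordIso x ((chartAt E x).symm z)
      (cov (coordField x w) ((chartAt E x).symm z) (coordField x v ((chartAt E x).symm z))))
    (fun v v' w => by simp only [coordField_add, Pi.add_apply, map_add])
    (fun c v w => by simp only [coordField_smul, Pi.smul_apply, map_smul])
    (fun v w w' => by
      have hm := (chartAt E x).map_target hz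
      rw [coordField_add, cov.isCovariantDerivativeOnUniv.add (mdifferentiableAt_coordField hm w)
        (mdifferentiableAt_coordField hm w')]
      simp only [add_apply, map_add])
    (fun c v w => by
      have hm := (chartAt E x).map_target hz
      rw [coordField_smul, cov.isCovariantDerivativeOnUniv.smul_const c
        (mdifferentiableAt_coordField hm w)]
      simp only [smul_apply, map_smul])

open Classical in
/-- The connection form of `cov` in the chart at `x`. -/
noncomputable def chartForm (cov : Connection E M) (x : M) (z : E) : E →L[ℝ] E →L[ℝ] E :=
  if hz : z ∈ (chartAt E x).target then
    LinearMap.toContinuousLinearMap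
      ((LinearMap.toContinuousLinearMap : (E →ₗ[ℝ] E) ≃ₗ[ℝ] (E →L[ℝ] E)).toLinearMap ∘ₗ
        chartFormAux cov x hz)
  else 0

theorem chartForm_apply (cov : Connection E M) (hz : z ∈ (chartAt E x).target) (v w : E) :
    chartForm cov x z v w = coordIso x ((chartAt E x).symm z)
      (cov (coordField x w) ((chartAt E x).symm z) (coordField x v ((chartAt E x).symm z))) := by
  rw [chartForm, dif_pos hz]
  rfl

/-- By tensoriality of the zeroth-order part, Z may be replaced there by the coordinate field with
the same value, whose chart derivative is zero. -/
theorem coordIso_cov (cov : Connection E M) (hz : z ∈ (chartAt E x).target)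
    {Z : ∀ m : M, TangentSpace 𝓘(ℝ, E) m} (hZ : MDiffAt (T% Z) ((chartAt E x).symm z)) (v : E) :
    coordIso x ((chartAt E x).symm z)
      (cov Z ((chartAt E x).symm z) (coordField x v ((chartAt E x).symm z))) =
      fderiv ℝ (fieldInChart x Z) z v + chartForm cov x z v (fieldInChart x Z z) := by
  have hm := (chartAt E x).map_target hz
  have h1 := (tensorialAt_cov_sub_mvfderiv cov hm
    (coordField x v ((chartAt E x).symm z))).pointwise hZ
    (mdifferentiableAt_coordField hm (fieldInChart x Z z))
    ((coordIso x ((chartAt E x).symm z)).symm_apply_apply _).symm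
  simp only [coordIso_coordField, mvfderiv_const, zero_apply, sub_zero] at h1
  have h2 := mvfderiv_coordIso_symm hz (mdifferentiableAt_coord hm hZ) v
  rw [chartForm_apply cov hz, ← h1]
  have h3 : fderiv ℝ (fieldInChart x Z) z v =
    mvfderiv 𝓘(ℝ, E) (fun m' => coordIso x m' (Z m')) ((chartAt E x).symm z)
      (coordField x v ((chartAt E x).symm z)) := h2.symm
  rw [h3]
  abel

/-- Coordinate fields are smooth only over the chart domain, so near a given point they are cut off
by a bump function to a global smooth field; ∇ is local and does not see the cut-off where the bump
equals 1. -/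
theorem contMDiffOn_cov_coordField [T2Space M] {cov : Connection E M}
    (hcov : CovariantDerivative.ContMDiffCovariantDerivative cov ∞) (x : M) (v w : E) :
    CMDiff[(chartAt E x).source] ∞ (T% (fun m => cov (coordField x w) m (coordField x v m))) := by
  intro m hm
  have hs : (chartAt E x).source ∈ 𝓝 m := (chartAt E x).open_source.mem_nhds hm
  obtain ⟨f, -, hf⟩ := (SmoothBumpFunction.nhds_basis_tsupport (I := 𝓘(ℝ, E)) m).mem_iff.1 hs
  have h1 : CMDiff ∞ (T% ((f : M → ℝ) • (coordField x w : ∀ m : M, TangentSpace 𝓘(ℝ, E) m))) :=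
    ContMDiffOn.smul_section_of_tsupport f.contMDiff.contMDiffOn (chartAt E x).open_source hf
      (contMDiffOn_coordField x w)
  have h2 := (hcov.contMDiff.contMDiff (h1.contMDiffOn)).contMDiffAt (x := m) Filter.univ_mem
  have h3 := h2.clm_bundle_apply ((contMDiffOn_coordField x v).contMDiffAt hs)
  refine ContMDiffAt.contMDiffWithinAt (h3.congr_of_eventuallyEq ?_)
  filter_upwards [f.eventuallyEq_one.eventually_nhds, hs] with m' hm' hs'
  have h4 : cov.toFun ((f : M → ℝ) • (coordField x w : ∀ m : M, TangentSpace 𝓘(ℝ, E) m)) m' =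
      cov.toFun (coordField x w) m' := by
    refine cov.isCovariantDerivativeOnUniv.congr_of_eventuallyEq
      (h1.mdifferentiableAt (by simp)) (mdifferentiableAt_coordField hs' w) Filter.univ_mem ?_
    filter_upwards [hm'] with m'' hm''
    simp [hm'']
  rw [h4]

theorem contDiffOn_chartForm [T2Space M] {cov : Connection E M}
    (hcov : CovariantDerivative.ContMDiffCovariantDerivative cov ∞) (x : M) :
    ContDiffOn ℝ ∞ (chartForm cov x) (chartAt E x).target := by
  refine contDiffOn_clm_apply.2 fun v => contDiffOn_clm_apply.2 fun w => ?_
  have h1 := (contMDiffOn_section_iff_coord (chartAt E x).open_source subset_rfl).1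
    (contMDiffOn_cov_coordField hcov x v w)
  have h2 := h1.comp (contMDiffOn_chart_symm (x := x) (I := 𝓘(ℝ, E)) (n := ∞))
    (fun z hz => (chartAt E x).map_target hz)
  exact h2.contDiffOn.congr fun z hz => chartForm_apply cov hz v w

theorem chartForm_symm {cov : Connection E M} (htor : cov.torsion = 0)
    (hz : z ∈ (chartAt E x).target) (v w : E) :
    chartForm cov x z v w = chartForm cov x z w v := by
  have hm := (chartAt E x).map_target hz
  have := FiniteDimensional.complete ℝ E
  have h1 := (CovariantDerivative.torsion_eq_zero_iff cov).1 htor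
    (mdifferentiableAt_coordField hm v) (mdifferentiableAt_coordField hm w)
  rw [mlieBracket_coordField hm, sub_eq_zero] at h1
  rw [chartForm_apply cov hz, chartForm_apply cov hz, h1]

end ConnectionInChart

/-! ### The curvature in a chart -/

section CurvatureInChart

variable {E : Type*} [NormedAddCommGroup E] [NormedSpace ℝ E]

set_option synthInstance.maxHeartbeats 200000 in
theorem fderiv_covariant [FiniteDimensional ℝ E] {Γ : E → E →L[ℝ] E →L[ℝ] E} {Y Z : E → E} {z : E}
    (hΓ : DifferentiableAt ℝ Γ z) (hY : DifferentiableAt ℝ Y z) (hZ : ContDiffAt ℝ 2 Z z) (u : E) :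
    fderiv ℝ (fun y => fderiv ℝ Z y (Y y) + Γ y (Y y) (Z y)) z u =
      fderiv ℝ (fderiv ℝ Z) z u (Y z) + fderiv ℝ Z z (fderiv ℝ Y z u) +
        (fderiv ℝ Γ z u (Y z) (Z z) + Γ z (fderiv ℝ Y z u) (Z z) +
          Γ z (Y z) (fderiv ℝ Z z u)) := by
  have hd : DifferentiableAt ℝ (fderiv ℝ Z) z :=
    (hZ.fderiv_right (m := 1) (by norm_num)).differentiableAt one_ne_zero
  have hZd : DifferentiableAt ℝ Z z := hZ.differentiableAt two_ne_zero
  have hΓY : DifferentiableAt ℝ (fun y => Γ y (Y y)) z := hΓ.clm_apply hY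
  rw [fderiv_fun_add (hd.clm_apply hY) (hΓY.clm_apply hZd), add_apply,
    fderiv_clm_apply_apply hd hY, fderiv_clm_apply_apply hΓY hZd, fderiv_clm_apply_apply hΓ hY]
  simp only [add_apply]
  abel

variable {M : Type*} [TopologicalSpace M]
  [ChartedSpace E M] [IsManifold 𝓘(ℝ, E) ∞ M] {x : M} {z : E}

theorem coordField_fieldInChart (x : M) (Z : ∀ m : M, TangentSpace 𝓘(ℝ, E) m) (z : E) :
    coordField x (fieldInChart x Z z) ((chartAt E x).symm z) = Z ((chartAt E x).symm z) :=
  (coordIso x ((chartAt E x).symm z)).symm_apply_apply _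

theorem contDiffAt_fieldInChart {Z : ∀ m : M, TangentSpace 𝓘(ℝ, E) m} (hZ : CMDiff ∞ (T% Z))
    (hz : z ∈ (chartAt E x).target) : ContDiffAt ℝ ∞ (fieldInChart x Z) z := by
  have h1 := (contMDiffOn_section_iff_coord (chartAt E x).open_source subset_rfl).1
    (hZ.contMDiffOn (s := (chartAt E x).source))
  have h2 := h1.comp (contMDiffOn_chart_symm (x := x) (I := 𝓘(ℝ, E)) (n := ∞))
    (fun z hz => (chartAt E x).map_target hz)
  exact h2.contDiffOn.contDiffAt ((chartAt E x).open_target.mem_nhds hz)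

variable [FiniteDimensional ℝ E]

theorem fieldInChart_cov_eventuallyEq (cov : Connection E M) (hz : z ∈ (chartAt E x).target)
    {Y Z : ∀ m : M, TangentSpace 𝓘(ℝ, E) m} (hZ : CMDiff ∞ (T% Z)) :
    fieldInChart x (fun m => cov Z m (Y m)) =ᶠ[𝓝 z] fun y =>
      fderiv ℝ (fieldInChart x Z) y (fieldInChart x Y y) +
        chartForm cov x y (fieldInChart x Y y) (fieldInChart x Z y) := by
  filter_upwards [(chartAt E x).open_target.mem_nhds hz] with y hy
  rw [← coordIso_cov cov hy (hZ.mdifferentiableAt (by simp)), coordField_fieldInChart]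
  rfl

set_option synthInstance.maxHeartbeats 200000 in
theorem coordIso_cov_cov [T2Space M] {cov : Connection E M}
    (hcov : CovariantDerivative.ContMDiffCovariantDerivative cov ∞)
    (hz : z ∈ (chartAt E x).target) {X Y Z : ∀ m : M, TangentSpace 𝓘(ℝ, E) m}
    (hY : CMDiff ∞ (T% Y)) (hZ : CMDiff ∞ (T% Z)) :
    coordIso x ((chartAt E x).symm z) (cov (fun m => cov Z m (Y m)) ((chartAt E x).symm z)
        (X ((chartAt E x).symm z))) =
      fderiv ℝ (fderiv ℝ (fieldInChart x Z)) z (fieldInChart x X z) (fieldInChart x Y z) +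
      fderiv ℝ (fieldInChart x Z) z (fderiv ℝ (fieldInChart x Y) z (fieldInChart x X z)) +
      (fderiv ℝ (chartForm cov x) z (fieldInChart x X z) (fieldInChart x Y z)
          (fieldInChart x Z z) +
        chartForm cov x z (fderiv ℝ (fieldInChart x Y) z (fieldInChart x X z))
          (fieldInChart x Z z) +
        chartForm cov x z (fieldInChart x Y z)
          (fderiv ℝ (fieldInChart x Z) z (fieldInChart x X z))) +
      chartForm cov x z (fieldInChart x X z) (fderiv ℝ (fieldInChart x Z) z (fieldInChart x Y z) +
        chartForm cov x z (fieldInChart x Y z) (fieldInChart x Z z)) := by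
  have hm := (chartAt E x).map_target hz
  have hev := fieldInChart_cov_eventuallyEq (Y := Y) cov hz hZ
  have hΓ : DifferentiableAt ℝ (chartForm cov x) z :=
    ((contDiffOn_chartForm hcov x).contDiffAt ((chartAt E x).open_target.mem_nhds hz)
      ).differentiableAt (by simp)
  have hYz := (contDiffAt_fieldInChart hY hz).differentiableAt (by simp)
  have hZz : ContDiffAt ℝ 2 (fieldInChart x Z) z :=
    (contDiffAt_fieldInChart hZ hz).of_le (WithTop.coe_le_coe.2 le_top)
  have hd : DifferentiableAt ℝ (fun y => fderiv ℝ (fieldInChart x Z) y (fieldInChart x Y y) +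
        chartForm cov x y (fieldInChart x Y y) (fieldInChart x Z y)) z :=
    (((hZz.fderiv_right (m := 1) (by norm_num)).differentiableAt one_ne_zero).clm_apply hYz).add
      ((hΓ.clm_apply hYz).clm_apply (hZz.differentiableAt two_ne_zero))
  -- The coordinate formula for ∇ is about to be applied to ∇_Y Z itself, which must first be known
  -- to be a differentiable section.
  have hV : MDiffAt (T% (fun m => cov Z m (Y m))) ((chartAt E x).symm z) := by
    rw [mdifferentiableAt_section_iff_coord hm]
    exact mdifferentiableAt_of_comp_symm (chart_mem_atlas E x) hz (hd.congr_of_eventuallyEq hev)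
  have h1 := coordIso_cov cov hz hV (fieldInChart x X z)
  rw [coordField_fieldInChart] at h1
  rw [h1, hev.fderiv_eq, hev.eq_of_nhds, fderiv_covariant hΓ hYz hZz]

/-- The second derivatives of Z cancel by symmetry and the derivatives of X and Y cancel against the
bracket term, so only the values of the three fields survive. -/
theorem coordIso_curvature [T2Space M] {cov : Connection E M}
    (hcov : CovariantDerivative.ContMDiffCovariantDerivative cov ∞) (htor : cov.torsion = 0)
    (hz : z ∈ (chartAt E x).target) {X Y Z : ∀ m : M, TangentSpace 𝓘(ℝ, E) m}
    (hX : CMDiff ∞ (T% X)) (hY : CMDiff ∞ (T% Y)) (hZ : CMDiff ∞ (T% Z)) :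
    coordIso x ((chartAt E x).symm z) (curvature cov X Y Z ((chartAt E x).symm z)) =
      formCurvature (chartForm cov x) z (fieldInChart x X z) (fieldInChart x Y z)
        (fieldInChart x Z z) := by
  have := FiniteDimensional.complete ℝ E
  have hXd := hX.mdifferentiableAt (x := (chartAt E x).symm z) (by simp)
  have hYd := hY.mdifferentiableAt (x := (chartAt E x).symm z) (by simp)
  have hZd := hZ.mdifferentiableAt (x := (chartAt E x).symm z) (by simp)
  have hb := (CovariantDerivative.torsion_eq_zero_iff cov).1 htor hXd hYd
  have h1 := coordIso_cov cov hz hYd (fieldInChart x X z)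
  have h2 := coordIso_cov cov hz hXd (fieldInChart x Y z)
  rw [coordField_fieldInChart] at h1 h2
  -- The bracket is read off from the torsion-free identity [X, Y] = ∇_X Y - ∇_Y X, where the terms
  -- with Γ cancel by symmetry.
  have hbr : fieldInChart x (VectorField.mlieBracket 𝓘(ℝ, E) X Y) z =
      fderiv ℝ (fieldInChart x Y) z (fieldInChart x X z) -
        fderiv ℝ (fieldInChart x X) z (fieldInChart x Y z) := by
    rw [fieldInChart, ← hb, map_sub, h1, h2, chartForm_symm htor hz]
    abel
  have h3 := coordIso_cov cov hz hZd (fieldInChart x (VectorField.mlieBracket 𝓘(ℝ, E) X Y) z)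
  rw [coordField_fieldInChart, hbr] at h3
  have hsymm : IsSymmSndFDerivAt ℝ (fieldInChart x Z) z :=
    ((contDiffAt_fieldInChart hZ hz).of_le (m := 2)
      (WithTop.coe_le_coe.2 le_top)).isSymmSndFDerivAt (by simp)
  rw [curvature, map_sub, map_sub, coordIso_cov_cov hcov hz hY hZ, coordIso_cov_cov hcov hz hX hZ,
    h3, hsymm.eq (fieldInChart x X z)]
  simp only [formCurvature, add_apply, sub_apply, map_add, map_sub,
    mul_apply_eq_comp]
  abel

end CurvatureInChart

/-! ### Two-forms in a chart of the base -/

section FormInChart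

variable {E : Type*} [NormedAddCommGroup E] [NormedSpace ℝ E] {M : Type*} [TopologicalSpace M]
  [ChartedSpace E M] [IsManifold 𝓘(ℝ, E) ∞ M] {x : M} {z : E}

theorem TwoForm.inChart_chartAt_apply (om : TwoForm E M) (hz : z ∈ (chartAt E x).target) (a b : E) :
    om.inChart (chartAt E x) z ![a, b] = om ((chartAt E x).symm z)
      ![coordField x a ((chartAt E x).symm z), coordField x b ((chartAt E x).symm z)] := by
  have h : (mfderiv 𝓘(ℝ, E) 𝓘(ℝ, E) (chartAt E x).symm z) ∘ ![a, b] =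
      ![coordField x a ((chartAt E x).symm z), coordField x b ((chartAt E x).symm z)] := by
    ext1 i
    fin_cases i
    · exact mfderiv_chartAt_symm_apply hz a
    · exact mfderiv_chartAt_symm_apply hz b
  exact congrArg (om ((chartAt E x).symm z)) h

variable [FiniteDimensional ℝ E]

-- Parallelism is tested on coordinate fields: their covariant derivatives at the point are given by
-- `chartForm`.
set_option synthInstance.maxHeartbeats 200000 in
theorem TwoForm.inChart_parallel {om : TwoForm E M} (hom : om.IsSmooth) {cov : Connection E M}
    (hpar : ∀ (m : M) (X : TangentSpace 𝓘(ℝ, E) m) (Y Z : ∀ m : M, TangentSpace 𝓘(ℝ, E) m),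
      MDiffAt (T% Y) m → MDiffAt (T% Z) m →
      mvfderiv 𝓘(ℝ, E) (fun m' => om m' ![Y m', Z m']) m X =
        om m ![cov Y m X, Z m] + om m ![Y m, cov Z m X])
    (hz : z ∈ (chartAt E x).target) (v a b : E) :
    fderiv ℝ (fun y => om.inChart (chartAt E x) y ![a, b]) z v =
      om.inChart (chartAt E x) z ![chartForm cov x z v a, b] +
        om.inChart (chartAt E x) z ![a, chartForm cov x z v b] := by
  have hm := (chartAt E x).map_target hz
  have hev : (fun y => om.inChart (chartAt E x) y ![a, b]) =ᶠ[𝓝 z] fun y =>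
      om ((chartAt E x).symm y)
        ![coordField x a ((chartAt E x).symm y), coordField x b ((chartAt E x).symm y)] := by
    filter_upwards [(chartAt E x).open_target.mem_nhds hz] with y hy
    exact om.inChart_chartAt_apply hy a b
  have hd : DifferentiableAt ℝ (fun y => om.inChart (chartAt E x) y ![a, b]) z := by
    have h1 := ((hom _ (chart_mem_atlas E x)).contDiffAt
      ((chartAt E x).open_target.mem_nhds hz)).differentiableAt (by simp)
    have h2 := (contDiff_altBilin (E := E)).differentiable (by simp) (om.inChart (chartAt E x) z)
    exact ((h2.comp z h1).clm_apply (differentiableAt_const a)).clm_apply (differentiableAt_const b)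
  have hf := mdifferentiableAt_of_comp_symm (chart_mem_atlas E x) hz
    (f := fun m => om m ![coordField x a m, coordField x b m]) (hd.congr_of_eventuallyEq hev.symm)
  have h1 := hpar _ (coordField x v ((chartAt E x).symm z)) _ _ (mdifferentiableAt_coordField hm a)
    (mdifferentiableAt_coordField hm b)
  have h2 := mvfderiv_coordIso_symm hz hf v
  have hc : ∀ w, cov (coordField x w) ((chartAt E x).symm z)
      (coordField x v ((chartAt E x).symm z)) =
      coordField x (chartForm cov x z v w) ((chartAt E x).symm z) := by
    intro w
    rw [chartForm_apply cov hz]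
    exact ((coordIso x ((chartAt E x).symm z)).symm_apply_apply _).symm
  rw [hc, hc] at h1
  rw [om.inChart_chartAt_apply hz, om.inChart_chartAt_apply hz, hev.fderiv_eq, ← h2]
  exact h1

theorem TwoForm.IsNondegenerate.inChart {om : TwoForm E M} (hom : om.IsNondegenerate)
    (hz : z ∈ (chartAt E x).target) {a : E}
    (ha : ∀ b, om.inChart (chartAt E x) z ![a, b] = 0) : a = 0 := by
  have h1 : coordField x a ((chartAt E x).symm z) = 0 := hom _ _ fun Y => by
    have h2 := ha (coordIso x ((chartAt E x).symm z) Y)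
    rw [om.inChart_chartAt_apply hz] at h2
    rwa [coordField, coordField, ContinuousLinearEquiv.symm_apply_apply] at h2
  exact (map_eq_zero_iff _ (coordIso x ((chartAt E x).symm z)).symm.injective).1 h1

end FormInChart

/-! ### A local admissible frame in coordinates -/

section LocalFrameCoordinates

variable {E : Type*} [NormedAddCommGroup E] [NormedSpace ℝ E] {M : Type*} [TopologicalSpace M]
  [ChartedSpace E M] [IsManifold 𝓘(ℝ, E) ∞ M] [FiniteDimensional ℝ E]
  {Q : AlmostQuaternionicStructure E M} (σ : LocalFrame Q)

theorem IsQuaternionic.map {R R' : Type*} [Ring R] [Algebra ℝ R] [Ring R'] [Algebra ℝ R']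
    {J : Fin 3 → R} (h : IsQuaternionic J) (f : R →ₐ[ℝ] R') :
    IsQuaternionic fun a => f (J a) where
  sq a := by rw [← map_mul, h.sq, map_neg, map_one]
  triple := by rw [← map_mul, ← map_mul, h.triple, map_neg, map_one]

/-- The coordinates of the points of the domain of a local frame. -/
def LocalFrame.coordDom : Set E :=
  {z | z ∈ (chartAt E σ.center).target ∧ (chartAt E σ.center).symm z ∈ σ.dom}

/-- A local frame in coordinates. -/
noncomputable def LocalFrame.coordFrame (z : E) (a : Fin 3) : E →L[ℝ] E :=
  clmConj (coordIso σ.center ((chartAt E σ.center).symm z))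
    ((σ.frame ((chartAt E σ.center).symm z)).J a)

theorem LocalFrame.isOpen_coordDom : IsOpen σ.coordDom :=
  (chartAt E σ.center).isOpen_inter_preimage_symm σ.dom_open

theorem LocalFrame.contDiffOn_coordFrame (a : Fin 3) :
    ContDiffOn ℝ ∞ (fun z => σ.coordFrame z a) σ.coordDom := by
  have h1 := (σ.smooth a).coord σ.dom_open σ.dom_subset
  have h2 := h1.comp ((contMDiffOn_chart_symm (x := σ.center) (I := 𝓘(ℝ, E)) (n := ∞)).mono
    (fun z (hz : z ∈ σ.coordDom) => hz.1)) (fun z hz => hz.2)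
  exact h2.contDiffOn

/-- The endomorphism B = ∇_v J a provided by the hypothesis lies in Q. Evaluated on coordinate
fields, its conjugate by `coordIso` is `covEnd`, and conjugation carries the span of the frame to
the span of the coordinate frame. -/
theorem LocalFrame.covEnd_mem_span {cov : Connection E M} {z : E} (hz : z ∈ σ.coordDom)
    (hcov : ∀ (U : Set M) (A : ∀ m : M, EndT E m), IsOpen U → SmoothEndOn A U →
      (∀ m ∈ U, A m ∈ Q.fiber m) → ∀ m ∈ U, ∀ X : TangentSpace 𝓘(ℝ, E) m, ∃ B ∈ Q.fiber m,
      ∀ Y : ∀ m : M, TangentSpace 𝓘(ℝ, E) m, MDiffAt (T% Y) m →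
        B (Y m) = cov (fun m' => A m' (Y m')) m X - A m (cov Y m X)) (v : E) (a : Fin 3) :
    covEnd (chartForm cov σ.center) σ.coordFrame z v a ∈
      Submodule.span ℝ (Set.range (σ.coordFrame z)) := by
  set x := σ.center with hx
  set m := (chartAt E x).symm z with hm
  have hms := (chartAt E x).map_target hz.1
  obtain ⟨B, hB, hBY⟩ := hcov σ.dom (fun m => (σ.frame m).J a) σ.dom_open (σ.smooth a)
    (fun m _ => by
      rw [← (σ.frame m).span_eq]
      exact Submodule.subset_span ⟨a, rfl⟩) m hz.2 (coordField x v m)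
  have hJd : DifferentiableAt ℝ (fun y => σ.coordFrame y a) z :=
    ((σ.contDiffOn_coordFrame a).contDiffAt (σ.isOpen_coordDom.mem_nhds hz)).differentiableAt
      (by simp)
  have key : covEnd (chartForm cov x) σ.coordFrame z v a = clmConj (coordIso x m) B := by
    ext w
    have hAY : MDiffAt (T% (fun m' => (σ.frame m').J a (coordField x w m'))) m := by
      rw [mdifferentiableAt_section_iff_coord hms]
      exact mdifferentiableAt_of_comp_symm (chart_mem_atlas E x) hz.1
        (hJd.clm_apply (differentiableAt_const w))
    have h1 := coordIso_cov cov hz.1 hAY v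
    have h2 : fieldInChart x (fun m' => (σ.frame m').J a (coordField x w m')) =
        fun y => σ.coordFrame y a w := rfl
    have h3 : clmConj (coordIso x m) B w = coordIso x m (B (coordField x w m)) := rfl
    have h4 : coordIso x m ((σ.frame m).J a (cov (coordField x w) m (coordField x v m))) =
        σ.coordFrame z a (chartForm cov x z v w) := by
      rw [chartForm_apply cov hz.1]
      change _ = coordIso x m ((σ.frame m).J a ((coordIso x m).symm (coordIso x m _)))
      rw [ContinuousLinearEquiv.symm_apply_apply]
    rw [h3, hBY _ (mdifferentiableAt_coordField hms w), map_sub, h4, h1, h2, covEnd,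
      fderiv_clm_apply_const hJd]
    simp only [add_apply, sub_apply, mul_apply_eq_comp]
    abel
  rw [key]
  rw [← (σ.frame m).span_eq] at hB
  have h5 := Submodule.mem_map_of_mem (f := (clmConj (coordIso x m)).toLinearMap) hB
  rw [Submodule.map_span, ← Set.range_comp] at h5
  exact h5

theorem LocalFrame.preservesQuaternionic [T2Space M] {om : TwoForm E M} {cov : Connection E M}
    (hcov : IsAdaptedTorsionFree Q om cov) :
    PreservesQuaternionic σ.coordDom (chartForm cov σ.center) σ.coordFrame where
  isOpen := σ.isOpen_coordDom
  contDiffOn_form := (contDiffOn_chartForm hcov.smooth σ.center).mono fun _ hz => hz.1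
  contDiffOn_frame := σ.contDiffOn_coordFrame
  quaternionic _ _ := (σ.frame _).quaternionic.map _
  covEnd_mem _ hz v a := σ.covEnd_mem_span hz hcov.preserves_Q v a

theorem LocalFrame.inChart_hermitian {om : TwoForm E M} (hom : IsScalarTwoForm Q om) {z : E}
    (hz : z ∈ σ.coordDom) (c : Fin 3) (a b : E) :
    om.inChart (chartAt E σ.center) z ![σ.coordFrame z c a, σ.coordFrame z c b] =
      om.inChart (chartAt E σ.center) z ![a, b] := by
  have h : ∀ a, coordField σ.center (σ.coordFrame z c a) ((chartAt E σ.center).symm z) =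
      (σ.frame _).J c (coordField σ.center a ((chartAt E σ.center).symm z)) := fun a =>
    (coordIso σ.center ((chartAt E σ.center).symm z)).symm_apply_apply _
  rw [om.inChart_chartAt_apply hz.1, om.inChart_chartAt_apply hz.1, h, h]
  exact hom.hermitian _ _ _ _ _

end LocalFrameCoordinates

/-! ### Derivatives of determinants -/

section Determinant

variable {E : Type*} [NormedAddCommGroup E] [NormedSpace ℝ E] [FiniteDimensional ℝ E]

theorem fderiv_det_one (A : E →L[ℝ] E) :
    fderiv ℝ (fun B : E →L[ℝ] E => LinearMap.det (B : E →ₗ[ℝ] E)) 1 A = clmTrace E A := by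
  have h0 : DifferentiableAt ℝ (fun B : E →L[ℝ] E => LinearMap.det (B : E →ₗ[ℝ] E))
      (1 + (0 : ℝ) • A) := (contDiff_clm_det E).differentiable (by simp) _
  have h1 : HasDerivAt (fun t : ℝ => 1 + t • A) A 0 := by
    simpa using ((hasDerivAt_id (0 : ℝ)).smul_const A).const_add 1
  have h2 := h0.hasFDerivAt.comp_hasDerivAt (0 : ℝ) h1
  set N := LinearMap.toMatrix (Module.finBasis ℝ E) (Module.finBasis ℝ E) (A : E →ₗ[ℝ] E) with hN
  have h3 : ∀ t : ℝ, LinearMap.det ((1 + t • A : E →L[ℝ] E) : E →ₗ[ℝ] E) = (1 + t • N).det := by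
    intro t
    rw [← LinearMap.det_toMatrix (Module.finBasis ℝ E), hN]
    congr 1
    rw [← LinearMap.toMatrix_one (Module.finBasis ℝ E), ← map_smul, ← map_add]
    rfl
  obtain ⟨P, hP⟩ : ∃ P : Polynomial ℝ, ∀ t : ℝ, (1 + t • N).det = 1 + N.trace * t + P.eval t * t ^ 2 :=
    ⟨_, fun t => Matrix.det_one_add_smul t N⟩
  have h4 : HasDerivAt (fun t : ℝ => 1 + N.trace * t + P.eval t * t ^ 2) N.trace 0 := by
    have k1 := ((hasDerivAt_id (0 : ℝ)).const_mul N.trace).const_add 1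
    have k2 := (P.hasDerivAt 0).mul ((hasDerivAt_id (0 : ℝ)).pow 2)
    exact (k1.add k2).congr_deriv (by simp)
  have h5 : HasDerivAt (fun t : ℝ => LinearMap.det ((1 + t • A : E →L[ℝ] E) : E →ₗ[ℝ] E))
      N.trace 0 := by
    simpa only [h3, hP] using h4
  have h6 := h2.unique h5
  simp only [zero_smul, add_zero] at h6
  rw [h6, hN]
  exact (LinearMap.trace_eq_matrix_trace ℝ (Module.finBasis ℝ E) (A : E →ₗ[ℝ] E)).symm

/-- The logarithmic derivative of a determinant. -/
theorem fderiv_log_det {F : Type*} [NormedAddCommGroup F] [NormedSpace ℝ F] {T : F → E →L[ℝ] E}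
    {S : E →L[ℝ] E} {p : F} (hT : DifferentiableAt ℝ T p) (hS : S * T p = 1) (h : F) :
    DifferentiableAt ℝ (fun y => Real.log (LinearMap.det (T y : E →ₗ[ℝ] E))) p ∧
    fderiv ℝ (fun y => Real.log (LinearMap.det (T y : E →ₗ[ℝ] E))) p h =
      clmTrace E (S * fderiv ℝ T p h) := by
  have hdet : ∀ A B : E →L[ℝ] E, LinearMap.det ((A * B : E →L[ℝ] E) : E →ₗ[ℝ] E) =
      LinearMap.det (A : E →ₗ[ℝ] E) * LinearMap.det (B : E →ₗ[ℝ] E) := fun A B =>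
    LinearMap.det_comp (A : E →ₗ[ℝ] E) (B : E →ₗ[ℝ] E)
  have hone : LinearMap.det ((1 : E →L[ℝ] E) : E →ₗ[ℝ] E) = 1 := LinearMap.det_id
  have hST : LinearMap.det (S : E →ₗ[ℝ] E) * LinearMap.det (T p : E →ₗ[ℝ] E) = 1 := by
    rw [← hdet, hS, hone]
  -- Writing det T(y) = det T(p) · det(S T(y)) moves the base point to S T(p) = 1, the only place
  -- where the derivative of det is needed.
  have hd : DifferentiableAt ℝ (fun B : E →L[ℝ] E => LinearMap.det (B : E →ₗ[ℝ] E)) (S * T p) :=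
    (contDiff_clm_det E).differentiable (by simp) _
  have hST' : DifferentiableAt ℝ (fun y => S * T y) p := hT.const_mul S
  have h1 := hd.hasFDerivAt.comp p (f := fun y => S * T y) hST'.hasFDerivAt
  have h2 : HasFDerivAt (fun y => LinearMap.det (S : E →ₗ[ℝ] E) * LinearMap.det (T y : E →ₗ[ℝ] E))
      (fderiv ℝ (fun B : E →L[ℝ] E => LinearMap.det (B : E →ₗ[ℝ] E)) (S * T p) ∘L
        fderiv ℝ (fun y => S * T y) p) p := by
    refine h1.congr_of_eventuallyEq (Filter.Eventually.of_forall fun y => ?_)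
    exact (hdet S (T y)).symm
  have h3 := h2.const_mul (LinearMap.det (T p : E →ₗ[ℝ] E))
  have h4 : (fun y => LinearMap.det (T p : E →ₗ[ℝ] E) *
      (LinearMap.det (S : E →ₗ[ℝ] E) * LinearMap.det (T y : E →ₗ[ℝ] E))) =
      fun y => LinearMap.det (T y : E →ₗ[ℝ] E) := by
    ext y
    rw [← mul_assoc, mul_comm (LinearMap.det (T p : E →ₗ[ℝ] E)), hST, one_mul]
  rw [h4] at h3
  have hne : LinearMap.det (T p : E →ₗ[ℝ] E) ≠ 0 := right_ne_zero_of_mul_eq_one hST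
  have h5 := h3.log hne
  refine ⟨h5.differentiableAt, ?_⟩
  have h6 : fderiv ℝ (fun y => S * T y) p h = S * fderiv ℝ T p h := by
    rw [fderiv_const_mul hT]; rfl
  rw [h5.fderiv, hS]
  simp only [smul_apply, ContinuousLinearMap.comp_apply, h6, fderiv_det_one, smul_eq_mul]
  rw [← mul_assoc, inv_mul_cancel₀ hne, one_mul]

end Determinant

/-! ### Change of chart for the connection coefficients -/

section ConnectionCoefficients

variable {E : Type*} [NormedAddCommGroup E] [NormedSpace ℝ E] {M : Type*} [TopologicalSpace M]
  [ChartedSpace E M] [IsManifold 𝓘(ℝ, E) ∞ M] {x m : M} {z : E}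

theorem coordIso_extend {m' : M} (hm : m' ∈ (chartAt E m).source) (y : TangentSpace 𝓘(ℝ, E) m) :
    coordIso m m' (FiberBundle.extend E y m') = coordIso m m y := by
  have h : m' ∈ (trivializationAt E (TangentSpace 𝓘(ℝ, E)) m).baseSet := hm
  rw [coordIso_eq_snd hm, coordIso_eq_snd (mem_chart_source E m), FiberBundle.extend,
    Bundle.Trivialization.apply_mk_symm _ h]

theorem coordTrans_mul_coordTrans (x x' m : M) :
    (coordTrans (E := E) x x' m : E →L[ℝ] E) * (coordTrans (E := E) x' x m : E →L[ℝ] E) = 1 := by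
  ext v
  change coordIso x' m ((coordIso x m).symm (coordIso x m ((coordIso x' m).symm v))) = v
  rw [ContinuousLinearEquiv.symm_apply_apply, ContinuousLinearEquiv.apply_symm_apply]

theorem contDiffAt_coordTrans (hz : z ∈ (chartAt E x).target)
    (hm : (chartAt E x).symm z ∈ (chartAt E m).source) :
    ContDiffAt ℝ ∞ (fun y => (coordTrans (E := E) m x ((chartAt E x).symm y) : E →L[ℝ] E)) z ∧
    ContDiffAt ℝ ∞ (fun y => (coordTrans (E := E) x m ((chartAt E x).symm y) : E →L[ℝ] E)) z := by
  have hs : ContMDiffAt 𝓘(ℝ, E) 𝓘(ℝ, E) ∞ (chartAt E x).symm z :=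
    (contMDiffOn_chart_symm (x := x)).contMDiffAt ((chartAt E x).open_target.mem_nhds hz)
  have h1 : (chartAt E x).source ∩ (chartAt E m).source ∈ 𝓝 ((chartAt E x).symm z) :=
    ((chartAt E x).open_source.inter (chartAt E m).open_source).mem_nhds
      ⟨(chartAt E x).map_target hz, hm⟩
  constructor
  · exact (((contMDiffOn_coordIso x m).contMDiffAt h1).comp z hs).contDiffAt
  · rw [Set.inter_comm] at h1
    exact (((contMDiffOn_coordIso m x).contMDiffAt h1).comp z hs).contDiffAt

variable [FiniteDimensional ℝ E] [Nontrivial E]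

/-- The inhomogeneous transformation law of Christoffel symbols: the field extending y has constant
coordinates in the chart at m, hence coordinates T y in the chart at x, with T the coordinate
change, and the derivative of T enters. -/
theorem coordIso_connCoeff (cov : Connection E M) (hz : z ∈ (chartAt E x).target)
    (hm : m = (chartAt E x).symm z) (v : E) (y : TangentSpace 𝓘(ℝ, E) m) :
    coordIso x m (connCoeff cov m (coordField x v m) y) =
      fderiv ℝ (fun y => (coordTrans (E := E) m x ((chartAt E x).symm y) : E →L[ℝ] E)) z v
        (coordIso m m y) + chartForm cov x z v (coordIso x m y) := by
  have h1 := coordIso_cov cov hz (hm ▸ FiberBundle.mdifferentiableAt_extend 𝓘(ℝ, E) E y) v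
  rw [← hm] at h1
  have hms : (chartAt E x).symm z ∈ (chartAt E m).source := hm ▸ mem_chart_source E m
  have hT := (contDiffAt_coordTrans (m := m) hz hms).1.differentiableAt (by simp)
  have h2 : fieldInChart x (FiberBundle.extend E y) =ᶠ[𝓝 z] fun z' =>
      (coordTrans (E := E) m x ((chartAt E x).symm z') : E →L[ℝ] E) (coordIso m m y) := by
    have hc : ContinuousAt (chartAt E x).symm z := (chartAt E x).continuousAt_symm hz
    filter_upwards [hc.preimage_mem_nhds ((chartAt E m).open_source.mem_nhds
      hms)] with z' hz'
    rw [← coordIso_extend hz' y]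
    change _ = coordIso x _ ((coordIso m _).symm (coordIso m _ _))
    rw [ContinuousLinearEquiv.symm_apply_apply]
    rfl
  have h3 : fieldInChart x (FiberBundle.extend E y) z = coordIso x m y := by
    rw [fieldInChart, ← hm, FiberBundle.extend_apply_self]
  rw [h2.fderiv_eq, fderiv_clm_apply_const hT, h3] at h1
  exact h1

end ConnectionCoefficients

/-! ### The connection form of the Swann bundle in bundle coordinates -/

section SwannChart

variable {E : Type*} [NormedAddCommGroup E] [NormedSpace ℝ E] {M : Type*} [TopologicalSpace M]
  [ChartedSpace E M] [IsManifold 𝓘(ℝ, E) ∞ M] [FiniteDimensional ℝ E] [Nontrivial E]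
  {Q : AlmostQuaternionicStructure E M} (σ : LocalFrame Q) {p : SwannModel E}

/-- The chart of the Swann bundle given by a local frame, as a homeomorphism. -/
noncomputable def LocalFrame.homeo : OpenPartialHomeomorph (SwannBundle Q) (SwannModel E) :=
  (swannCore Q).openPartialHomeomorph σ.chart ⟨σ, rfl⟩

theorem LocalFrame.homeo_mem_atlas : σ.homeo ∈ atlas (SwannModel E) (SwannBundle Q) := by
  have h : σ.homeo ∈ ⋃ (f : PartialEquiv (SwannBundle Q) (E × ℝ × (Fin 3 → ℝ)))
      (hf : f ∈ (swannCore Q).atlas), {(swannCore Q).openPartialHomeomorph f hf} := by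
    simp only [Set.mem_iUnion, Set.mem_singleton_iff]
    exact ⟨σ.chart, ⟨σ, rfl⟩, rfl⟩
  exact h

theorem LocalFrame.vol_homeo_symm (p : SwannModel E) :
    (σ.homeo.symm p).vol = Density.ofLog σ.center _ p.2.1 := rfl

/-- The differential of the inverse of the chart given by a local frame. -/
noncomputable def LocalFrame.tangentMap (p h : SwannModel E) : SwannTangent (σ.homeo.symm p) :=
  mfderiv 𝓘(ℝ, SwannModel E) 𝓘(ℝ, SwannModel E) σ.homeo.symm p h

theorem LocalFrame.tangentMap_surjective (hp : p ∈ σ.homeo.target) :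
    Function.Surjective (σ.tangentMap p) :=
  ((mdifferentiable_of_mem_atlas (I := 𝓘(ℝ, SwannModel E)) σ.homeo_mem_atlas).symm.mfderiv_bijective
    hp).2

theorem LocalFrame.tangentMap_injective (hp : p ∈ σ.homeo.target) :
    Function.Injective (σ.tangentMap p) :=
  ((mdifferentiable_of_mem_atlas (I := 𝓘(ℝ, SwannModel E)) σ.homeo_mem_atlas).symm.mfderiv_bijective
    hp).1

theorem LocalFrame.tangentMap_add (p h k : SwannModel E) :
    σ.tangentMap p (h + k) = σ.tangentMap p h + σ.tangentMap p k := map_add _ _ _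

theorem LocalFrame.mdifferentiableAt_base (hp : p ∈ σ.homeo.target) :
    MDifferentiableAt 𝓘(ℝ, SwannModel E) 𝓘(ℝ, E) (SwannBundle.base (Q := Q)) (σ.homeo.symm p) := by
  have h1 : MDifferentiableAt 𝓘(ℝ, SwannModel E) 𝓘(ℝ, E)
      (fun q : SwannModel E => (chartAt E σ.center).symm q.1) p :=
    (mdifferentiableAt_atlas_symm (chart_mem_atlas E σ.center) hp.1).comp (I' := 𝓘(ℝ, E)) p
      (differentiableAt_fst.mdifferentiableAt)
  have h2 : MDifferentiableAt 𝓘(ℝ, SwannModel E) 𝓘(ℝ, SwannModel E) σ.homeo (σ.homeo.symm p) :=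
    mdifferentiableAt_atlas σ.homeo_mem_atlas (σ.homeo.map_target hp)
  have h3 : MDifferentiableAt 𝓘(ℝ, SwannModel E) 𝓘(ℝ, E)
      (fun q : SwannModel E => (chartAt E σ.center).symm q.1) (σ.homeo (σ.homeo.symm p)) := by
    rw [σ.homeo.right_inv hp]; exact h1
  refine (h3.comp (σ.homeo.symm p) h2).congr_of_eventuallyEq ?_
  filter_upwards [σ.homeo.open_source.mem_nhds (σ.homeo.map_target hp)] with u hu
  conv_lhs => rw [← σ.homeo.left_inv hu]
  rfl

/-- In the two charts the bundle projection is the first projection of the model space. -/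
theorem LocalFrame.dproj_tangentMap (hp : p ∈ σ.homeo.target) (h : SwannModel E) :
    dproj (σ.homeo.symm p) (σ.tangentMap p h) =
      coordField σ.center h.1 (σ.homeo.symm p).base := by
  have h1 := mfderiv_comp_apply p (σ.mdifferentiableAt_base hp)
    (mdifferentiableAt_atlas_symm σ.homeo_mem_atlas hp) h
  have h2 : MDifferentiableAt 𝓘(ℝ, SwannModel E) 𝓘(ℝ, E) (fun q : SwannModel E => q.1) p :=
    differentiableAt_fst.mdifferentiableAt
  have h3 := mfderiv_comp_apply p (mdifferentiableAt_atlas_symm (I := 𝓘(ℝ, E))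
    (chart_mem_atlas E σ.center) hp.1) h2 h
  have h4 : mfderiv 𝓘(ℝ, SwannModel E) 𝓘(ℝ, E) (fun q : SwannModel E => q.1) p h = h.1 := by
    rw [mfderiv_eq_fderiv, fderiv_fst]
    rfl
  have h5 := mfderiv_chartAt_symm_apply hp.1 h.1
  refine h1.symm.trans (Eq.trans ?_ h5)
  refine Eq.trans h3 ?_
  rw [h4]

theorem LocalFrame.tangentMap_mem_vertical (hp : p ∈ σ.homeo.target) (h : SwannModel E) :
    σ.tangentMap p h ∈ vertical (σ.homeo.symm p) ↔ h.1 = 0 := by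
  have h1 : σ.tangentMap p h ∈ vertical (σ.homeo.symm p) ↔
      dproj (σ.homeo.symm p) (σ.tangentMap p h) = 0 := Iff.rfl
  rw [h1, σ.dproj_tangentMap hp]
  exact map_eq_zero_iff _ (coordIso σ.center (σ.homeo.symm p).base).symm.injective

theorem LocalFrame.mvfderiv_tangentMap {G : Type*} [NormedAddCommGroup G] [NormedSpace ℝ G]
    (hp : p ∈ σ.homeo.target) {f : SwannBundle Q → G}
    (hf : DifferentiableAt ℝ (fun q => f (σ.homeo.symm q)) p) (h : SwannModel E) :
    mvfderiv 𝓘(ℝ, SwannModel E) f (σ.homeo.symm p) (σ.tangentMap p h) =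
      fderiv ℝ (fun q => f (σ.homeo.symm q)) p h :=
  mvfderiv_mfderiv_symm σ.homeo_mem_atlas hp
    (mdifferentiableAt_of_comp_symm σ.homeo_mem_atlas hp hf) h

theorem LocalFrame.clmConj_frame_homeo_symm (p : SwannModel E) (a : Fin 3) :
    clmConj (coordIso σ.center (σ.homeo.symm p).base) ((σ.homeo.symm p).frame.J a) =
      tautFrame σ.coordFrame p a :=
  map_quatRot (clmConj (coordIso σ.center ((chartAt E σ.center).symm p.1)))
    (σ.frame ((chartAt E σ.center).symm p.1)).J (onePlus p.2.2) a

theorem fderiv_comp_fst {F G : Type*} [NormedAddCommGroup F] [NormedSpace ℝ F]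
    [NormedAddCommGroup G] [NormedSpace ℝ G] {f : E → G} {p : E × F}
    (hf : DifferentiableAt ℝ f p.1) (h : E × F) :
    fderiv ℝ (fun q : E × F => f q.1) p h = fderiv ℝ f p.1 h.1 := by
  have := fderiv_comp (𝕜 := ℝ) p (g := f) (f := fun q : E × F => q.1) hf differentiableAt_fst
  rw [Function.comp_def] at this
  rw [this, fderiv_fst]
  rfl

variable {cov : Connection E M}

theorem LocalFrame.mem_chartAt_base_source (p : SwannModel E) :
    (chartAt E σ.center).symm p.1 ∈ (chartAt E (σ.homeo.symm p).base).source :=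
  mem_chart_source E (σ.homeo.symm p).base

/-- `nablaFrame` is defined in the preferred chart at the base point, which moves with that point,
while the right side uses the fixed chart of σ. The derivatives of the coordinate change coming from
the frame and from `connCoeff` cancel. -/
theorem LocalFrame.coordIso_nablaFrame
    (hp : p ∈ σ.homeo.target) (a : Fin 3)
    (hJ : DifferentiableAt ℝ (fun q => tautFrame σ.coordFrame q a) p)
    (h : SwannModel E) (y : TangentSpace 𝓘(ℝ, E) (σ.homeo.symm p).base) :
    coordIso σ.center (σ.homeo.symm p).base
        (nablaFrame cov (σ.homeo.symm p) a (σ.tangentMap p h) y) =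
      (fderiv ℝ (fun q => tautFrame σ.coordFrame q a) p h +
        (chartForm cov σ.center p.1 h.1 * tautFrame σ.coordFrame p a -
          tautFrame σ.coordFrame p a * chartForm cov σ.center p.1 h.1))
        (coordIso σ.center (σ.homeo.symm p).base y) := by
  revert y
  set x := σ.center with hx
  set u := σ.homeo.symm p with hu
  set m := u.base with hm
  set T : E → E →L[ℝ] E := fun z => (coordTrans (E := E) m x ((chartAt E x).symm z) : E →L[ℝ] E)
    with hT
  set S : E → E →L[ℝ] E := fun z => (coordTrans (E := E) x m ((chartAt E x).symm z) : E →L[ℝ] E)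
    with hS
  intro y
  have hTd : DifferentiableAt ℝ T p.1 :=
    (contDiffAt_coordTrans hp.1 (σ.mem_chartAt_base_source p)).1.differentiableAt (by simp)
  have hSd : DifferentiableAt ℝ S p.1 :=
    (contDiffAt_coordTrans hp.1 (σ.mem_chartAt_base_source p)).2.differentiableAt (by simp)
  have hTS : ∀ z, T z * S z = 1 := fun z => coordTrans_mul_coordTrans m x _
  have hTS' : fderiv ℝ T p.1 h.1 * S p.1 + T p.1 * fderiv ℝ S p.1 h.1 = 0 := by
    have := fderiv_fun_mul_apply hTd hSd h.1
    simp only [hTS, fderiv_const_apply, zero_apply] at this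
    rw [this]
    abel
  -- In the chart at m the frame is its expression in the chart of σ conjugated by the coordinate
  -- change, T being kept as a function of the base point.
  have hf : (fun q : SwannModel E => clmConj (coordIso m (σ.homeo.symm q).base)
      ((σ.homeo.symm q).frame.J a)) = fun q => S q.1 * tautFrame σ.coordFrame q a * T q.1 := by
    ext1 q
    rw [← σ.clmConj_frame_homeo_symm]
    ext w
    change _ = coordIso m (σ.homeo.symm q).base ((coordIso x (σ.homeo.symm q).base).symm
      (coordIso x (σ.homeo.symm q).base ((σ.homeo.symm q).frame.J a
        ((coordIso x (σ.homeo.symm q).base).symm (coordIso x (σ.homeo.symm q).base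
          ((coordIso m (σ.homeo.symm q).base).symm w))))))
    rw [ContinuousLinearEquiv.symm_apply_apply, ContinuousLinearEquiv.symm_apply_apply]
    rfl
  have hS1 : DifferentiableAt ℝ (fun q : SwannModel E => S q.1) p := hSd.comp p differentiableAt_fst
  have hT1 : DifferentiableAt ℝ (fun q : SwannModel E => T q.1) p := hTd.comp p differentiableAt_fst
  have hSJ : DifferentiableAt ℝ (fun q : SwannModel E => S q.1 * tautFrame σ.coordFrame q a) p :=
    hS1.mul hJ
  have hfd : DifferentiableAt ℝ (fun q : SwannModel E => clmConj (coordIso m (σ.homeo.symm q).base)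
      ((σ.homeo.symm q).frame.J a)) p := by
    rw [hf]
    exact hSJ.mul hT1
  have h1 := σ.mvfderiv_tangentMap hp
    (f := fun u' : SwannBundle Q => clmConj (coordIso m u'.base) (u'.frame.J a)) hfd h
  rw [hf, fderiv_fun_mul_apply hSJ hT1, fderiv_fun_mul_apply hS1 hJ,
    fderiv_comp_fst hSd, fderiv_comp_fst hTd] at h1
  set A := tautFrame σ.coordFrame p a with hA
  set A' := fderiv ℝ (fun q => tautFrame σ.coordFrame q a) p h with hA'
  set T' := fderiv ℝ T p.1 h.1 with hT'
  set S' := fderiv ℝ S p.1 h.1 with hS'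
  set Γ := chartForm cov x p.1 h.1 with hΓ
  have hc0 : ∀ y, coordIso m m y = S p.1 (coordIso x m y) := fun y => by
    change _ = coordIso m m ((coordIso x m).symm (coordIso x m y))
    rw [ContinuousLinearEquiv.symm_apply_apply]
  have hconn : ∀ y, coordIso x m (connCoeff cov m (dproj u (σ.tangentMap p h)) y) =
      (T' * S p.1 + Γ) (coordIso x m y) := fun y => by
    rw [σ.dproj_tangentMap hp]
    refine (coordIso_connCoeff (m := m) cov hp.1 rfl h.1 y).trans ?_
    rw [hc0]
    rfl
  have hJ' : ∀ y, coordIso x m (u.frame.J a y) = A (coordIso x m y) := fun y => by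
    rw [hA, ← σ.clmConj_frame_homeo_symm]
    change _ = coordIso x m (u.frame.J a ((coordIso x m).symm (coordIso x m y)))
    rw [ContinuousLinearEquiv.symm_apply_apply]
  have h2 : nablaFrame cov u a (σ.tangentMap p h) y =
      (coordIso m m).symm (mvfderiv 𝓘(ℝ, SwannModel E)
        (fun u' : SwannBundle Q => clmConj (coordIso m u'.base) (u'.frame.J a)) u
        (σ.tangentMap p h) (coordIso m m y)) +
      (connCoeff cov m (dproj u (σ.tangentMap p h)) (u.frame.J a y) -
        u.frame.J a (connCoeff cov m (dproj u (σ.tangentMap p h)) y)) := rfl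
  have h3 : ∀ w, coordIso x m ((coordIso m m).symm w) = T p.1 w := fun w => rfl
  rw [h2, h1, map_add, map_sub, hconn, hJ', hJ', hconn, h3, hc0]
  -- With T S = 1 and T S' = -T' S, the conjugation contributes [A, T'S], which the connection
  -- coefficients T'S + Γ undo.
  have key : T p.1 * ((S p.1 * A * T' + (S p.1 * A' + S' * A) * T p.1) * S p.1) +
      ((T' * S p.1 + Γ) * A - A * (T' * S p.1 + Γ)) = A' + (Γ * A - A * Γ) := by
    have e1 : T p.1 * S p.1 = 1 := hTS p.1
    have e2 : T p.1 * S' = -(T' * S p.1) := by rw [eq_neg_iff_add_eq_zero, add_comm]; exact hTS'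
    have e3 : T p.1 * ((S p.1 * A * T' + (S p.1 * A' + S' * A) * T p.1) * S p.1) =
        (T p.1 * S p.1) * A * (T' * S p.1) + ((T p.1 * S p.1) * A' + (T p.1 * S') * A) *
          (T p.1 * S p.1) := by noncomm_ring
    rw [e3, e1, e2]
    noncomm_ring
  exact congrArg (fun L : E →L[ℝ] E => L (coordIso x m y)) key

/-- Changing charts adds log det T to the density coordinate and T'S to the connection coefficients.
The logarithmic derivative of det T is the trace of S T', so the two corrections cancel. -/
theorem LocalFrame.thetaZero_tangentMap (hp : p ∈ σ.homeo.target) (h : SwannModel E) :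
    thetaZero cov (σ.homeo.symm p) (σ.tangentMap p h) =
      h.2.1 - clmTrace E (chartForm cov σ.center p.1 h.1) := by
  set x := σ.center with hx
  set u := σ.homeo.symm p with hu
  set m := u.base with hm
  set T : E → E →L[ℝ] E := fun z => (coordTrans (E := E) m x ((chartAt E x).symm z) : E →L[ℝ] E)
    with hT
  set S : E →L[ℝ] E := (coordTrans (E := E) x m m : E →L[ℝ] E) with hS
  have hTd : DifferentiableAt ℝ T p.1 :=
    (contDiffAt_coordTrans hp.1 (σ.mem_chartAt_base_source p)).1.differentiableAt (by simp)
  have hST : S * T p.1 = 1 := coordTrans_mul_coordTrans x m m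
  have hlog := fderiv_log_det hTd hST h.1
  have hf : (fun q : SwannModel E => (σ.homeo.symm q).vol.logCoord m) = fun q =>
      q.2.1 + Real.log (LinearMap.det (T q.1 : E →ₗ[ℝ] E)) := by
    ext1 q
    rw [σ.vol_homeo_symm, Density.logCoord_ofLog]
    rfl
  have hd1 : DifferentiableAt ℝ (fun q : SwannModel E => q.2.1) p := by fun_prop
  have hd2 : DifferentiableAt ℝ
      (fun q : SwannModel E => Real.log (LinearMap.det (T q.1 : E →ₗ[ℝ] E))) p :=
    hlog.1.comp p differentiableAt_fst
  have h1 := σ.mvfderiv_tangentMap hp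
    (f := fun u' : SwannBundle Q => u'.vol.logCoord m) (by rw [hf]; exact hd1.add hd2) h
  have h4 : fderiv ℝ (fun q : SwannModel E => q.2.1) p h = h.2.1 := by
    have := ((hasFDerivAt_id (𝕜 := ℝ) p).snd).fst
    exact congrArg (fun L => L h) this.fderiv
  rw [hf, fderiv_fun_add hd1 hd2, add_apply, h4,
    fderiv_comp_fst (f := fun z => Real.log (LinearMap.det (T z : E →ₗ[ℝ] E))) hlog.1,
    hlog.2] at h1
  have h2 : thetaZero cov u (σ.tangentMap p h) =
      mvfderiv 𝓘(ℝ, SwannModel E) (fun u' : SwannBundle Q => u'.vol.logCoord m) u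
        (σ.tangentMap p h) -
      LinearMap.trace ℝ (TangentSpace 𝓘(ℝ, E) m)
        (connCoeff cov m (dproj u (σ.tangentMap p h))) := rfl
  have h3 : LinearMap.trace ℝ (TangentSpace 𝓘(ℝ, E) m)
      (connCoeff cov m (dproj u (σ.tangentMap p h))) =
      clmTrace E (fderiv ℝ T p.1 h.1 * S + chartForm cov x p.1 h.1) := by
    have k := LinearMap.trace_conj' (connCoeff cov m (dproj u (σ.tangentMap p h)))
      (coordIso x m).toLinearEquiv
    rw [← k]
    refine congrArg (LinearMap.trace ℝ E) (LinearMap.ext fun w => ?_)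
    rw [σ.dproj_tangentMap hp]
    refine (coordIso_connCoeff cov hp.1 rfl h.1 ((coordIso x m).symm w)).trans ?_
    exact congrArg (fun e : E => fderiv ℝ T p.1 h.1 (S w) + chartForm cov x p.1 h.1 e)
      ((coordIso x m).apply_symm_apply w)
  rw [h2, h1, h3, map_add, clmTrace_mul_comm]
  ring

/-- The lifts of constant vector fields span the horizontal spaces. -/
theorem LocalFrame.liftField_mem_horizontal
    (hpq : PreservesQuaternionic σ.coordDom (chartForm cov σ.center) σ.coordFrame)
    (hp : p ∈ σ.homeo.target) (v : E) :
    σ.tangentMap p (liftField (chartForm cov σ.center) σ.coordFrame v p) ∈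
      horizontal cov (σ.homeo.symm p) := by
  refine Submodule.mem_inf.2 ⟨?_, (Submodule.mem_iInf _).2 fun a => ?_⟩
  · rw [LinearMap.mem_ker, σ.thetaZero_tangentMap hp]
    exact sub_self _
  -- θ_a is a trace built from ∇I_{a+1}, which vanishes because the tautological frame is parallel
  -- along the lift.
  · have h1 : nablaFrame cov (σ.homeo.symm p) (a + 1)
        (σ.tangentMap p (liftField (chartForm cov σ.center) σ.coordFrame v p)) = 0 := by
      ext y
      apply (coordIso σ.center (σ.homeo.symm p).base).injective
      rw [σ.coordIso_nablaFrame hp (a + 1)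
        ((hpq.contDiffAt_tautFrame hp (a + 1)).differentiableAt (by simp)),
        hpq.fderiv_tautFrame hp v (a + 1)]
      change ((_ : E →L[ℝ] E) + (chartForm cov σ.center p.1 v * _ -
        _ * chartForm cov σ.center p.1 v)) _ = _
      rw [sub_add_sub_cancel, sub_self]
      exact (map_zero _).symm
    rw [LinearMap.mem_ker, theta, LinearMap.smul_apply, LinearMap.comp_apply,
      LinearMap.comp_apply, h1, map_zero, map_zero, smul_zero]

end SwannChart

/-! ### Closed vertical forms and the conclusion -/

section ClosedVerticalForms

variable {E : Type*} [NormedAddCommGroup E] [NormedSpace ℝ E] {M : Type*} [TopologicalSpace M]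
  [ChartedSpace E M] [IsManifold 𝓘(ℝ, E) ∞ M] [FiniteDimensional ℝ E] [Nontrivial E]
  {Q : AlmostQuaternionicStructure E M} (σ : LocalFrame Q) {p : SwannModel E}
  {om : TwoForm E M} {cov : Connection E M}

theorem LocalFrame.inChart_homeo_apply (β : TwoForm (SwannModel E) (SwannBundle Q))
    (p a b : SwannModel E) : β.inChart σ.homeo p ![a, b] =
      β (σ.homeo.symm p) ![σ.tangentMap p a, σ.tangentMap p b] := by
  have h : (mfderiv 𝓘(ℝ, SwannModel E) 𝓘(ℝ, SwannModel E) σ.homeo.symm p) ∘ ![a, b] =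
      ![σ.tangentMap p a, σ.tangentMap p b] := by
    ext1 i
    fin_cases i <;> rfl
  exact congrArg (β (σ.homeo.symm p)) h

theorem LocalFrame.sub_liftField_mem_vertical (hp : p ∈ σ.homeo.target)
    (Γ : E → E →L[ℝ] E →L[ℝ] E) (ξ : SwannModel E) :
    σ.tangentMap p (ξ - liftField Γ σ.coordFrame ξ.1 p) ∈ vertical (σ.homeo.symm p) := by
  rw [σ.tangentMap_mem_vertical hp]
  exact sub_self _

/-- The horizontal part is the lift of the base component; the remainder has base component zero. -/
theorem LocalFrame.exists_horizontal_add_vertical [T2Space M]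
    (hcov : IsAdaptedTorsionFree Q om cov) (hp : p ∈ σ.homeo.target)
    (η : SwannTangent (σ.homeo.symm p)) :
    ∃ ζ ∈ horizontal cov (σ.homeo.symm p), ∃ κ ∈ vertical (σ.homeo.symm p), η = ζ + κ := by
  obtain ⟨ξ, rfl⟩ := σ.tangentMap_surjective hp η
  refine ⟨_, σ.liftField_mem_horizontal (σ.preservesQuaternionic hcov) hp ξ.1, _,
    σ.sub_liftField_mem_vertical hp (chartForm cov σ.center) ξ, ?_⟩
  rw [← σ.tangentMap_add, add_sub_cancel]

/-- Translates the geometric hypotheses into the coordinate statement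
`PreservesQuaternionic.formCurvature_eq_zero`, with B the form β in the bundle chart of σ. -/
theorem LocalFrame.formCurvature_eq_zero [T2Space M] (hom : IsScalarTwoForm Q om)
    (hcov : IsAdaptedTorsionFree Q om cov) {β : TwoForm (SwannModel E) (SwannBundle Q)}
    (hβ : β.IsSmooth) (hver : IsVerticalForm cov β) (hnd : IsNondegenerateOnVertical β)
    (hd : ∀ p ∈ σ.homeo.target, extDeriv (β.inChart σ.homeo) p = 0) {z : E}
    (hz : z ∈ σ.coordDom) (v w : E) :
    formCurvature (chartForm cov σ.center) z v w = 0 := by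
  have hpq := σ.preservesQuaternionic hcov
  refine hpq.formCurvature_eq_zero (fun z hz => chartForm_symm hcov.torsion_free hz.1)
    ((hom.smooth _ (chart_mem_atlas E σ.center)).mono fun z hz => hz.1)
    (fun z hz => TwoForm.inChart_parallel hom.smooth hcov.preserves_om hz.1)
    (fun z hz a => hom.nondegenerate.inChart hz.1)
    (fun z hz => σ.inChart_hermitian hom hz) (B := β.inChart σ.homeo)
    (fun p hp => ((hβ _ σ.homeo_mem_atlas).contDiffAt
      (σ.homeo.open_target.mem_nhds hp)).differentiableAt (by simp))
    (fun p hp => hd p hp) (fun p hp v ξ => ?_) (fun p hp k hk h => ?_) hz v w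
  · have h1 := hver _ _ (σ.liftField_mem_horizontal hpq hp v)
    -- Verticality of β controls horizontal and vertical arguments only, so an arbitrary ξ is split
    -- into the two kinds.
    have h2 : ξ = liftField (chartForm cov σ.center) σ.coordFrame ξ.1 p +
        (ξ - liftField (chartForm cov σ.center) σ.coordFrame ξ.1 p) := by abel
    have h3 := h1.1 _ (σ.liftField_mem_horizontal hpq hp ξ.1)
    have h4 := h1.2 _ (σ.sub_liftField_mem_vertical hp (chartForm cov σ.center) ξ)
    rw [← σ.inChart_homeo_apply, ← altBilin_apply] at h3 h4
    rw [← altBilin_apply, h2, map_add, h3, h4, add_zero]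
  · have h1 : σ.tangentMap p k = 0 := by
      refine hnd _ _ ((σ.tangentMap_mem_vertical hp k).2 hk) fun η hη => ?_
      obtain ⟨k', rfl⟩ := σ.tangentMap_surjective hp η
      rw [← σ.inChart_homeo_apply]
      exact h k' ((σ.tangentMap_mem_vertical hp k').1 hη)
    exact σ.tangentMap_injective hp (h1.trans (map_zero _).symm)

/-- A closed vertical two-form that is non-degenerate on the vertical spaces exists only in the
flat case. -/
theorem curvature_eq_zero_of_closed_vertical [T2Space M] (hom : IsScalarTwoForm Q om)
    (hcov : IsAdaptedTorsionFree Q om cov) {β : TwoForm (SwannModel E) (SwannBundle Q)}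
    (hβ : β.IsSmooth) (hver : IsVerticalForm cov β) (hnd : IsNondegenerateOnVertical β)
    (hd : ∀ σ : LocalFrame Q, ∀ p ∈ σ.homeo.target, extDeriv (β.inChart σ.homeo) p = 0) :
    ¬ CurvatureNeZero cov := by
  rintro ⟨X, Y, Z, hX, hY, hZ, m, hne⟩
  obtain ⟨s⟩ := Q.nonempty_frame m
  -- Any point above m serves; it is only used to obtain a local frame defined around m.
  obtain ⟨σ, hσ⟩ := exists_localFrame (⟨m, Density.ofLog m m 0, s⟩ : SwannBundle Q)
  have hm : m ∈ (chartAt E σ.center).source := σ.dom_subset hσ.1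
  have hmz : (chartAt E σ.center).symm (chartAt E σ.center m) = m :=
    (chartAt E σ.center).left_inv hm
  have hz : chartAt E σ.center m ∈ σ.coordDom :=
    ⟨(chartAt E σ.center).map_source hm, by rw [hmz]; exact hσ.1⟩
  have h1 := coordIso_curvature hcov.smooth hcov.torsion_free hz.1 hX hY hZ
  rw [σ.formCurvature_eq_zero hom hcov hβ hver hnd (hd σ) hz, hmz] at h1
  exact hne ((map_eq_zero_iff _ (coordIso σ.center m).injective).1 h1)

theorem LocalFrame.inChart_pullback_base (hp : p ∈ σ.homeo.target) :
    TwoForm.inChart (TwoForm.pullback (SwannBundle.base (Q := Q)) om) σ.homeo p =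
      (om.inChart (chartAt E σ.center) p.1).compContinuousLinearMap
        (fderiv ℝ (fun q : SwannModel E => q.1) p) := by
  ext ξ
  refine congrArg (om ((chartAt E σ.center).symm p.1)) (funext fun i => ?_)
  refine (σ.dproj_tangentMap hp (ξ i)).trans ?_
  refine (mfderiv_chartAt_symm_apply hp.1 (ξ i).1).symm.trans ?_
  rw [fderiv_fst]
  rfl

/-- In the charts the pull-back is along the first projection, and d commutes with pull-back. -/
theorem LocalFrame.extDeriv_pullback_base (hom : om.IsSmooth)
    (hd : ∀ z ∈ (chartAt E σ.center).target, extDeriv (om.inChart (chartAt E σ.center)) z = 0)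
    (hp : p ∈ σ.homeo.target) :
    DifferentiableAt ℝ
      (TwoForm.inChart (TwoForm.pullback (SwannBundle.base (Q := Q)) om) σ.homeo) p ∧
    extDeriv (TwoForm.inChart (TwoForm.pullback (SwannBundle.base (Q := Q)) om) σ.homeo) p = 0 := by
  have hev : TwoForm.inChart (TwoForm.pullback (SwannBundle.base (Q := Q)) om) σ.homeo =ᶠ[𝓝 p]
      fun q => (om.inChart (chartAt E σ.center) q.1).compContinuousLinearMap
        (fderiv ℝ (fun q : SwannModel E => q.1) q) := by
    filter_upwards [σ.homeo.open_target.mem_nhds hp] with q hq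
    exact σ.inChart_pullback_base hq
  have hs := ((hom _ (chart_mem_atlas E σ.center)).contDiffAt
    ((chartAt E σ.center).open_target.mem_nhds hp.1)).differentiableAt (by simp)
  constructor
  · refine DifferentiableAt.congr_of_eventuallyEq ?_ hev
    simp only [fderiv_fst]
    exact (ContinuousAlternatingMap.compContinuousLinearMapCLM
      (ContinuousLinearMap.fst ℝ E (ℝ × (Fin 3 → ℝ)))).differentiableAt.comp p
      (hs.comp p differentiableAt_fst)
  · rw [hev.extDeriv_eq, extDeriv_pullback (r := 2) hs contDiff_fst.contDiffAt (by simp), hd _ hp.1]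
    ext
    rfl

end ClosedVerticalForms

theorem theorem3p8 {n : ℕ} (hn : 1 < n)
    {E : Type*} [NormedAddCommGroup E] [NormedSpace ℝ E] [FiniteDimensional ℝ E] [Nontrivial E]
    (hE : Module.finrank ℝ E = 4 * n)
    {M : Type*} [TopologicalSpace M] [ChartedSpace E M] [IsManifold 𝓘(ℝ, E) ∞ M]
    [T2Space M] [SecondCountableTopology M]
    (Q : AlmostQuaternionicStructure E M) (om : TwoForm E M) (hom : IsScalarTwoForm Q om)
    (cov : Connection E M) (hcov : IsAdaptedTorsionFree Q om cov) (hR : CurvatureNeZero cov) :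
    (¬ ∃ β : TwoForm (SwannModel E) (SwannBundle Q),
      β.IsSmooth ∧ IsHHermitian cov β ∧ IsVerticalForm cov β ∧ IsNondegenerateOnVertical β ∧
        β.IsClosed) ∧
    (¬ ∃ β : TwoForm (SwannModel E) (SwannBundle Q),
      β.IsSmooth ∧ IsVerticalForm cov β ∧
        IsHHermitian cov (TwoForm.pullback SwannBundle.base om + β) ∧
        (TwoForm.pullback SwannBundle.base om + β).IsSymplectic) := by
  refine ⟨?_, ?_⟩
  · rintro ⟨β, hβ, -, hver, hnd, hd⟩
    exact curvature_eq_zero_of_closed_vertical hom hcov hβ hver hnd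
      (fun σ p hp => hd _ σ.homeo_mem_atlas p hp) hR
  · rintro ⟨β, hβ, hver, -, hsymp⟩
    -- Let ξ be vertical and β-orthogonal to the vertical vectors. It is β-orthogonal to the
    -- horizontal ones since β is vertical, and π̂*ω annihilates it; so it lies in the kernel of the
    -- symplectic sum.
    have hnd : IsNondegenerateOnVertical β := by
      intro u ξ hξ h
      obtain ⟨σ, hσ⟩ := exists_localFrame u
      obtain ⟨p, hp, rfl⟩ : ∃ p ∈ σ.homeo.target, σ.homeo.symm p = u :=
        ⟨_, σ.homeo.map_source hσ, σ.homeo.left_inv hσ⟩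
      refine hsymp.nondegenerate _ ξ fun η => ?_
      obtain ⟨ζ, hζ, κ, hκ, rfl⟩ := σ.exists_horizontal_add_vertical hcov hp η
      have h1 : ∀ η, TwoForm.pullback SwannBundle.base om (σ.homeo.symm p) ![ξ, η] = 0 := by
        intro η
        refine (om (σ.homeo.symm p).base).map_coord_zero 0 ?_
        exact hξ
      have h2 : β (σ.homeo.symm p) ![ξ, ζ + κ] =
          altBilin (E := SwannModel E) (β (σ.homeo.symm p)) ξ (ζ + κ) := rfl
      have h3 : altBilin (E := SwannModel E) (β (σ.homeo.symm p)) ξ ζ = 0 :=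
        (altBilin_swap (E := SwannModel E) _ ξ ζ).trans (neg_eq_zero.2 ((hver _ ζ hζ).2 ξ hξ))
      have h4 : altBilin (E := SwannModel E) (β (σ.homeo.symm p)) ξ κ = 0 := h κ hκ
      have h5 : β (σ.homeo.symm p) ![ξ, ζ + κ] = 0 :=
        h2.trans ((map_add _ _ _).trans ((congrArg₂ (· + ·) h3 h4).trans (add_zero 0)))
      exact (congrArg₂ (· + ·) (h1 (ζ + κ)) h5).trans (add_zero 0)
    refine curvature_eq_zero_of_closed_vertical hom hcov hβ hver hnd (fun σ p hp => ?_) hR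
    -- ω is closed, being parallel for a torsion-free connection; subtracting its pull-back from the
    -- closed sum leaves dβ = 0.
    have hdom : ∀ z ∈ (chartAt E σ.center).target,
        extDeriv (om.inChart (chartAt E σ.center)) z = 0 := fun z hz =>
      extDeriv_eq_zero_of_parallel
        (((hom.smooth _ (chart_mem_atlas E σ.center)).contDiffAt
          ((chartAt E σ.center).open_target.mem_nhds hz)).differentiableAt (by simp))
        (chartForm_symm hcov.torsion_free hz)
        (TwoForm.inChart_parallel hom.smooth hcov.preserves_om hz)
    have h1 := σ.extDeriv_pullback_base hom.smooth hdom hp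
    have h2 : DifferentiableAt ℝ (β.inChart σ.homeo) p := ((hβ _ σ.homeo_mem_atlas).contDiffAt
      (σ.homeo.open_target.mem_nhds hp)).differentiableAt (by simp)
    have h3 : TwoForm.inChart (TwoForm.pullback SwannBundle.base om + β) σ.homeo =
        TwoForm.inChart (TwoForm.pullback SwannBundle.base om) σ.homeo + β.inChart σ.homeo := rfl
    have h4 := hsymp.closed _ σ.homeo_mem_atlas p hp
    rw [h3, extDeriv_add h1.1 h2, h1.2, zero_add] at h4
    exact h4
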